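/- **Setting.** Consider rank-3 real tensors with symmetry $O(N)^3$ (colours red, green, blue) and two sextic interactions, given by labelled interaction graphs on the fields $1,\dots,6$. The *prism* has red edges $16,23,45$, green edges $12,34,56$ and blue edges $13,25,46$. The *wheel* ($K_{3,3}$) has red edges $16,23,45$, green edges $12,34,56$ and blue edges $14,25,36$. A *colour permutation symmetry* of an interaction is a permutation of its fields that carries the edges of each colour $c$ to those of $\pi(c)$ for some permutation $\pi$ of the colours; it is an *automorphism* if $\pi=1$. A *free-energy diagram* is either the *0-cycle* (one closed propagator, no interaction vertex, three index loops), or a nonempty finite set of interaction vertices, each a prism or a wheel, with a complete Wick contraction of their fields (a pairing of all the fields) that makes the diagram connected. Diagrams are identified up to renaming vertices and relabelling the fields of each vertex by automorphisms. An index loop of colour $c$ is a closed line alternating between Wick contractions and edges of colour $c$ inside vertices; $f_{tot}$ is the total number of index loops of all three colours (the power of $N$). A free-energy diagram is *maximal* if its $f_{tot}$ is the largest among all free-energy diagrams with the same number of interaction vertices. **Cycles.** A *1-cycle* $\langle X,Y\rangle$ at a vertex is a contraction of its fields $X$ and $Y$. A *mixed 2-cycle* $(\langle X_L,Y_R\rangle,\langle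 Z_L,W_R\rangle)$ consists of two distinct contractions, of field $X$ of a prism vertex $L$ with field $Y$ of a wheel vertex $R$, and of field $Z$ of $L$ with field $W$ of $R$. Two mixed 2-cycles are *equivalent* if they are related by a colour permutation acting on both vertices simultaneously, together with automorphisms acting on each vertex independently. The *snail pairing* is $\{16,25,34\}$ for the prism and, for the wheel, $\{12,36,45\}$ or its image under an automorphism. Two legs are *joined* if they are contracted with each other or are the two external legs of a subgraph with exactly two external legs, which does not contain the vertices of the cycle. A 1-cycle $\langle X,Y\rangle$ has *snail form* if $XY$ is a pair of a snail pairing of its vertex and the other two pairs are joined. A mixed 2-cycle is a *double snail* if $XZ$ is a pair of a snail pairing of $L$ whose other two pairs are joined, and $YW$ is a pair of a snail pairing of $R$ whose other two pairs are joined. It *yields an elementary melon* if the other four legs of $L$ are joined one-to-one with the other four legs of $R$. **Moves.** The *prism moves* are: replacing a propagator by an elementary snail (the one-vertex diagram with contractions $16,25,34$, with any one of its propagators cut); replacing a propagator by an elementary melon (two prisms, each field of one contracted with the same field of the other, with any one propagator cut); and vertex expansion, which replaces a prism vertex $P$ by two prism vertices $L,R$ with $\langle i_L,i_R\rangle$ contracted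 for $i=1,2,3$, where fields $1,2,3$ of $P$ become $6_L,5_L,4_L$ and fields $4,5,6$ of $P$ become $4_R,5_R,6_R$. The *wheel moves* are: replacing a propagator by an elementary snail (contractions $12,36,45$, any propagator cut), or by an elementary melon (two wheels, each field contracted with the same field of the other, any propagator cut). **Theorem.** In the theory with both the prism and the wheel interaction: 1. Every mixed 2-cycle $(\langle X_L,Y_R\rangle,\langle Z_L,W_R\rangle)$ with $X\ne Z$, $Y\ne W$ falls, up to equivalence, under exactly one of the following forms: (1) $(\langle 1_L,1_R\rangle,\langle 2_L,W_R\rangle)$ for some $W$; (2) $(\langle 1_L,1_R\rangle,\langle 4_L,W_R\rangle)$ for some $W$; (3) $(\langle 1_L,1_R\rangle,\langle 6_L,2_R\rangle)$; (4) $(\langle 1_L,1_R\rangle,\langle 6_L,3_R\rangle)$; (5) $(\langle 1_L,1_R\rangle,\langle 6_L,6_R\rangle)$. 2. Every 1-cycle in a maximal diagram has snail form. 3. Every mixed 2-cycle in a maximal diagram is equivalent to form (3) or (5), and is a double snail; it yields no elementary melon. (In particular forms (1), (2), (4) do not occur in maximal diagrams.) 4. Every mixed 2-cycle equivalent to form (3)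 or (5) occurs in some maximal diagram. 5. A diagram is maximal if and only if it can be generated from the 0-cycle by finitely many prism moves and wheel moves. -/

import Mathlib

namespace PrismWheel

open Equiv

/-- The three colours, one for each factor of the symmetry group `O(N)³`. -/
inductive Colour
  | red
  | green
  | blue
  deriving DecidableEq

instance : Fintype Colour :=
  ⟨{.red, .green, .blue}, fun c => by cases c <;> simp⟩

/-- The two sextic maximally-single-trace interactions of rank-3 tensors. -/
inductive Interaction
  | prism
  | wheel
  deriving DecidableEq

instance : Fintype Interaction :=
  ⟨{.prism, .wheel}, fun k => by cases k <;> simp⟩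

open Colour Interaction

/-- Labels of the six field-vertices of an interaction. Labels are read modulo `6`, so that the
literals `1, 2, 3, 4, 5, 6` are the six labels used in the literature. -/
abbrev Field6 : Type := Fin 6

/-- The labelled interaction graphs: `edge k c` exchanges the end points of each edge of
colour `c` in the interaction graph of `k`. -/
def edge : Interaction → Colour → Perm Field6
  | prism, red => swap 1 6 * swap 2 3 * swap 4 5
  | prism, green => swap 1 2 * swap 3 4 * swap 5 6
  | prism, blue => swap 1 3 * swap 2 5 * swap 4 6
  | wheel, red => swap 1 6 * swap 2 3 * swap 4 5
  | wheel, green => swap 1 2 * swap 3 4 * swap 5 6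
  | wheel, blue => swap 1 4 * swap 2 5 * swap 3 6

/-- `α` is a colour permutation symmetry of the interaction `k`, inducing the permutation `π` of
the colours: it carries the edges of colour `c` to the edges of colour `π c`. -/
def IsColourSymmetry (k : Interaction) (π : Perm Colour) (α : Perm Field6) : Prop :=
  ∀ c, α * edge k c * α⁻¹ = edge k (π c)

/-- Automorphisms of an interaction: the symmetries that keep every colour. -/
def IsAutomorphism (k : Interaction) (α : Perm Field6) : Prop :=
  IsColourSymmetry k 1 α

/-! ### Vacuum Feynman diagrams -/

/-- A Feynman diagram without external legs in the theory with both interactions. A half-edge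
`(v, i)` is the field labelled `i` of the interaction vertex `v`; `wick` is the complete Wick
contraction. A propagator closed on itself, with no interaction vertex on it, is not visible in the
half-edges; `circles` is the number of these. -/
structure Diagram where
  V : Type
  finite : Finite V
  kind : V → Interaction
  wick : V × Field6 → V × Field6
  wick_wick : ∀ h, wick (wick h) = h
  wick_ne : ∀ h, wick h ≠ h
  circles : ℕ

namespace Diagram

/-- The number of interaction vertices. -/
noncomputable def numVertices (D : Diagram) : ℕ := Nat.card D.V

/-- Two half-edges are consecutive on a line of colour `c` of the multi-line diagram if they are
Wick contracted or are joined by an edge of colour `c` inside an interaction vertex. -/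
def Consecutive (D : Diagram) (c : Colour) (h h' : D.V × Field6) : Prop :=
  h' = D.wick h ∨ h' = (h.1, edge (D.kind h.1) c h.2)

/-- The closed loops of colour `c` that pass through some interaction vertex. -/
def Loop (D : Diagram) (c : Colour) : Type := Quot (D.Consecutive c)

/-- The total number of index loops, that is the exponent of `N`. A circle carries one loop
of each colour. -/
noncomputable def fTotal (D : Diagram) : ℕ :=
  Nat.card (D.Loop red) + Nat.card (D.Loop green) + Nat.card (D.Loop blue) + 3 * D.circles

/-- Two interaction vertices are adjacent if a field of one is contracted with a field of the
other. -/
def Adj (D : Diagram) (u v : D.V) : Prop := ∃ i j, D.wick (u, i) = (v, j)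

/-- The diagram with no interaction vertices: a single closed propagator. -/
def IsZeroCycle (D : Diagram) : Prop := IsEmpty D.V ∧ D.circles = 1

/-- Connected vacuum diagrams, i.e. those that contribute to the free energy. -/
def Connected (D : Diagram) : Prop :=
  D.IsZeroCycle ∨
    (Nonempty D.V ∧ D.circles = 0 ∧ ∀ u v : D.V, Relation.ReflTransGen D.Adj u v)

/-- A maximal diagram contributes to the free energy and has the largest number of index loops
among all such diagrams with as many interaction vertices. -/
def IsMaximal (D : Diagram) : Prop :=
  D.Connected ∧
    ∀ D' : Diagram, D'.Connected → D'.numVertices = D.numVertices → D'.fTotal ≤ D.fTotal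

/-- `D` and `D'` are the same diagram: they differ by the names of the interaction vertices and by
relabelling the fields of each vertex by an automorphism of its interaction. -/
def Same (D D' : Diagram) : Prop :=
  D'.circles = D.circles ∧
    ∃ (φ : D.V ≃ D'.V) (α : D.V → Perm Field6),
      (∀ v, D'.kind (φ v) = D.kind v) ∧ (∀ v, IsAutomorphism (D.kind v) (α v)) ∧
      ∀ h : D.V × Field6,
        D'.wick (φ h.1, α h.1 h.2) = (φ (D.wick h).1, α (D.wick h).1 (D.wick h).2)

end Diagram

/-! ### Melonic moves -/

/-- The contractions of the elementary snail closed to a vacuum diagram with one vertex. -/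
def snailPairing : Interaction → Perm Field6
  | prism => swap 1 6 * swap 2 5 * swap 3 4
  | wheel => swap 1 2 * swap 3 6 * swap 4 5

theorem snailPairing_snailPairing (k : Interaction) (i : Field6) :
    snailPairing k (snailPairing k i) = i := by
  revert k i; decide

theorem snailPairing_ne (k : Interaction) (i : Field6) : snailPairing k i ≠ i := by
  revert k i; decide

/-- The vacuum diagram that yields the elementary snail when one of its propagators is cut. -/
def closedSnail (k : Interaction) : Diagram where
  V := Unit
  finite := inferInstance
  kind := fun _ => k
  wick := fun h => (h.1, snailPairing k h.2)
  wick_wick := fun h => Prod.ext rfl (snailPairing_snailPairing k h.2)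
  wick_ne := fun h e => snailPairing_ne k h.2 (congrArg Prod.snd e)
  circles := 0

/-- The vacuum diagram that yields the elementary melons when one of its propagators is cut: two
vertices of the same kind, each field of one contracted with the same field of the other. -/
def closedMelon (k : Interaction) : Diagram where
  V := Bool
  finite := inferInstance
  kind := fun _ => k
  wick := fun h => (!h.1, h.2)
  wick_wick := fun h => Prod.ext (Bool.not_not h.1) rfl
  wick_ne := fun h e => Bool.not_ne_self h.1 (congrArg Prod.fst e)
  circles := 0

/-- `D'` arises from `D` by replacing one propagator of `D` by the diagram with two external legs
that is obtained by cutting a propagator of the vacuum diagram `E` (which has no circles). The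
propagator of `D` is either the contraction `{h, wick h}` or a circle. In the first case `h` and
`wick h` get contracted with the two ends of the cut propagator `{a, wick a}` of `E`; in the second
case the cut is closed again. -/
def ReplacesPropagator (E D D' : Diagram) : Prop :=
  ∃ φ : D.V ⊕ E.V ≃ D'.V,
    (∀ v, D'.kind (φ (Sum.inl v)) = D.kind v) ∧
    (∀ v, D'.kind (φ (Sum.inr v)) = E.kind v) ∧
    ((D'.circles = D.circles ∧ ∃ (h : D.V × Field6) (a : E.V × Field6),
        D'.wick (φ (Sum.inl h.1), h.2) = (φ (Sum.inr a.1), a.2) ∧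
        D'.wick (φ (Sum.inl (D.wick h).1), (D.wick h).2) =
          (φ (Sum.inr (E.wick a).1), (E.wick a).2) ∧
        (∀ k, k ≠ h → k ≠ D.wick h →
          D'.wick (φ (Sum.inl k.1), k.2) = (φ (Sum.inl (D.wick k).1), (D.wick k).2)) ∧
        (∀ b, b ≠ a → b ≠ E.wick a →
          D'.wick (φ (Sum.inr b.1), b.2) = (φ (Sum.inr (E.wick b).1), (E.wick b).2))) ∨
     (D'.circles + 1 = D.circles ∧
        (∀ k, D'.wick (φ (Sum.inl k.1), k.2) = (φ (Sum.inl (D.wick k).1), (D.wick k).2)) ∧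
        (∀ b, D'.wick (φ (Sum.inr b.1), b.2) = (φ (Sum.inr (E.wick b).1), (E.wick b).2))))

open Classical in
/-- Where the half-edges of a diagram go when its vertex `P` is expanded into the two vertices
`none` (the left one) and `some P` (the right one): the fields `1, 2, 3` of `P` become the
fields `6, 5, 4` of the left vertex, the fields `4, 5, 6` of `P` those of the right vertex. -/
noncomputable def expandLeg {V : Type} (P : V) (h : V × Field6) : Option V × Field6 :=
  if h.1 = P ∧ h.2 = 1 then (none, 6)
  else if h.1 = P ∧ h.2 = 2 then (none, 5)
  else if h.1 = P ∧ h.2 = 3 then (none, 4)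
  else (some h.1, h.2)

/-- Vertex expansion: a prism vertex of `D` is replaced by two prism vertices whose
fields `1, 2, 3` are contracted with each other. -/
def ExpandsVertex (D D' : Diagram) : Prop :=
  ∃ (P : D.V) (φ : Option D.V ≃ D'.V),
    D.kind P = prism ∧ D'.circles = D.circles ∧
    D'.kind (φ none) = prism ∧ (∀ v, D'.kind (φ (some v)) = D.kind v) ∧
    (∀ i : Field6, i = 1 ∨ i = 2 ∨ i = 3 → D'.wick (φ none, i) = (φ (some P), i)) ∧
    ∀ h : D.V × Field6,
      D'.wick (φ (expandLeg P h).1, (expandLeg P h).2) =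
        (φ (expandLeg P (D.wick h)).1, (expandLeg P (D.wick h)).2)

/-- The melonic moves of the theory with the prism interaction only. -/
def PrismMove (D D' : Diagram) : Prop :=
  ReplacesPropagator (closedSnail prism) D D' ∨ ReplacesPropagator (closedMelon prism) D D' ∨
    ExpandsVertex D D'

/-- The melonic moves of the theory with the wheel interaction only. -/
def WheelMove (D D' : Diagram) : Prop :=
  ReplacesPropagator (closedSnail wheel) D D' ∨ ReplacesPropagator (closedMelon wheel) D D'

/-- The diagrams generated from the 0-cycle by the melonic moves of the prism theory and of the
wheel theory. -/
inductive Melonic : Diagram → Prop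
  | zeroCycle (D : Diagram) : D.IsZeroCycle → Melonic D
  | prismMove (D D' : Diagram) : Melonic D → PrismMove D D' → Melonic D'
  | wheelMove (D D' : Diagram) : Melonic D → WheelMove D D' → Melonic D'
  | same (D D' : Diagram) : Melonic D → D.Same D' → Melonic D'

/-! ### Cycles -/

namespace Diagram

/-- Once the vertices in `A` are taken out, the legs `h` and `h'` are the two external legs of a
subgraph with exactly these two external legs (`S` is the set of its vertices), or are directly
contracted with each other (`S` is empty). -/
def Joined (D : Diagram) (A : Set D.V) (h h' : D.V × Field6) : Prop :=
  ∃ S : Set D.V, Disjoint S A ∧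
    ∀ k : D.V × Field6, (k.1 ∈ S ∨ k = h ∨ k = h') →
      ((D.wick k).1 ∈ S ∨ D.wick k = h ∨ D.wick k = h')

end Diagram

/-- The pairings of the fields of an interaction as in the elementary snail, up to
automorphisms. -/
def IsSnailPairing (k : Interaction) (s : Perm Field6) : Prop :=
  ∃ α, IsAutomorphism k α ∧ s = α * snailPairing k * α⁻¹

namespace Diagram

/-- A 1-cycle through the vertex `v`: its fields `x` and `y` are contracted. -/
def IsOneCycle (D : Diagram) (v : D.V) (x y : Field6) : Prop := D.wick (v, x) = (v, y)

/-- The diagram has the form of an elementary snail at `v` with one propagator `⟨x, y⟩`, the other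
two propagators being replaced by subgraphs with two external legs. -/
def IsSnailForm (D : Diagram) (v : D.V) (x y : Field6) : Prop :=
  ∃ s, IsSnailPairing (D.kind v) s ∧ s x = y ∧
    ∀ i, i ≠ x → i ≠ y → D.Joined {v} (v, i) (v, s i)

/-- A 2-cycle `(⟨x_L, y_R⟩, ⟨z_L, w_R⟩)` through a prism vertex `L` and a wheel vertex `R`. -/
def IsMixedTwoCycle (D : Diagram) (L R : D.V) (x y z w : Field6) : Prop :=
  D.kind L = prism ∧ D.kind R = wheel ∧ x ≠ z ∧
    D.wick (L, x) = (R, y) ∧ D.wick (L, z) = (R, w)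

/-- The 2-cycle comes from the insertion of two elementary snails, at `L` with external
legs `x, z` and at `R` with external legs `y, w`: the other four legs of `L` are joined in pairs as
in a snail, by subgraphs with two external legs, and so are the other four legs of `R`. -/
def IsDoubleSnail (D : Diagram) (L R : D.V) (x y z w : Field6) : Prop :=
  (∃ s, IsSnailPairing (D.kind L) s ∧ s x = z ∧
    ∀ i, i ≠ x → i ≠ z → D.Joined {L, R} (L, i) (L, s i)) ∧
  ∃ s, IsSnailPairing (D.kind R) s ∧ s y = w ∧
    ∀ i, i ≠ y → i ≠ w → D.Joined {L, R} (R, i) (R, s i)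

/-- The 2-cycle yields an elementary melon: the other four legs of `L` are joined one by one to the
other four legs of `R`, by subgraphs with two external legs. -/
def IsMelonForm (D : Diagram) (L R : D.V) (x y z w : Field6) : Prop :=
  ∃ ρ : Perm Field6, ρ x = y ∧ ρ z = w ∧
    ∀ i, i ≠ x → i ≠ z → D.Joined {L, R} (L, i) (R, ρ i)

end Diagram

/-- Equivalence of mixed 2-cycles `(⟨x_L, y_R⟩, ⟨z_L, w_R⟩)`, `(⟨x'_L, y'_R⟩, ⟨z'_L, w'_R⟩)`: colour
permutations act on both vertices simultaneously, automorphisms on each vertex independently. -/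
def EquivalentMixed (x y z w x' y' z' w' : Field6) : Prop :=
  ∃ (π : Perm Colour) (α β : Perm Field6),
    IsColourSymmetry prism π α ∧ IsColourSymmetry wheel π β ∧
      α x = x' ∧ β y = y' ∧ α z = z' ∧ β w = w'

/-- The five forms of mixed 2-cycles:
`(⟨1,1⟩, ⟨2,W⟩)`, `(⟨1,1⟩, ⟨4,W⟩)`, `(⟨1,1⟩, ⟨6,2⟩)`, `(⟨1,1⟩, ⟨6,3⟩)`, `(⟨1,1⟩, ⟨6,6⟩)`,
with the prism field first in each contraction. -/
inductive MixedForm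
  | form1
  | form2
  | form3
  | form4
  | form5

/-- The mixed 2-cycle `(⟨x_L, y_R⟩, ⟨z_L, w_R⟩)` is equivalent to one of the given form. -/
def HasForm (x y z w : Field6) : MixedForm → Prop
  | .form1 => ∃ W, EquivalentMixed x y z w 1 1 2 W
  | .form2 => ∃ W, EquivalentMixed x y z w 1 1 4 W
  | .form3 => EquivalentMixed x y z w 1 1 6 2
  | .form4 => EquivalentMixed x y z w 1 1 6 3
  | .form5 => EquivalentMixed x y z w 1 1 6 6

end PrismWheel

/-!
The propagators together with the index loops of two colours form a ribbon graph with hexagonal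
vertices, whose Euler characteristic is at most 2. Summed over the pairs of colours, this gives
`f_tot ≤ 3 V + 3` for a diagram with `V` interaction vertices, with equality for rings of elementary
snails. So, apart from the 0-cycle, the maximal diagrams are the connected ones whose ribbon graphs
are planar for every pair of colours, which means that every colour has exactly `V + 1` index loops.

The Euler inequalities for the two sides of a cut into connected parts show that, in a planar
diagram, every index loop that crosses the cut does so exactly twice. Hence at each vertex either
the legs are joined along a snail pairing, or no index loop passes twice. A vertex in a 1-cycle is
of the first kind, and so are both vertices of a mixed 2-cycle: between two vertices of the second
kind the loops would give either an isomorphism of the prism with the wheel or a triangle in the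
wheel.

The moves preserve connectedness and `f_tot - 3 V`, so what they generate from the 0-cycle is
maximal. Conversely, a smallest nonempty set of vertices with at most two legs in a maximal diagram
either contains an inserted elementary snail or, by counting, an index loop of length less than six.
Such a loop is a 2-cycle, which belongs either to an elementary melon or to two prisms created by a
vertex expansion; undoing the move leaves a smaller maximal diagram.
-/

namespace PrismWheel

open Equiv Colour Interaction

theorem edge_edge (k : Interaction) (c : Colour) (i : Field6) : edge k c (edge k c i) = i := by
  revert k c i; decide

theorem edge_ne (k : Interaction) (c : Colour) (i : Field6) : edge k c i ≠ i := by
  revert k c i; decide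

theorem edge_ne_edge (k : Interaction) {a b : Colour} (hab : a ≠ b) (i : Field6) :
    edge k a i ≠ edge k b i := by
  revert k a b i; decide

theorem hexagon_of_forall_ne_edge (k : Interaction) (c : Colour) (s : Perm Field6)
    (hs : ∀ i, s (s i) = i) (hne : ∀ i, s i ≠ i) (hsc : ∀ i, s i ≠ edge k c i) (i j : Field6) :
    j = i ∨ j = s i ∨ j = edge k c i ∨ j = edge k c (s i) ∨ j = s (edge k c i) ∨
      j = s (edge k c (s i)) := by
  revert k c s i j; decide +kernel

/-! ### Fixed-point-free involutions on finite types -/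

section Involution

variable {α : Type*} {f g : α → α} {T : Set α}

theorem even_ncard_of_involution [Finite α] (hf : ∀ x ∈ T, f x ∈ T)
    (hff : ∀ x ∈ T, f (f x) = x) (hne : ∀ x ∈ T, f x ≠ x) : Even T.ncard := by
  classical
  have : Fintype α := Fintype.ofFinite α
  have h : ∑ _x ∈ T.toFinset, (1 : ZMod 2) = 0 :=
    Finset.sum_involution (fun x _ => f x) (fun _ _ => CharTwo.add_self_eq_zero _)
      (fun x hx _ => hne x (by simpa using hx))
      (fun x hx => by simpa using hf x (by simpa using hx))
      (fun x hx => hff x (by simpa using hx))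
  rw [Set.ncard_eq_toFinset_card', ← ZMod.natCast_eq_zero_iff_even]
  simpa using h

theorem not_mapsTo_sdiff_singleton_of_involution [Finite α] {a : α} (ha : a ∈ T)
    (hf : Set.MapsTo f T T) (hff : f.Involutive) (hne : ∀ x, f x ≠ x)
    (hgg : g.Involutive) (hgne : ∀ x, g x ≠ x) : ¬ Set.MapsTo g (T \ {a}) (T \ {a}) := by
  intro hg
  have hT : Even T.ncard := even_ncard_of_involution hf (fun x _ => hff x) fun x _ => hne x
  have hTa : Even (T \ {a}).ncard :=
    even_ncard_of_involution hg (fun x _ => hgg x) fun x _ => hgne x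
  rw [← Set.ncard_sdiff_singleton_add_one ha] at hT
  exact Nat.even_add_one.1 hT hTa

theorem exists_orientation_of_involutive (hff : f.Involutive) (hne : ∀ x, f x ≠ x) :
    ∃ P : Set α, ∀ x, f x ∈ P ↔ x ∉ P := by
  classical
  let _ : LinearOrder α := IsWellOrder.linearOrder WellOrderingRel
  refine ⟨{x | x < f x}, fun x => ?_⟩
  simp only [Set.mem_ofPred_eq, hff x, not_lt]
  exact (hne x).le_iff_lt.symm

end Involution

section Fibers

variable {α β : Type*} [Finite α] {f : α → β} {T : Set α}

theorem two_mul_ncard_image_le (hf : ∀ y ∈ f '' T, 2 ≤ {x ∈ T | f x = y}.ncard) :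
    2 * (f '' T).ncard ≤ T.ncard := by
  classical
  obtain ⟨t, rfl⟩ := T.toFinite.exists_finset_coe
  simp only [← Finset.coe_image, ← Finset.coe_filter, Finset.mem_coe, Set.ncard_coe_finset] at hf ⊢
  rw [Finset.card_eq_sum_card_image f, mul_comm, ← smul_eq_mul]
  exact Finset.card_nsmul_le_sum _ _ _ hf

theorem ncard_fiber_eq_two_of_two_mul_ncard_image_eq
    (hf : ∀ y ∈ f '' T, 2 ≤ {x ∈ T | f x = y}.ncard) (h : 2 * (f '' T).ncard = T.ncard) {y : β}
    (hy : y ∈ f '' T) : {x ∈ T | f x = y}.ncard = 2 := by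
  classical
  obtain ⟨t, rfl⟩ := T.toFinite.exists_finset_coe
  simp only [← Finset.coe_image, ← Finset.coe_filter, Finset.mem_coe, Set.ncard_coe_finset]
    at hf h hy ⊢
  rw [t.card_eq_sum_card_image f, mul_comm, ← smul_eq_mul, ← Finset.sum_const] at h
  exact ((Finset.sum_eq_sum_iff_of_le hf).1 h y hy).symm

end Fibers

/-! ### Invariant functions -/

section InvariantFunctions

variable (K : Type*) [Field K] {X : Type*}

/-- The functions with values in `K` that are constant along the relation `r` and vanish outside
`A`. They serve as chain groups: `r` generates the cells, and `A` cuts out a subcomplex. -/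
def invariantFunctions (r : X → X → Prop) (A : Set X) : Submodule K (X → K) where
  carrier := {g | (∀ x y, r x y → g x = g y) ∧ ∀ x ∉ A, g x = 0}
  add_mem' hg hk := ⟨fun x y h => congrArg₂ (· + ·) (hg.1 x y h) (hk.1 x y h),
    fun x h => by simp [hg.2 x h, hk.2 x h]⟩
  zero_mem' := ⟨fun _ _ _ => rfl, fun _ _ => rfl⟩
  smul_mem' a _ hg := ⟨fun x y h => congrArg (a * ·) (hg.1 x y h), fun x h => by simp [hg.2 x h]⟩

open Classical in
/-- An invariant function is a function on the classes contained in its support. -/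
noncomputable def invariantFunctionsEquiv (r : X → X → Prop) (A : Set X) :
    invariantFunctions K r A ≃ₗ[K] ({q : Quot r | ∀ x, Quot.mk r x = q → x ∈ A} → K) where
  toFun g q := Quot.lift g.1 g.2.1 q.1
  map_add' g k := by ext ⟨⟨x⟩, _⟩; rfl
  map_smul' a g := by ext ⟨⟨x⟩, _⟩; rfl
  invFun k := ⟨fun x =>
      if h : ∀ y, Quot.mk r y = Quot.mk r x → y ∈ A then k ⟨Quot.mk r x, h⟩ else 0,
    fun x y h => by simp only [Quot.sound h], fun x h => dif_neg fun h' => h (h' x rfl)⟩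
  left_inv g := by
    ext x
    by_cases h : ∀ y, Quot.mk r y = Quot.mk r x → y ∈ A
    · exact dif_pos h
    · obtain ⟨y, hy, hyA⟩ := by simpa only [not_forall] using h
      have hgx : g.1 x = g.1 y := congrArg (Quot.lift g.1 g.2.1) hy.symm
      exact (dif_neg h).trans ((hgx.trans (g.2.2 y hyA)).symm)
  right_inv k := by ext ⟨⟨x⟩, h⟩; exact dif_pos h

variable {K}

theorem finrank_invariantFunctions [Finite X] (r : X → X → Prop) (A : Set X) :
    Module.finrank K (invariantFunctions K r A) =
      {q : Quot r | ∀ x, Quot.mk r x = q → x ∈ A}.ncard := by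
  have : Finite (Quot r) := Finite.of_surjective _ Quot.mk_surjective
  have := Fintype.ofFinite {q : Quot r | ∀ x, Quot.mk r x = q → x ∈ A}
  rw [(invariantFunctionsEquiv K r A).finrank_eq, Module.finrank_fintype_fun_eq_card,
    ← Nat.card_eq_fintype_card, Nat.card_coe_set_eq]

theorem two_mul_finrank_invariantFunctions_le [Finite X] {f : X → X} (hff : f.Involutive)
    (hne : ∀ x, f x ≠ x) (A : Set X) :
    2 * Module.finrank K (invariantFunctions K (fun x y => y = f x) A) ≤
      {x | x ∈ A ∧ f x ∈ A}.ncard := by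
  classical
  obtain ⟨P, hP⟩ := exists_orientation_of_involutive hff hne
  let U := invariantFunctions K (fun x y => y = f x) A
  let I : Set X := {x | x ∈ A ∧ f x ∈ A}
  have hU (g : U) (x : X) : g.1 (f x) = g.1 x := (g.2.1 x _ rfl).symm
  let θ : U × U →ₗ[K] (I → K) :=
    { toFun p x := if x.1 ∈ P then p.1.1 x else p.2.1 x
      map_add' p q := by ext x; dsimp; split_ifs <;> rfl
      map_smul' a p := by ext x; dsimp; split_ifs <;> rfl }
  have hθ : Function.Injective θ := by
    refine (injective_iff_map_eq_zero θ).2 fun p hp => ?_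
    have hzero (x : X) (hx : x ∈ I) : (if x ∈ P then p.1.1 x else p.2.1 x) = 0 :=
      congrFun hp ⟨x, hx⟩
    have hboth (x : X) : p.1.1 x = 0 ∧ p.2.1 x = 0 := by
      by_cases hx : x ∈ I
      · have h1 := hzero x hx
        have h2 := hzero (f x) ⟨hx.2, by rw [hff]; exact hx.1⟩
        rw [hU, hU] at h2
        by_cases hxP : x ∈ P <;> simp_all
      · by_cases hxA : x ∈ A
        · have hfx : f x ∉ A := fun h => hx ⟨hxA, h⟩
          exact ⟨(hU p.1 x).symm.trans (p.1.2.2 _ hfx), (hU p.2 x).symm.trans (p.2.2.2 _ hfx)⟩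
        · exact ⟨p.1.2.2 x hxA, p.2.2.2 x hxA⟩
    exact Prod.ext (Subtype.ext (funext fun x => (hboth x).1))
      (Subtype.ext (funext fun x => (hboth x).2))
  have := Fintype.ofFinite I
  calc 2 * Module.finrank K U = Module.finrank K (U × U) := by rw [Module.finrank_prod, two_mul]
    _ ≤ Module.finrank K (I → K) := LinearMap.finrank_le_finrank_of_injective hθ
    _ = I.ncard := by
      rw [Module.finrank_fintype_fun_eq_card, ← Nat.card_eq_fintype_card, Nat.card_coe_set_eq]

end InvariantFunctions

namespace Diagram

variable (D : Diagram)

instance : Finite D.V := D.finite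

/-- The other end of the edge of colour `c` at a half-edge. -/
def inner (c : Colour) (h : D.V × Field6) : D.V × Field6 := (h.1, edge (D.kind h.1) c h.2)

/-- The index loop of colour `c` through a half-edge. -/
def loop (c : Colour) (h : D.V × Field6) : D.Loop c := Quot.mk _ h

/-- The half-edges of a vertex set that are contracted with half-edges outside: the external legs
of the subdiagram on `S`. -/
def legs (S : Set D.V) : Set (D.V × Field6) := {h | h.1 ∈ S ∧ (D.wick h).1 ∉ S}

/-- The loops of colour `c` that stay in a vertex set. -/
def innerLoops (c : Colour) (S : Set D.V) : Set (D.Loop c) := {l | ∀ h, D.loop c h = l → h.1 ∈ S}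

/-- The subdiagram on a vertex set is connected: no proper nonempty part of it is closed under
contractions. Unlike `Diagram.Connected`, this does not mention circles. -/
def ConnectedOn (S : Set D.V) : Prop :=
  S.Nonempty ∧ ∀ T ⊆ S, T.Nonempty →
    (∀ h : D.V × Field6, h.1 ∈ T → (D.wick h).1 ∈ S → (D.wick h).1 ∈ T) → T = S

variable {D}

theorem inner_inner (c : Colour) (h : D.V × Field6) : D.inner c (D.inner c h) = h :=
  Prod.ext rfl (edge_edge _ _ _)

theorem inner_ne (c : Colour) (h : D.V × Field6) : D.inner c h ≠ h :=
  fun e => edge_ne _ _ _ (congrArg Prod.snd e)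

theorem wick_involutive : Function.Involutive D.wick := D.wick_wick

theorem wick_injective : Function.Injective D.wick := wick_involutive.injective

theorem loop_wick (c : Colour) (h : D.V × Field6) : D.loop c (D.wick h) = D.loop c h :=
  (Quot.sound (r := D.Consecutive c) (Or.inl rfl)).symm

theorem loop_inner (c : Colour) (h : D.V × Field6) : D.loop c (D.inner c h) = D.loop c h :=
  (Quot.sound (r := D.Consecutive c) (Or.inr rfl)).symm

theorem loop_edge (c : Colour) (v : D.V) (i : Field6) :
    D.loop c (v, edge (D.kind v) c i) = D.loop c (v, i) := D.loop_inner c (v, i)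

theorem loop_surjective (c : Colour) : Function.Surjective (D.loop c) := Quot.mk_surjective

instance (c : Colour) : Finite (D.Loop c) := Finite.of_surjective _ (D.loop_surjective c)

theorem mem_of_loop_eq {c : Colour} {T : Set (D.V × Field6)} (hw : ∀ h ∈ T, D.wick h ∈ T)
    (he : ∀ h ∈ T, D.inner c h ∈ T) {h h' : D.V × Field6} (hh : D.loop c h = D.loop c h')
    (hT : h ∈ T) : h' ∈ T := by
  have hwT (k) : k ∈ T ↔ D.wick k ∈ T := ⟨hw k, fun h => D.wick_wick k ▸ hw _ h⟩
  have heT (k) : k ∈ T ↔ D.inner c k ∈ T := ⟨he k, fun h => D.inner_inner c k ▸ he _ h⟩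
  let p : D.Loop c → Prop := Quot.lift (· ∈ T) (by
    rintro k _ (rfl | rfl)
    · exact propext (hwT k)
    · exact propext (heT k))
  exact cast (congrArg p hh) hT

theorem ConnectedOn.induction {S : Set D.V} (hS : D.ConnectedOn S) {p : D.V → Prop} {u v : D.V}
    (hu : u ∈ S) (hpu : p u)
    (step : ∀ h : D.V × Field6, h.1 ∈ S → (D.wick h).1 ∈ S → p h.1 → p (D.wick h).1)
    (hv : v ∈ S) : p v := by
  have hT : {w | w ∈ S ∧ p w} = S := hS.2 _ (fun _ hw => hw.1) ⟨u, hu, hpu⟩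
    fun h hh hw => ⟨hw, step h hh.1 hw hh.2⟩
  exact (hT.symm.subset hv).2

theorem ncard_fields (S : Set D.V) : {h : D.V × Field6 | h.1 ∈ S}.ncard = 6 * S.ncard := by
  have : {h : D.V × Field6 | h.1 ∈ S} = S ×ˢ Set.univ := by ext; simp
  rw [this, Set.ncard_prod, Set.ncard_univ, Nat.card_eq_fintype_card, Fintype.card_fin, mul_comm]

/-! ### The Euler inequality -/

/-- The faces of colour `c` inside `S`, as chains over `ZMod 2`. -/
def loopChains (D : Diagram) (c : Colour) (S : Set D.V) :
    Submodule (ZMod 2) (D.V × Field6 → ZMod 2) :=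
  invariantFunctions (ZMod 2) (D.Consecutive c) {h | h.1 ∈ S}

/-- The propagators inside `S`, as chains over `ZMod 2`. A chain of faces is identified with its
boundary, so that `loopChains` are contained in these. -/
def propagatorChains (D : Diagram) (S : Set D.V) : Submodule (ZMod 2) (D.V × Field6 → ZMod 2) :=
  invariantFunctions (ZMod 2) (fun h h' => h' = D.wick h) {h | h.1 ∈ S}

/-- The boundary of a chain of propagators. -/
def boundary (D : Diagram) : (D.V × Field6 → ZMod 2) →ₗ[ZMod 2] (D.V → ZMod 2) :=
  LinearMap.pi fun v => ∑ i, LinearMap.proj (v, i)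

theorem finrank_loopChains (c : Colour) (S : Set D.V) :
    Module.finrank (ZMod 2) (D.loopChains c S) = (D.innerLoops c S).ncard :=
  finrank_invariantFunctions _ _

theorem two_mul_finrank_propagatorChains_add_ncard_legs_le (S : Set D.V) :
    2 * Module.finrank (ZMod 2) (D.propagatorChains S) + (D.legs S).ncard ≤ 6 * S.ncard := by
  have hI : {h | h.1 ∈ S ∧ (D.wick h).1 ∈ S} ∪ D.legs S = {h : D.V × Field6 | h.1 ∈ S} := by
    ext h; simp only [legs, Set.mem_union, Set.mem_ofPred_eq]; tauto
  have hdisj : Disjoint {h | h.1 ∈ S ∧ (D.wick h).1 ∈ S} (D.legs S) :=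
    Set.disjoint_left.2 fun _ h h' => h'.2 h.2
  rw [← ncard_fields, ← hI, Set.ncard_union_eq hdisj]
  exact Nat.add_le_add_right
    (two_mul_finrank_invariantFunctions_le wick_involutive D.wick_ne {h | h.1 ∈ S}) _

theorem loopChains_le (c : Colour) (S : Set D.V) :
    D.loopChains c S ≤ D.propagatorChains S ⊓ LinearMap.ker D.boundary := by
  intro g hg
  refine ⟨⟨fun h h' e => hg.1 h h' (Or.inl e), hg.2⟩, ?_⟩
  ext v
  suffices ∑ i, g (v, i) = 0 by simpa [boundary] using this
  refine Finset.sum_involution (fun i _ => edge (D.kind v) c i) (fun i _ => ?_)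
    (fun i _ _ => edge_ne _ _ _) (fun _ _ => Finset.mem_univ _) fun i _ => edge_edge _ _ _
  rw [← hg.1 (v, i) (v, edge (D.kind v) c i) (Or.inr rfl), CharTwo.add_self_eq_zero]

theorem eq_of_mem_loopChains {S : Set D.V} (hS : D.ConnectedOn S) {a b : Colour} (hab : a ≠ b)
    {g : D.V × Field6 → ZMod 2} (ha : g ∈ D.loopChains a S) (hb : g ∈ D.loopChains b S)
    {h h' : D.V × Field6} (hh : h.1 ∈ S) (hh' : h'.1 ∈ S) : g h' = g h := by
  have hwick (k) : g (D.wick k) = g k := (ha.1 k _ (Or.inl rfl)).symm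
  have hvertex (v i j) : g (v, j) = g (v, i) := by
    have hga (i) : g (v, edge (D.kind v) a i) = g (v, i) := (ha.1 (v, i) _ (Or.inr rfl)).symm
    have hgb (i) : g (v, edge (D.kind v) b i) = g (v, i) := (hb.1 (v, i) _ (Or.inr rfl)).symm
    rcases hexagon_of_forall_ne_edge (D.kind v) b (edge (D.kind v) a) (edge_edge _ a)
      (edge_ne _ a) (edge_ne_edge _ hab) i j with e | e | e | e | e | e <;>
      simp only [e, hga, hgb]
  refine hS.induction (p := fun v => ∀ i, g (v, i) = g h) hh (hvertex h.1 h.2) ?_ hh' h'.2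
  exact fun k _ _ hk j => (hvertex _ (D.wick k).2 j).trans ((hwick k).trans (hk k.2))

theorem finrank_loopChains_inf_le_one {S : Set D.V} (hS : D.ConnectedOn S) {a b : Colour}
    (hab : a ≠ b) : Module.finrank (ZMod 2) ↥(D.loopChains a S ⊓ D.loopChains b S) ≤ 1 := by
  obtain ⟨v, hv⟩ := hS.1
  let eval : ↥(D.loopChains a S ⊓ D.loopChains b S) →ₗ[ZMod 2] ZMod 2 :=
    LinearMap.proj (v, 0) ∘ₗ Submodule.subtype _
  have heval : Function.Injective eval := by
    refine (injective_iff_map_eq_zero eval).2 fun g hg => Subtype.ext (funext fun h => ?_)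
    by_cases hh : h.1 ∈ S
    · exact (eq_of_mem_loopChains hS hab g.2.1 g.2.2 (h := (v, 0)) hv hh).trans hg
    · exact g.2.1.2 h hh
  simpa using LinearMap.finrank_le_finrank_of_injective heval

theorem loopChains_inf_eq_bot {S : Set D.V} (hS : D.ConnectedOn S) {a b : Colour} (hab : a ≠ b)
    (hl : (D.legs S).Nonempty) : D.loopChains a S ⊓ D.loopChains b S = ⊥ := by
  obtain ⟨k, hkS, hk⟩ := hl
  refine (Submodule.eq_bot_iff _).2 fun g hg => funext fun h => ?_
  by_cases hh : h.1 ∈ S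
  · calc g h = g k := eq_of_mem_loopChains hS hab hg.1 hg.2 hkS hh
      _ = g (D.wick k) := hg.1.1 k _ (Or.inl rfl)
      _ = 0 := hg.1.2 _ hk
  · exact hg.1.2 h hh

theorem single_add_single_mem_map_boundary {S : Set D.V} {h : D.V × Field6} (hh : h.1 ∈ S)
    (hw : (D.wick h).1 ∈ S) [DecidableEq D.V] :
    (Pi.single h.1 1 + Pi.single (D.wick h).1 1 : D.V → ZMod 2) ∈
      (D.propagatorChains S).map D.boundary := by
  refine ⟨Pi.single h 1 + Pi.single (D.wick h) 1, ⟨?_, fun k hk => ?_⟩, ?_⟩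
  · rintro k _ rfl
    have h1 : D.wick k = h ↔ k = D.wick h := wick_involutive.eq_iff
    have h2 : D.wick k = D.wick h ↔ k = h := wick_injective.eq_iff
    simp only [Pi.add_apply, Pi.single_apply, h1, h2, add_comm]
  · have h1 : k ≠ h := fun e => hk (e ▸ hh)
    have h2 : k ≠ D.wick h := fun e => hk (e ▸ hw)
    simp [h1, h2]
  · have hsingle (k : D.V × Field6) : D.boundary (Pi.single k 1) = Pi.single k.1 1 := by
      ext v
      by_cases hv : v = k.1
      · subst hv
        simp [boundary, Pi.single_apply, Prod.ext_iff]
      · simp [boundary, Prod.ext_iff, hv]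
    rw [map_add, hsingle, hsingle]

theorem ncard_le_finrank_map_boundary_add_one {S : Set D.V} (hS : D.ConnectedOn S) :
    S.ncard ≤ Module.finrank (ZMod 2) ((D.propagatorChains S).map D.boundary) + 1 := by
  classical
  obtain ⟨v₀, hv₀⟩ := hS.1
  let e (v : D.V) : D.V → ZMod 2 := Pi.single v 1
  let M := (D.propagatorChains S).map D.boundary ⊔ Submodule.span (ZMod 2) {e v₀}
  have hM (v : S) : e v ∈ M :=
    hS.induction (p := (e · ∈ M)) hv₀
      (Submodule.mem_sup_right (Submodule.mem_span_singleton_self _))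
      (fun h hh hw hm => (Submodule.add_mem_iff_right M hm).1
        (Submodule.mem_sup_left (single_add_single_mem_map_boundary hh hw))) v.2
  have := Fintype.ofFinite D.V
  have := Fintype.ofFinite S
  have hindep : LinearIndependent (ZMod 2) fun v : S => (⟨e v, hM v⟩ : M) := by
    have := (Pi.basisFun (ZMod 2) D.V).linearIndependent.comp ((↑) : S → D.V)
      Subtype.val_injective
    refine LinearIndependent.of_comp M.subtype ?_
    convert this using 1
    ext v u
    simp [e]
  calc S.ncard = Fintype.card S := by rw [← Nat.card_eq_fintype_card, Nat.card_coe_set_eq]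
    _ ≤ Module.finrank (ZMod 2) M := hindep.fintype_card_le_finrank
    _ ≤ _ := Submodule.finrank_add_le_finrank_add_finrank _ _
    _ ≤ _ := Nat.add_le_add_left ((finrank_span_le_card _).trans (by simp)) _

theorem two_mul_ncard_innerLoops_add_ncard_legs_le {S : Set D.V} (hS : D.ConnectedOn S)
    (a b : Colour) :
    2 * ((D.innerLoops a S).ncard + (D.innerLoops b S).ncard) + (D.legs S).ncard ≤
      4 * S.ncard + 2 +
        2 * Module.finrank (ZMod 2) ↥(D.loopChains a S ⊓ D.loopChains b S) := by
  have hsup := Submodule.finrank_sup_add_finrank_inf_eq (D.loopChains a S) (D.loopChains b S)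
  rw [finrank_loopChains, finrank_loopChains] at hsup
  have hcycles := Submodule.finrank_mono (sup_le (D.loopChains_le a S) (D.loopChains_le b S))
  have hrank := LinearMap.finrank_range_add_finrank_ker
    (D.boundary.domRestrict (D.propagatorChains S))
  rw [LinearMap.range_domRestrict, LinearMap.ker_domRestrict, ← Submodule.finrank_map_subtype_eq,
    Submodule.map_comap_subtype] at hrank
  have hvertices := ncard_le_finrank_map_boundary_add_one hS
  have hpropagators := D.two_mul_finrank_propagatorChains_add_ncard_legs_le S
  omega

/-- The propagators and the faces of colours `a`, `b` form a ribbon graph with hexagonal vertices,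
so this says that the Euler characteristic of a closed connected surface is at most two. -/
theorem euler_bound {S : Set D.V} (hS : D.ConnectedOn S) {a b : Colour} (hab : a ≠ b) :
    2 * ((D.innerLoops a S).ncard + (D.innerLoops b S).ncard) + (D.legs S).ncard ≤
      4 * S.ncard + 4 := by
  have := two_mul_ncard_innerLoops_add_ncard_legs_le hS a b
  have := finrank_loopChains_inf_le_one hS hab
  omega

theorem euler_bound_of_legs {S : Set D.V} (hS : D.ConnectedOn S) (hl : (D.legs S).Nonempty)
    {a b : Colour} (hab : a ≠ b) :
    2 * ((D.innerLoops a S).ncard + (D.innerLoops b S).ncard) + (D.legs S).ncard ≤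
      4 * S.ncard + 2 := by
  have := two_mul_ncard_innerLoops_add_ncard_legs_le hS a b
  rwa [loopChains_inf_eq_bot hS hab hl, finrank_bot] at this

/-- Connected diagrams with as many loops as possible. By `euler_bound` this means that the ribbon
graph of any two colours is planar. -/
structure IsPlanar (D : Diagram) : Prop where
  conn : D.ConnectedOn Set.univ
  card_loop : ∀ c, Nat.card (D.Loop c) = Nat.card D.V + 1


/-! ### Legs -/

theorem even_ncard_legs_of_closed (c : Colour) (S : Set D.V) {Q : D.V × Field6 → Prop}
    (hw : ∀ h, Q h → Q (D.wick h)) (hc : ∀ h, Q h → Q (D.inner c h)) :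
    Even {h ∈ D.legs S | Q h}.ncard := by
  have hall : Even {h | h.1 ∈ S ∧ Q h}.ncard :=
    even_ncard_of_involution (f := D.inner c) (fun h hh => ⟨hh.1, hc h hh.2⟩)
      (fun h _ => D.inner_inner c h) (fun h _ => D.inner_ne c h)
  have hinside : Even {h | h.1 ∈ S ∧ (D.wick h).1 ∈ S ∧ Q h}.ncard :=
    even_ncard_of_involution (fun h hh => ⟨hh.2.1, (D.wick_wick h).symm ▸ hh.1, hw h hh.2.2⟩)
      (fun h _ => D.wick_wick h) (fun h _ => D.wick_ne h)
  have hsplit : {h | h.1 ∈ S ∧ Q h} =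
      {h | h.1 ∈ S ∧ (D.wick h).1 ∈ S ∧ Q h} ∪ {h ∈ D.legs S | Q h} := by
    ext h; simp only [Set.mem_ofPred_eq, Set.mem_union, legs]; tauto
  rw [hsplit, Set.ncard_union_eq (Set.disjoint_left.2 fun h hh hh' => hh'.1.2 hh.2.1)] at hall
  exact (Nat.even_add.1 hall).1 hinside

theorem even_ncard_legs_loop (c : Colour) (S : Set D.V) (l : D.Loop c) :
    Even {h ∈ D.legs S | D.loop c h = l}.ncard :=
  even_ncard_legs_of_closed c S (fun h hh => (D.loop_wick c h).trans hh)
    (fun h hh => (D.loop_inner c h).trans hh)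

theorem even_ncard_legs (S : Set D.V) : Even (D.legs S).ncard := by
  simpa using even_ncard_legs_of_closed red S (Q := fun _ => True) (fun _ h => h) (fun _ h => h)

theorem legs_compl (S : Set D.V) : D.legs Sᶜ = D.wick '' D.legs S := by
  ext h
  constructor
  · rintro ⟨h1, h2⟩
    exact ⟨D.wick h, ⟨not_not.1 h2, by rw [D.wick_wick]; exact h1⟩, D.wick_wick h⟩
  · rintro ⟨k, ⟨h1, h2⟩, rfl⟩
    exact ⟨h2, by rw [D.wick_wick]; exact not_not.2 h1⟩

theorem ncard_legs_compl (S : Set D.V) : (D.legs Sᶜ).ncard = (D.legs S).ncard := by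
  rw [legs_compl, Set.ncard_image_of_injective _ wick_injective]

theorem legs_univ : D.legs Set.univ = ∅ := by
  ext h; simp [legs]

theorem legs_nonempty (hD : D.ConnectedOn Set.univ) {S : Set D.V} (hS : S.Nonempty)
    (hne : S ≠ Set.univ) : (D.legs S).Nonempty := by
  by_contra! hl
  refine hne (hD.2 S (Set.subset_univ _) hS fun h hh _ => ?_)
  by_contra hw
  exact hl.subset ⟨hh, hw⟩

theorem loop_mem_innerLoops {c : Colour} {S : Set D.V} {h : D.V × Field6}
    (hh : h.1 ∈ S) (hl : ∀ k ∈ D.legs S, D.loop c k ≠ D.loop c h) :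
    D.loop c h ∈ D.innerLoops c S := by
  intro k hk
  refine (mem_of_loop_eq (T := {k | k.1 ∈ S ∧ D.loop c k = D.loop c h}) ?_ ?_ hk.symm
    ⟨hh, rfl⟩).1
  · rintro k ⟨h1, h2⟩
    refine ⟨?_, (D.loop_wick c k).trans h2⟩
    by_contra hw
    exact hl k ⟨h1, hw⟩ h2
  · rintro k ⟨h1, h2⟩
    exact ⟨h1, (D.loop_inner c k).trans h2⟩

theorem card_loop_le (c : Colour) (S : Set D.V) :
    Nat.card (D.Loop c) ≤ (D.loop c '' D.legs S).ncard + (D.innerLoops c S).ncard +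
      (D.innerLoops c Sᶜ).ncard := by
  rw [← Set.ncard_univ]
  refine (Set.ncard_le_ncard (t := D.loop c '' D.legs S ∪ D.innerLoops c S ∪ D.innerLoops c Sᶜ)
    fun l _ => ?_).trans ((Set.ncard_union_le _ _).trans
      (Nat.add_le_add_right (Set.ncard_union_le _ _) _))
  by_cases hl : l ∈ D.loop c '' D.legs S
  · exact Or.inl (Or.inl hl)
  obtain ⟨h, rfl⟩ := D.loop_surjective c l
  by_cases hh : h.1 ∈ S
  · exact Or.inl (Or.inr (loop_mem_innerLoops hh fun k hk e => hl ⟨k, hk, e⟩))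
  · refine Or.inr (loop_mem_innerLoops hh fun k hk e => ?_)
    rw [legs_compl] at hk
    obtain ⟨k, hk, rfl⟩ := hk
    exact hl ⟨k, hk, (D.loop_wick c k).symm.trans e⟩

theorem two_le_ncard_legs_loop {c : Colour} {S : Set D.V} {l : D.Loop c}
    (hl : l ∈ D.loop c '' D.legs S) : 2 ≤ {h ∈ D.legs S | D.loop c h = l}.ncard := by
  have hpos : 0 < {h ∈ D.legs S | D.loop c h = l}.ncard := (Set.ncard_pos (Set.toFinite _)).2 hl
  obtain ⟨n, hn⟩ := even_ncard_legs_loop c S l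
  omega

theorem two_mul_ncard_image_loop_legs_le (c : Colour) (S : Set D.V) :
    2 * (D.loop c '' D.legs S).ncard ≤ (D.legs S).ncard :=
  two_mul_ncard_image_le fun _ => two_le_ncard_legs_loop

/- The Euler inequalities on the two sides of the bond add up to an upper bound on the number of
inner loops, and each loop that crosses the bond uses up at least two legs. In a planar diagram the
total number of loops leaves no slack in either estimate. -/
theorem IsPlanar.ncard_innerLoops_and_ncard_crossing (hD : D.IsPlanar) {S : Set D.V}
    (hS : D.ConnectedOn S) (hS' : D.ConnectedOn Sᶜ) (c : Colour) :
    4 * (D.innerLoops c S).ncard + (D.legs S).ncard = 4 * S.ncard + 2 ∧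
      2 * (D.loop c '' D.legs S).ncard = (D.legs S).ncard := by
  have hne : S ≠ Set.univ := by
    rintro rfl; simpa using hS'.1
  have hl := legs_nonempty hD.conn hS.1 hne
  have hl' : (D.legs Sᶜ).Nonempty := by rw [legs_compl]; exact hl.image _
  have hV : S.ncard + Sᶜ.ncard = Nat.card D.V := Set.ncard_add_ncard_compl S
  have hloops (c) := (hD.card_loop c).symm.trans_le (D.card_loop_le c S)
  have hcross (c) := two_mul_ncard_image_loop_legs_le c S
  have euler {a b : Colour} (hab : a ≠ b) := euler_bound_of_legs hS hl hab
  have euler' {a b : Colour} (hab : a ≠ b) := euler_bound_of_legs hS' hl' hab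
  rw [ncard_legs_compl] at euler'
  have hrg : red ≠ green := by decide
  have hgb : green ≠ blue := by decide
  have hrb : red ≠ blue := by decide
  have := euler hrg; have := euler hgb; have := euler hrb
  have := euler' hrg; have := euler' hgb; have := euler' hrb
  have := hloops red; have := hloops green; have := hloops blue
  have := hcross red; have := hcross green; have := hcross blue
  cases c <;> omega

theorem IsPlanar.four_mul_ncard_innerLoops_add_ncard_legs (hD : D.IsPlanar) {S : Set D.V}
    (hS : D.ConnectedOn S) (hS' : D.ConnectedOn Sᶜ) (c : Colour) :
    4 * (D.innerLoops c S).ncard + (D.legs S).ncard = 4 * S.ncard + 2 :=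
  (hD.ncard_innerLoops_and_ncard_crossing hS hS' c).1

theorem IsPlanar.ncard_legs_loop_eq_two (hD : D.IsPlanar) {S : Set D.V} (hS : D.ConnectedOn S)
    (hS' : D.ConnectedOn Sᶜ) {c : Colour} {h : D.V × Field6} (hh : h ∈ D.legs S) :
    {k ∈ D.legs S | D.loop c k = D.loop c h}.ncard = 2 :=
  ncard_fiber_eq_two_of_two_mul_ncard_image_eq (fun _ => two_le_ncard_legs_loop)
    (hD.ncard_innerLoops_and_ncard_crossing hS hS' c).2 ⟨h, hh, rfl⟩

/-! ### Components of the complement of a vertex set -/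

/-- The component of a vertex after a set of vertices is taken out. -/
def component (D : Diagram) (A : Set D.V) (u : D.V) : Set D.V :=
  {v | Relation.ReflTransGen (fun p q => q ∉ A ∧ D.Adj p q) u v}

theorem adj_symm {u v : D.V} (h : D.Adj u v) : D.Adj v u := by
  obtain ⟨i, j, e⟩ := h
  exact ⟨j, i, by rw [← e, D.wick_wick]⟩

theorem adj_wick (h : D.V × Field6) : D.Adj h.1 (D.wick h).1 := ⟨h.2, (D.wick h).2, rfl⟩

theorem self_mem_component (A : Set D.V) (u : D.V) : u ∈ D.component A u :=
  Relation.ReflTransGen.refl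

theorem notMem_of_mem_component {A : Set D.V} {u v : D.V} (hu : u ∉ A)
    (h : v ∈ D.component A u) : v ∉ A := by
  cases h with
  | refl => exact hu
  | tail _ h => exact h.1

theorem disjoint_component {A : Set D.V} {u : D.V} (hu : u ∉ A) :
    Disjoint (D.component A u) A :=
  Set.disjoint_left.2 fun _ hv => notMem_of_mem_component hu hv

theorem wick_mem_component {A : Set D.V} {u : D.V} {h : D.V × Field6}
    (hh : h.1 ∈ D.component A u) (hw : (D.wick h).1 ∉ A) : (D.wick h).1 ∈ D.component A u :=
  Relation.ReflTransGen.tail hh ⟨hw, adj_wick h⟩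

theorem mem_component_symm {A : Set D.V} {u v : D.V} (hu : u ∉ A) (h : v ∈ D.component A u) :
    u ∈ D.component A v := by
  induction h with
  | refl => exact self_mem_component A u
  | tail h1 h2 ih =>
    exact Relation.ReflTransGen.head ⟨notMem_of_mem_component hu h1, adj_symm h2.2⟩ ih

theorem component_eq {A : Set D.V} {u v : D.V} (hu : u ∉ A) (h : v ∈ D.component A u) :
    D.component A v = D.component A u := by
  ext w
  exact ⟨fun h' => Relation.ReflTransGen.trans h h',
    fun h' => Relation.ReflTransGen.trans (mem_component_symm hu h) h'⟩

theorem connectedOn_component {A : Set D.V} {u : D.V} (hu : u ∉ A) :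
    D.ConnectedOn (D.component A u) := by
  refine ⟨⟨u, self_mem_component A u⟩, fun T hT ⟨t, ht⟩ hcl => hT.antisymm fun v hv => ?_⟩
  rw [← component_eq hu (hT ht)] at hv
  induction hv with
  | refl => exact ht
  | tail _ h2 ih =>
    obtain ⟨h2, i, j, e⟩ := h2
    have := hcl (_, i) ih
    rw [e] at this
    refine this (Relation.ReflTransGen.tail (hT ih) ⟨h2, i, j, e⟩)

theorem connectedOn_singleton (v : D.V) : D.ConnectedOn {v} :=
  ⟨⟨v, rfl⟩, fun _ hT ht _ => (Set.subset_singleton_iff_eq.1 hT).resolve_left ht.ne_empty⟩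

theorem connectedOn_pair {h : D.V × Field6} {L R : D.V} (hL : h.1 = L) (hR : (D.wick h).1 = R) :
    D.ConnectedOn {L, R} := by
  subst hL hR
  refine ⟨⟨h.1, Or.inl rfl⟩, fun T hT ⟨t, ht⟩ hcl => hT.antisymm ?_⟩
  rcases hT ht with rfl | rfl
  · rintro _ (rfl | rfl)
    · exact ht
    · exact hcl h ht (Or.inr rfl)
  · have := hcl (D.wick h) ht (by rw [D.wick_wick]; exact Or.inl rfl)
    rw [D.wick_wick] at this
    rintro _ (rfl | rfl)
    · exact this
    · exact ht

theorem wick_notMem_component {A : Set D.V} {u : D.V} {h : D.V × Field6}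
    (hA : h.1 ∉ A) (hh : h.1 ∉ D.component A u) : (D.wick h).1 ∉ D.component A u := fun hw =>
  hh (by simpa [D.wick_wick] using wick_mem_component hw (by rwa [D.wick_wick]))

theorem eq_empty_of_closed_in_compl_component (hD : D.ConnectedOn Set.univ) {A U : Set D.V}
    (hA : A.Nonempty) {u : D.V} (hU : U ⊆ (D.component A u)ᶜ) (hUA : Disjoint U A)
    (hcl : ∀ h : D.V × Field6, h.1 ∈ U → (D.wick h).1 ∈ (D.component A u)ᶜ → (D.wick h).1 ∈ U) :
    U = ∅ := by
  by_contra! hne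
  have huniv : U = Set.univ := hD.2 U (Set.subset_univ _) hne fun h hh _ =>
    hcl h hh (wick_notMem_component (Set.disjoint_left.1 hUA hh) (hU hh))
  exact hA.ne_empty (Set.univ_disjoint.1 (huniv ▸ hUA))

theorem connectedOn_compl_component (hD : D.ConnectedOn Set.univ) {A : Set D.V}
    (hA : D.ConnectedOn A) {u : D.V} (hu : u ∉ A) : D.ConnectedOn (D.component A u)ᶜ := by
  have hAK : A ⊆ (D.component A u)ᶜ := fun a ha hK => notMem_of_mem_component hu hK ha
  refine ⟨hA.1.mono hAK, fun T hT hne hcl => hT.antisymm ?_⟩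
  have hTA : (T ∩ A).Nonempty := by
    by_contra! h
    exact hne.ne_empty (eq_empty_of_closed_in_compl_component hD hA.1 hT
      (Set.disjoint_iff_inter_eq_empty.2 h) hcl)
  have hAT : A ⊆ T := by
    have := hA.2 (T ∩ A) Set.inter_subset_right hTA fun h hh hw => ⟨hcl h hh.1 (hAK hw), hw⟩
    exact this ▸ Set.inter_subset_left
  have hrest : (D.component A u)ᶜ \ T = ∅ := by
    refine eq_empty_of_closed_in_compl_component hD hA.1 Set.sdiff_subset
      (Set.disjoint_left.2 fun a ha ha' => ha.2 (hAT ha')) fun h hh hw => ⟨hw, fun hwT => hh.2 ?_⟩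
    have := hcl (D.wick h) hwT (by rw [D.wick_wick]; exact hh.1)
    rwa [D.wick_wick] at this
  exact Set.sdiff_eq_empty.1 hrest

theorem mem_legs_component {A : Set D.V} {u : D.V} {h : D.V × Field6} :
    h ∈ D.legs (D.component A u) → (D.wick h).1 ∈ A := fun hh => by
  by_contra hw
  exact hh.2 (wick_mem_component hh.1 hw)

theorem IsPlanar.four_mul_ncard_innerLoops_component (hD : D.IsPlanar) {A : Set D.V}
    (hA : D.ConnectedOn A) {u : D.V} (hu : u ∉ A) (c : Colour) :
    4 * (D.innerLoops c (D.component A u)).ncard + (D.legs (D.component A u)).ncard =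
      4 * (D.component A u).ncard + 2 :=
  hD.four_mul_ncard_innerLoops_add_ncard_legs (connectedOn_component hu)
    (connectedOn_compl_component hD.conn hA hu) c

/-- The components that remain when a set of vertices is taken out. -/
noncomputable def components (D : Diagram) (A : Set D.V) : Finset (Set D.V) :=
  (Set.toFinite {K | ∃ u, u ∉ A ∧ D.component A u = K}).toFinset

theorem mem_components {A K : Set D.V} :
    K ∈ D.components A ↔ ∃ u, u ∉ A ∧ D.component A u = K := by
  simp [components]

theorem pairwiseDisjoint_components (A : Set D.V) :
    (D.components A : Set (Set D.V)).PairwiseDisjoint id := by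
  intro K hK K' hK' hne
  refine Set.disjoint_left.2 fun v hv hv' => hne ?_
  obtain ⟨u, hu, rfl⟩ := mem_components.1 hK
  obtain ⟨u', hu', rfl⟩ := mem_components.1 hK'
  exact (component_eq hu hv).symm.trans (component_eq hu' hv')

theorem sum_ncard_components_le (A : Set D.V) :
    ∑ K ∈ D.components A, K.ncard ≤ Aᶜ.ncard := by
  classical
  have := Fintype.ofFinite D.V
  simp only [Set.ncard_eq_toFinset_card']
  rw [← Finset.card_biUnion (t := fun K : Set D.V => K.toFinset) fun K hK K' hK' hne =>
    Set.disjoint_toFinset.2 (pairwiseDisjoint_components A hK hK' hne)]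
  refine Finset.card_le_card fun v hv => ?_
  simp only [Finset.mem_biUnion, Set.mem_toFinset] at hv ⊢
  obtain ⟨K, hK, hv⟩ := hv
  obtain ⟨u, hu, rfl⟩ := mem_components.1 hK
  exact notMem_of_mem_component hu hv

/-- The loops of colour `c` that pass through a vertex set. -/
def touching (D : Diagram) (c : Colour) (A : Set D.V) : Set (D.Loop c) :=
  {l | ∃ h, h.1 ∈ A ∧ D.loop c h = l}

theorem mem_innerLoops_component {c : Colour} {A : Set D.V} {h : D.V × Field6}
    (hl : D.loop c h ∉ D.touching c A) : D.loop c h ∈ D.innerLoops c (D.component A h.1) := by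
  refine loop_mem_innerLoops (self_mem_component A h.1) fun k hk e => hl ?_
  exact ⟨D.wick k, mem_legs_component hk, (D.loop_wick c k).trans e⟩

theorem card_loop_le_touching_add_sum (c : Colour) (A : Set D.V) :
    Nat.card (D.Loop c) ≤
      (D.touching c A).ncard + ∑ K ∈ D.components A, (D.innerLoops c K).ncard := by
  classical
  have := Fintype.ofFinite (D.Loop c)
  have hcover : (Finset.univ : Finset (D.Loop c)) ⊆ (D.touching c A).toFinset ∪
      (D.components A).biUnion fun K => (D.innerLoops c K).toFinset := by
    intro l _
    rw [Finset.mem_union, Set.mem_toFinset, Finset.mem_biUnion]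
    refine or_iff_not_imp_left.2 fun hl => ?_
    obtain ⟨h, rfl⟩ := D.loop_surjective c l
    exact ⟨_, mem_components.2 ⟨h.1, fun hh => hl ⟨h, hh, rfl⟩, rfl⟩,
      Set.mem_toFinset.2 (mem_innerLoops_component hl)⟩
  simp only [Set.ncard_eq_toFinset_card', Nat.card_eq_fintype_card]
  calc Fintype.card (D.Loop c) ≤ _ := Finset.card_le_card hcover
    _ ≤ _ := Finset.card_union_le _ _
    _ ≤ _ := Nat.add_le_add_left Finset.card_biUnion_le _

theorem IsPlanar.le_ncard_touching (hD : D.IsPlanar) {A : Set D.V} (hA : D.ConnectedOn A)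
    (c : Colour) :
    4 + 4 * A.ncard + ∑ K ∈ D.components A, ((D.legs K).ncard - 2) ≤
      4 * (D.touching c A).ncard := by
  have hsum : ∑ K ∈ D.components A, (4 * (D.innerLoops c K).ncard + ((D.legs K).ncard - 2)) =
      ∑ K ∈ D.components A, 4 * K.ncard := by
    refine Finset.sum_congr rfl fun K hK => ?_
    obtain ⟨u, hu, rfl⟩ := mem_components.1 hK
    have := hD.four_mul_ncard_innerLoops_component hA hu c
    have := legs_nonempty hD.conn ⟨u, self_mem_component A u⟩ fun e =>
      hA.1.ne_empty (Set.univ_disjoint.1 (e ▸ disjoint_component hu))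
    have := (Set.ncard_pos (Set.toFinite _)).2 this
    omega
  rw [Finset.sum_add_distrib, ← Finset.mul_sum, ← Finset.mul_sum] at hsum
  have := card_loop_le_touching_add_sum c A
  have := sum_ncard_components_le A
  have : A.ncard + Aᶜ.ncard = Nat.card D.V := Set.ncard_add_ncard_compl A
  have := hD.card_loop c
  omega

end Diagram

instance (k : Interaction) (π : Perm Colour) (α : Perm Field6) :
    Decidable (IsColourSymmetry k π α) :=
  inferInstanceAs (Decidable (∀ c, α * edge k c * α⁻¹ = edge k (π c)))

instance (k : Interaction) (α : Perm Field6) : Decidable (IsAutomorphism k α) :=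
  inferInstanceAs (Decidable (IsColourSymmetry k 1 α))

/-- The automorphism of the wheel that moves the labels by two. -/
def wheelRotation : Perm Field6 := swap 1 3 * swap 3 5 * (swap 2 4 * swap 4 6)

theorem exists_conj_snailPairing_of_common_edges (k : Interaction) (s : Perm Field6)
    (hs : ∀ i, s (s i) = i) (h : ∀ c, ∃ i, s i = edge k c i) :
    ∃ α ∈ [1, wheelRotation, wheelRotation⁻¹], IsAutomorphism k α ∧
      s = α * snailPairing k * α⁻¹ := by
  revert k s; decide +kernel

theorem isSnailPairing_of_common_edges {k : Interaction} {s : Perm Field6}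
    (hs : ∀ i, s (s i) = i) (h : ∀ c, ∃ i, s i = edge k c i) : IsSnailPairing k s :=
  let ⟨α, _, hα⟩ := exists_conj_snailPairing_of_common_edges k s hs h
  ⟨α, hα⟩

theorem eq_or_eq_of_mem_pair {X : Type*} {p q a b c : X} (ha : a ∈ ({p, q} : Set X))
    (hb : b ∈ ({p, q} : Set X)) (hc : c ∈ ({p, q} : Set X)) (hab : b ≠ a) : c = a ∨ c = b := by
  simp only [Set.mem_insert_iff, Set.mem_singleton_iff] at ha hb hc
  grind

namespace Diagram

variable {D : Diagram}

/-! ### Legs joined by two-point subgraphs -/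

/-- The legs `h`, `h'` of the vertex set `A` are contracted or attached to a connected subgraph
outside `A` without further external legs. -/
def Twin (D : Diagram) (A : Set D.V) (h h' : D.V × Field6) : Prop :=
  h ≠ h' ∧ h.1 ∈ A ∧ h'.1 ∈ A ∧
    (D.wick h = h' ∨ ∃ K, D.ConnectedOn K ∧ Disjoint K A ∧ D.legs K = {D.wick h, D.wick h'})

theorem Twin.symm {A : Set D.V} {h h' : D.V × Field6} (ht : D.Twin A h h') : D.Twin A h' h := by
  obtain ⟨h1, h2, h3, h4⟩ := ht
  refine ⟨h1.symm, h3, h2, h4.imp (fun e => by rw [← e, D.wick_wick]) fun ⟨K, k1, k2, k3⟩ =>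
    ⟨K, k1, k2, by rw [k3, Set.pair_comm]⟩⟩

theorem twin_of_wick {A : Set D.V} {h h' : D.V × Field6} (h1 : h.1 ∈ A) (h2 : h'.1 ∈ A)
    (e : D.wick h = h') : D.Twin A h h' :=
  ⟨fun e' => D.wick_ne h (e.trans e'.symm), h1, h2, Or.inl e⟩

theorem joined_of_wick (A : Set D.V) {h h' : D.V × Field6} (e : D.wick h = h') :
    D.Joined A h h' := by
  refine ⟨∅, Set.empty_disjoint A, fun k hk => Or.inr ?_⟩
  rcases hk with hk | rfl | rfl
  · exact absurd hk (Set.notMem_empty _)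
  · exact Or.inr e
  · exact Or.inl (by rw [← e, D.wick_wick])

theorem joined_of_legs {A K : Set D.V} {h h' : D.V × Field6} (hd : Disjoint K A)
    (hl : D.legs K = {D.wick h, D.wick h'}) : D.Joined A h h' := by
  refine ⟨K, hd, fun k hk => ?_⟩
  have h1 : (D.wick h) ∈ D.legs K := by rw [hl]; exact Or.inl rfl
  have h2 : (D.wick h') ∈ D.legs K := by rw [hl]; exact Or.inr rfl
  rcases hk with hk | rfl | rfl
  · by_cases hw : (D.wick k).1 ∈ K
    · exact Or.inl hw
    · have : k ∈ D.legs K := ⟨hk, hw⟩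
      rw [hl] at this
      rcases this with rfl | rfl
      · exact Or.inr (Or.inl (D.wick_wick h))
      · exact Or.inr (Or.inr (D.wick_wick h'))
  · exact Or.inl h1.1
  · exact Or.inl h2.1

theorem Twin.joined {A : Set D.V} {h h' : D.V × Field6} (ht : D.Twin A h h') :
    D.Joined A h h' := by
  rcases ht.2.2.2 with e | ⟨K, -, k2, k3⟩
  · exact joined_of_wick A e
  · exact joined_of_legs k2 k3

theorem Joined.loop_eq {A : Set D.V} {h h' : D.V × Field6} (hj : D.Joined A h h') (h1 : h.1 ∈ A)
    (h2 : h'.1 ∈ A) (c : Colour) : D.loop c h = D.loop c h' := by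
  obtain ⟨S, hS, hcl⟩ := hj
  by_contra hne
  refine not_mapsTo_sdiff_singleton_of_involution (f := D.wick) (g := D.inner c) (a := h)
    (T := {k | (k.1 ∈ S ∨ k = h ∨ k = h') ∧ D.loop c k = D.loop c h}) ⟨Or.inr (Or.inl rfl), rfl⟩
    ?_ D.wick_wick D.wick_ne (D.inner_inner c) (D.inner_ne c) ?_
  · exact fun k hk => ⟨hcl k hk.1, (D.loop_wick c k).trans hk.2⟩
  · rintro k ⟨⟨hk, hl⟩, hkh⟩
    have hkS : k.1 ∈ S := by
      rcases hk with hk | rfl | rfl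
      · exact hk
      · exact absurd rfl hkh
      · exact absurd hl.symm hne
    refine ⟨⟨Or.inl hkS, (D.loop_inner c k).trans hl⟩, fun e => ?_⟩
    exact Set.disjoint_left.1 hS hkS (e ▸ h1 : (D.inner c k).1 ∈ A)

theorem Twin.loop_eq {A : Set D.V} {h h' : D.V × Field6} (ht : D.Twin A h h') (c : Colour) :
    D.loop c h = D.loop c h' := ht.joined.loop_eq ht.2.1 ht.2.2.1 c

theorem subset_of_connectedOn {K K' : Set D.V} (hK : D.ConnectedOn K) {u : D.V} (hu : u ∈ K)
    (hu' : u ∈ K') (h : ∀ k ∈ D.legs K', (D.wick k).1 ∉ K) : K ⊆ K' := fun _ =>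
  hK.induction (p := (· ∈ K')) hu hu' fun k _ hw hk => by_contra fun hw' => h k ⟨hk, hw'⟩ hw

theorem eq_of_connectedOn {A K K' : Set D.V} (hK : D.ConnectedOn K) (hK' : D.ConnectedOn K')
    (hA : Disjoint K A) (hA' : Disjoint K' A) (hl : ∀ k ∈ D.legs K, (D.wick k).1 ∈ A)
    (hl' : ∀ k ∈ D.legs K', (D.wick k).1 ∈ A) {u : D.V} (hu : u ∈ K) (hu' : u ∈ K') : K = K' :=
  (subset_of_connectedOn hK hu hu' fun k hk hw => Set.disjoint_left.1 hA hw (hl' k hk)).antisymm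
    (subset_of_connectedOn hK' hu' hu fun k hk hw => Set.disjoint_left.1 hA' hw (hl k hk))

theorem wick_mem_of_legs_eq {A K : Set D.V} {h h' : D.V × Field6} (h1 : h.1 ∈ A) (h2 : h'.1 ∈ A)
    (hl : D.legs K = {D.wick h, D.wick h'}) : ∀ k ∈ D.legs K, (D.wick k).1 ∈ A := by
  intro k hk
  rw [hl] at hk
  rcases hk with rfl | rfl
  · rwa [D.wick_wick]
  · rwa [D.wick_wick]

theorem fst_mem_of_legs_eq {K : Set D.V} {k k' : D.V × Field6} (hl : D.legs K = {k, k'}) :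
    k.1 ∈ K := (show k ∈ D.legs K by rw [hl]; exact Or.inl rfl).1

theorem Twin.unique {A : Set D.V} {h h' h'' : D.V × Field6} (ht : D.Twin A h h')
    (ht' : D.Twin A h h'') : h' = h'' := by
  obtain ⟨n1, a1, b1, c1⟩ := ht
  obtain ⟨n2, -, b2, c2⟩ := ht'
  rcases c1 with e | ⟨K, k1, k2, k3⟩ <;> rcases c2 with e' | ⟨K', k1', k2', k3'⟩
  · exact e.symm.trans e'
  · subst e
    exact absurd b1 (Set.disjoint_left.1 k2' (fst_mem_of_legs_eq k3'))
  · subst e'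
    exact absurd b2 (Set.disjoint_left.1 k2 (fst_mem_of_legs_eq k3))
  · obtain rfl := eq_of_connectedOn k1 k1' k2 k2' (wick_mem_of_legs_eq a1 b1 k3)
      (wick_mem_of_legs_eq a1 b2 k3') (fst_mem_of_legs_eq k3) (fst_mem_of_legs_eq k3')
    have : D.wick h' ∈ ({D.wick h, D.wick h''} : Set _) := by
      rw [← k3', k3]; exact Or.inr rfl
    rcases this with e | e
    · exact absurd (wick_injective e).symm n1
    · exact wick_injective e

theorem ncard_wick_mem_component {A : Set D.V} {u : D.V} (hu : u ∉ A) :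
    {h : D.V × Field6 | h.1 ∈ A ∧ (D.wick h).1 ∈ D.component A u}.ncard =
      (D.legs (D.component A u)).ncard := by
  rw [← Set.ncard_image_of_injective _ (wick_injective (D := D))]
  congr 1
  ext h
  constructor
  · rintro ⟨k, ⟨h1, h2⟩, rfl⟩
    exact ⟨h2, by rw [D.wick_wick]; exact fun hk => notMem_of_mem_component hu hk h1⟩
  · exact fun hh => ⟨D.wick h, ⟨mem_legs_component hh, by rw [D.wick_wick]; exact hh.1⟩,
      D.wick_wick h⟩

theorem exists_twin_of_ncard_legs_component {A : Set D.V} {h : D.V × Field6} (hh : h.1 ∈ A)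
    (hw : (D.wick h).1 ∉ A) (h2 : (D.legs (D.component A (D.wick h).1)).ncard = 2) :
    ∃ h', D.Twin A h h' := by
  have hmem : D.wick h ∈ D.legs (D.component A (D.wick h).1) :=
    ⟨self_mem_component _ _, by
      rw [D.wick_wick]; exact fun hk => notMem_of_mem_component hw hk hh⟩
  obtain ⟨q, hq⟩ := Set.ncard_eq_one.1 <| Nat.succ.inj <|
    (Set.ncard_sdiff_singleton_add_one hmem).trans h2
  have hlegs : D.legs (D.component A (D.wick h).1) = {D.wick h, q} := by
    rw [← hq, Set.insert_sdiff_singleton, Set.insert_eq_of_mem hmem]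
  have hqmem : q ∈ D.legs (D.component A (D.wick h).1) \ {D.wick h} := hq ▸ rfl
  exact ⟨D.wick q, fun e => hqmem.2 (by simp [e, D.wick_wick]), hh, mem_legs_component hqmem.1,
    Or.inr ⟨_, connectedOn_component hw, disjoint_component hw, by rw [D.wick_wick, hlegs]⟩⟩

theorem IsPlanar.exists_twin_or_six_le_ncard_legs (hD : D.IsPlanar) {A : Set D.V}
    (hA : D.ConnectedOn A) {h : D.V × Field6} (hh : h.1 ∈ A) :
    (∃ h', D.Twin A h h') ∨
      (D.wick h).1 ∉ A ∧ 6 ≤ (D.legs (D.component A (D.wick h).1)).ncard := by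
  by_cases hw : (D.wick h).1 ∈ A
  · exact Or.inl ⟨_, twin_of_wick hh hw rfl⟩
  by_cases h2 : (D.legs (D.component A (D.wick h).1)).ncard = 2
  · exact Or.inl (exists_twin_of_ncard_legs_component hh hw h2)
  · have := hD.four_mul_ncard_innerLoops_component hA hw red
    have : 0 < (D.legs (D.component A (D.wick h).1)).ncard := by
      refine (Set.ncard_pos (Set.toFinite _)).2 ⟨D.wick h, self_mem_component _ _, ?_⟩
      rw [D.wick_wick]
      exact fun hk => notMem_of_mem_component hw hk hh
    exact Or.inr ⟨hw, by omega⟩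

/-! ### The vertices of a planar diagram -/

/-- Each loop passes the vertex at most once. -/
def IsRegular (D : Diagram) (v : D.V) : Prop :=
  ∀ c i j, D.loop c (v, i) = D.loop c (v, j) → j = i ∨ j = edge (D.kind v) c i

theorem IsRegular.false {v : D.V} (hv : D.IsRegular v) {i j : Field6} (hij : i ≠ j)
    (h : ∀ c, D.loop c (v, i) = D.loop c (v, j)) : False := by
  have h1 := (hv red i j (h red)).resolve_left hij.symm
  have h2 := (hv green i j (h green)).resolve_left hij.symm
  exact edge_ne_edge (D.kind v) (by decide) i (h1.symm.trans h2)

/-- A vertex whose removal splits a planar diagram into pieces with two legs looks like a snail. -/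
def IsSnailVertex (D : Diagram) (v : D.V) (s : Perm Field6) : Prop :=
  IsSnailPairing (D.kind v) s ∧ ∀ i, D.Twin {v} (v, i) (v, s i)

theorem isRegular_of_ncard_legs_loop_eq_two {v : D.V} (hleg : ∀ i, (v, i) ∈ D.legs {v})
    (h2 : ∀ c, ∀ h ∈ D.legs {v}, {k ∈ D.legs {v} | D.loop c k = D.loop c h}.ncard = 2) :
    D.IsRegular v := by
  intro c i j hij
  obtain ⟨p, q, -, e⟩ := Set.ncard_eq_two.1 (h2 c (v, i) (hleg i))
  have hi : (v, i) ∈ ({p, q} : Set _) := e ▸ ⟨hleg i, rfl⟩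
  have hc : (v, edge (D.kind v) c i) ∈ ({p, q} : Set _) := e ▸ ⟨hleg _, D.loop_edge c v i⟩
  have hj : (v, j) ∈ ({p, q} : Set _) := e ▸ ⟨hleg _, hij.symm⟩
  exact (eq_or_eq_of_mem_pair hi hc hj fun e => edge_ne (D.kind v) c i (congrArg Prod.snd e)).imp
    (congrArg Prod.snd) (congrArg Prod.snd)

theorem wick_mem_component_of_six_le {v u : D.V} (hu : u ∉ ({v} : Set D.V))
    (h6 : 6 ≤ (D.legs (D.component {v} u)).ncard) (i : Field6) :
    (D.wick (v, i)).1 ∈ D.component {v} u := by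
  rw [← ncard_wick_mem_component hu] at h6
  have hall : {h : D.V × Field6 | h.1 ∈ ({v} : Set D.V) ∧ (D.wick h).1 ∈ D.component {v} u} =
      {h | h.1 ∈ ({v} : Set D.V)} :=
    Set.eq_of_subset_of_ncard_le (fun h hh => hh.1)
      (by rwa [ncard_fields, Set.ncard_singleton])
  exact ((Set.ext_iff.1 hall (v, i)).2 rfl).2

theorem IsPlanar.isRegular_of_six_le (hD : D.IsPlanar) {v u : D.V} (hu : u ∉ ({v} : Set D.V))
    (h6 : 6 ≤ (D.legs (D.component {v} u)).ncard) : D.IsRegular v := by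
  have hw := wick_mem_component_of_six_le hu h6
  have hcompl : {v} = (D.component {v} u)ᶜ := by
    refine (connectedOn_compl_component hD.conn (connectedOn_singleton v) hu).2 {v} ?_ ⟨v, rfl⟩ ?_
    · rintro _ rfl hk
      exact notMem_of_mem_component hu hk rfl
    · rintro ⟨_, i⟩ rfl hk
      exact absurd (hw i) hk
  have hconn : D.ConnectedOn {v}ᶜ := by
    rw [hcompl, compl_compl]
    exact connectedOn_component hu
  exact isRegular_of_ncard_legs_loop_eq_two
    (fun i => ⟨rfl, fun h => notMem_of_mem_component hu (hw i) h⟩)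
    fun c _ => hD.ncard_legs_loop_eq_two (connectedOn_singleton v) hconn

theorem exists_perm_twin {v : D.V} (h : ∀ i, ∃ h', D.Twin {v} (v, i) h') :
    ∃ s : Perm Field6, (∀ i, s (s i) = i) ∧ ∀ i, D.Twin {v} (v, i) (v, s i) := by
  have htwin (i : Field6) : ∃ j, D.Twin {v} (v, i) (v, j) := by
    obtain ⟨⟨u, j⟩, ht⟩ := h i
    obtain rfl : u = v := ht.2.2.1
    exact ⟨j, ht⟩
  choose s hs using htwin
  have hss : Function.Involutive s := fun i => congrArg Prod.snd ((hs (s i)).unique (hs i).symm)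
  exact ⟨hss.toPerm, hss, hs⟩

theorem IsPlanar.exists_twin_eq_edge (hD : D.IsPlanar) {v : D.V} {s : Perm Field6}
    (hss : ∀ i, s (s i) = i) (hs : ∀ i, D.Twin {v} (v, i) (v, s i)) (c : Colour) :
    ∃ i, s i = edge (D.kind v) c i := by
  by_contra! hne
  have htouching := hD.le_ncard_touching (connectedOn_singleton v) c
  rw [Set.ncard_singleton] at htouching
  obtain ⟨_, ⟨⟨u, i⟩, hu, rfl⟩, _, ⟨⟨u', j⟩, hu', rfl⟩, hij⟩ :=
    (Set.one_lt_ncard (Set.toFinite _)).1 (show 1 < (D.touching c {v}).ncard by omega)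
  obtain rfl : u = v := hu
  obtain rfl : u' = u := hu'
  have hsl (i) : D.loop c (u', s i) = D.loop c (u', i) := ((hs i).loop_eq c).symm
  apply hij
  rcases hexagon_of_forall_ne_edge (D.kind u') c s hss (fun i e => (hs i).1 (by rw [e])) hne i j
    with e | e | e | e | e | e <;> simp only [e, hsl, D.loop_edge]

theorem IsPlanar.isRegular_or_isSnailVertex (hD : D.IsPlanar) (v : D.V) :
    D.IsRegular v ∨ ∃ s, D.IsSnailVertex v s := by
  by_cases htwin : ∀ i, ∃ h', D.Twin {v} (v, i) h'
  · obtain ⟨s, hss, hs⟩ := exists_perm_twin htwin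
    exact Or.inr ⟨s, isSnailPairing_of_common_edges hss (hD.exists_twin_eq_edge hss hs), hs⟩
  · obtain ⟨i, hi⟩ := not_forall.1 htwin
    obtain ⟨hw, h6⟩ := (hD.exists_twin_or_six_le_ncard_legs (connectedOn_singleton v)
      (h := (v, i)) rfl).resolve_left hi
    exact Or.inl (hD.isRegular_of_six_le hw h6)


/-! ### Two-cycles between regular vertices -/

theorem three_edges (k : Interaction) (c : Colour) : ∃ p q r, ∀ j,
    j = p ∨ j = edge k c p ∨ j = q ∨ j = edge k c q ∨ j = r ∨ j = edge k c r := by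
  revert k c; decide +kernel

theorem ncard_touching_singleton_le (c : Colour) (v : D.V) : (D.touching c {v}).ncard ≤ 3 := by
  obtain ⟨p, q, r, h⟩ := three_edges (D.kind v) c
  have hsub : D.touching c {v} ⊆ {D.loop c (v, p), D.loop c (v, q), D.loop c (v, r)} := by
    rintro _ ⟨⟨u, j⟩, hu, rfl⟩
    obtain rfl : u = v := hu
    rcases h j with rfl | rfl | rfl | rfl | rfl | rfl <;> simp [loop_edge]
  refine (Set.ncard_le_ncard hsub).trans ((Set.ncard_insert_le _ _).trans ?_)
  have := Set.ncard_insert_le (D.loop c (v, q)) {D.loop c (v, r)}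
  rw [Set.ncard_singleton] at this
  omega

theorem Twin.edge_eq {A : Set D.V} {L R : D.V} (hR : D.IsRegular R) {c : Colour}
    {i j i' j' : Field6} (h : D.Twin A (L, i) (R, j)) (h' : D.Twin A (L, i') (R, j'))
    (e : edge (D.kind L) c i = i') : edge (D.kind R) c j = j' := by
  have h1 : D.loop c (R, j) = D.loop c (R, j') := by
    rw [← h.loop_eq c, ← h'.loop_eq c, ← e, loop_edge]
  rcases hR c j j' h1 with rfl | h2
  · have := congrArg Prod.snd (h.symm.unique h'.symm)
    exact absurd (e.trans this.symm) (edge_ne _ _ _)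
  · exact h2.symm

/-- A 2-cycle between vertices of arbitrary kinds: two contractions between distinct vertices `L`
and `R`, of `x` of `L` with `y` of `R`, and of `z` of `L` with `w` of `R`. -/
structure IsTwoCycle (D : Diagram) (L R : D.V) (x y z w : Field6) : Prop where
  ne : L ≠ R
  field_ne : x ≠ z
  wick_fst : D.wick (L, x) = (R, y)
  wick_snd : D.wick (L, z) = (R, w)

theorem Twin.exists_eq_right {L R : D.V} {i : Field6} {h : D.V × Field6} (hL : D.IsRegular L)
    (ht : D.Twin {L, R} (L, i) h) : ∃ j, h = (R, j) := by
  obtain ⟨u, j⟩ := h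
  rcases ht.2.2.1 with rfl | rfl
  · exact (hL.false (fun e => ht.1 (by rw [e])) ht.loop_eq).elim
  · exact ⟨j, rfl⟩

theorem ncard_wick_notMem_component {A : Set D.V} {u : D.V} (hu : u ∉ A) :
    {h : D.V × Field6 | h.1 ∈ A ∧ (D.wick h).1 ∉ D.component A u}.ncard +
      (D.legs (D.component A u)).ncard = 6 * A.ncard := by
  rw [← ncard_wick_mem_component hu, ← ncard_fields, ← Set.ncard_union_eq]
  · congr 1
    ext h
    exact ⟨fun hh => hh.elim And.left And.left, fun hh => (em' _).imp (⟨hh, ·⟩) (⟨hh, ·⟩)⟩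
  · exact Set.disjoint_left.2 fun h hh hh' => hh.2 hh'.2

theorem touching_pair (c : Colour) (L R : D.V) :
    D.touching c {L, R} = D.touching c {L} ∪ D.touching c {R} := by
  ext l
  constructor
  · rintro ⟨h, hh | hh, e⟩
    · exact Or.inl ⟨h, hh, e⟩
    · exact Or.inr ⟨h, hh, e⟩
  · rintro (⟨h, hh, e⟩ | ⟨h, hh, e⟩)
    · exact ⟨h, Or.inl hh, e⟩
    · exact ⟨h, Or.inr hh, e⟩

theorem IsPlanar.ncard_touching_inter_le_two (hD : D.IsPlanar) {L R u : D.V} (hLR : L ≠ R)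
    (hA : D.ConnectedOn {L, R}) (hu : u ∉ ({L, R} : Set D.V))
    (h6 : 6 ≤ (D.legs (D.component {L, R} u)).ncard) (c : Colour) :
    (D.touching c {L} ∩ D.touching c {R}).ncard ≤ 2 := by
  have htouching := hD.le_ncard_touching hA c
  have hle := Finset.single_le_sum (f := fun K => (D.legs K).ncard - 2)
    (fun _ _ => Nat.zero_le _) (mem_components.2 ⟨u, hu, rfl⟩)
  have hunion := Set.ncard_union_add_ncard_inter (D.touching c {L}) (D.touching c {R})
  have hL := ncard_touching_singleton_le c L
  have hR := ncard_touching_singleton_le c R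
  rw [Set.ncard_pair hLR] at htouching
  rw [← touching_pair] at hunion
  omega

namespace IsTwoCycle

variable {L R : D.V} {x y z w : Field6}

theorem wick_fst' (h : D.IsTwoCycle L R x y z w) : D.wick (R, y) = (L, x) := by
  rw [← h.wick_fst, D.wick_wick]

theorem wick_snd' (h : D.IsTwoCycle L R x y z w) : D.wick (R, w) = (L, z) := by
  rw [← h.wick_snd, D.wick_wick]

theorem field_ne' (h : D.IsTwoCycle L R x y z w) : y ≠ w := fun e =>
  h.field_ne (congrArg Prod.snd (wick_injective (h.wick_fst.trans (e ▸ h.wick_snd.symm))))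

theorem symm (h : D.IsTwoCycle L R x y z w) : D.IsTwoCycle R L y x w z :=
  ⟨h.ne.symm, h.field_ne', h.wick_fst', h.wick_snd'⟩

theorem twin_fst (h : D.IsTwoCycle L R x y z w) : D.Twin {L, R} (L, x) (R, y) :=
  twin_of_wick (Or.inl rfl) (Or.inr rfl) h.wick_fst

theorem twin_snd (h : D.IsTwoCycle L R x y z w) : D.Twin {L, R} (L, z) (R, w) :=
  twin_of_wick (Or.inl rfl) (Or.inr rfl) h.wick_snd

theorem connectedOn (h : D.IsTwoCycle L R x y z w) : D.ConnectedOn {L, R} :=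
  connectedOn_pair (h := (L, x)) rfl (by rw [h.wick_fst])

/-- The four fields contracted in the two-cycle. -/
def fields (_ : D.IsTwoCycle L R x y z w) : Set (D.V × Field6) :=
  {(L, x), (L, z), (R, y), (R, w)}

theorem ncard_fields (h : D.IsTwoCycle L R x y z w) : h.fields.ncard = 4 := by
  have hpair : (R, y) ≠ (R, w) := fun e => h.field_ne' (congrArg Prod.snd e)
  rw [fields, Set.ncard_insert_of_notMem, Set.ncard_insert_of_notMem, Set.ncard_pair hpair] <;>
    simp [h.field_ne, h.ne]

theorem mem_of_mem_fields (h : D.IsTwoCycle L R x y z w) {k : D.V × Field6}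
    (hk : k ∈ h.fields) : k.1 ∈ ({L, R} : Set D.V) ∧ (D.wick k).1 ∈ ({L, R} : Set D.V) := by
  rcases hk with rfl | rfl | rfl | rfl
  · simp [h.wick_fst]
  · simp [h.wick_snd]
  · simp [h.wick_fst']
  · simp [h.wick_snd']

theorem fields_subset (h : D.IsTwoCycle L R x y z w) {u : D.V}
    (hu : u ∉ ({L, R} : Set D.V)) : h.fields ⊆
      {k | k.1 ∈ ({L, R} : Set D.V) ∧ (D.wick k).1 ∉ D.component {L, R} u} := fun _ hk =>
  ⟨(h.mem_of_mem_fields hk).1, fun hw => notMem_of_mem_component hu hw (h.mem_of_mem_fields hk).2⟩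

variable {u : D.V}

theorem ncard_legs_component (h : D.IsTwoCycle L R x y z w) (hD : D.IsPlanar)
    (hu : u ∉ ({L, R} : Set D.V)) (h6 : 6 ≤ (D.legs (D.component {L, R} u)).ncard) :
    (D.legs (D.component {L, R} u)).ncard = 6 := by
  have hcard := ncard_wick_notMem_component hu
  have hle := Set.ncard_le_ncard (h.fields_subset hu)
  have hmod := hD.four_mul_ncard_innerLoops_component h.connectedOn hu red
  rw [Set.ncard_pair h.ne] at hcard
  rw [h.ncard_fields] at hle
  omega

theorem exists_twin_of_wick_notMem (h : D.IsTwoCycle L R x y z w) (hD : D.IsPlanar)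
    (hu : u ∉ ({L, R} : Set D.V)) (h6 : 6 ≤ (D.legs (D.component {L, R} u)).ncard)
    {k : D.V × Field6} (hk : k.1 ∈ ({L, R} : Set D.V))
    (hw : (D.wick k).1 ∉ D.component {L, R} u) : ∃ k', D.Twin {L, R} k k' := by
  refine (hD.exists_twin_or_six_le_ncard_legs h.connectedOn hk).resolve_right ?_
  rintro ⟨hu', h6'⟩
  rw [← ncard_wick_mem_component hu'] at h6'
  have hdisj := Set.disjoint_left.2 fun k' hk' (hw' : k' ∈ {k' : D.V × Field6 |
      k'.1 ∈ ({L, R} : Set D.V) ∧ (D.wick k').1 ∈ D.component {L, R} (D.wick k).1}) =>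
    (h.fields_subset hu' hk').2 hw'.2
  have hsub := Set.ncard_le_ncard <| Set.union_subset (h.fields_subset hu)
    fun k' (hk' : k' ∈ {k' : D.V × Field6 |
      k'.1 ∈ ({L, R} : Set D.V) ∧ (D.wick k').1 ∈ D.component {L, R} (D.wick k).1}) =>
    show k' ∈ {k | k.1 ∈ ({L, R} : Set D.V) ∧ (D.wick k).1 ∉ D.component {L, R} u} from
      ⟨hk'.1, fun hw' => hw <| by
        rw [← component_eq hu hw', component_eq hu' hk'.2]
        exact self_mem_component _ _⟩
  have hcard := ncard_wick_notMem_component hu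
  rw [Set.ncard_union_eq hdisj, h.ncard_fields] at hsub
  rw [Set.ncard_pair h.ne] at hcard
  omega

theorem exists_third_twin (h : D.IsTwoCycle L R x y z w) (hD : D.IsPlanar)
    (hL : D.IsRegular L) (hR : D.IsRegular R) (hu : u ∉ ({L, R} : Set D.V))
    (h6 : 6 ≤ (D.legs (D.component {L, R} u)).ncard) :
    ∃ t t', t ≠ x ∧ t ≠ z ∧ D.Twin {L, R} (L, t) (R, t') := by
  have hcard := ncard_wick_notMem_component hu
  rw [h.ncard_legs_component hD hu h6, Set.ncard_pair h.ne] at hcard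
  have hlt : h.fields.ncard <
      {k | k.1 ∈ ({L, R} : Set D.V) ∧ (D.wick k).1 ∉ D.component {L, R} u}.ncard := by
    rw [h.ncard_fields]
    omega
  obtain ⟨⟨v, i⟩, ⟨hv, hw⟩, hk⟩ := Set.exists_mem_notMem_of_ncard_lt_ncard hlt
  obtain ⟨k', hk'⟩ := h.exists_twin_of_wick_notMem hD hu h6 hv hw
  rcases hv with rfl | rfl
  · obtain ⟨j, rfl⟩ := hk'.exists_eq_right hL
    exact ⟨i, j, fun e => hk (by simp [fields, e]), fun e => hk (by simp [fields, e]), hk'⟩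
  · obtain ⟨j, rfl⟩ := Twin.exists_eq_right hR (Set.pair_comm L v ▸ hk')
    refine ⟨j, i, ?_, ?_, hk'.symm⟩
    · rintro rfl
      exact hk (by simp [fields, show i = y from congrArg Prod.snd (hk'.symm.unique h.twin_fst)])
    · rintro rfl
      exact hk (by simp [fields, show i = w from congrArg Prod.snd (hk'.symm.unique h.twin_snd)])

theorem loop_eq_or_loop_eq (h : D.IsTwoCycle L R x y z w) (hD : D.IsPlanar)
    (hu : u ∉ ({L, R} : Set D.V)) (h6 : 6 ≤ (D.legs (D.component {L, R} u)).ncard)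
    {t t' : Field6} (ht : D.Twin {L, R} (L, t) (R, t')) (c : Colour) :
    D.loop c (L, x) = D.loop c (L, z) ∨ D.loop c (L, x) = D.loop c (L, t) ∨
      D.loop c (L, z) = D.loop c (L, t) := by
  have htwin (i j) (hij : D.Twin {L, R} (L, i) (R, j)) :
      D.loop c (L, i) ∈ D.touching c {L} ∩ D.touching c {R} :=
    ⟨⟨(L, i), rfl, rfl⟩, ⟨(R, j), rfl, (hij.loop_eq c).symm⟩⟩
  by_contra! hne
  have hsub : ({D.loop c (L, x), D.loop c (L, z), D.loop c (L, t)} : Set _) ⊆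
      D.touching c {L} ∩ D.touching c {R} := by
    rintro _ (rfl | rfl | rfl)
    exacts [htwin _ _ h.twin_fst, htwin _ _ h.twin_snd, htwin _ _ ht]
  have hthree := Set.ncard_le_ncard hsub
  rw [Set.ncard_insert_of_notMem (by simpa using ⟨hne.1, hne.2.1⟩), Set.ncard_pair hne.2.2]
    at hthree
  have := hD.ncard_touching_inter_le_two h.ne h.connectedOn hu h6 c
  omega

theorem exists_triangle (h : D.IsTwoCycle L R x y z w) (hD : D.IsPlanar)
    (hL : D.IsRegular L) (hR : D.IsRegular R) (hu : u ∉ ({L, R} : Set D.V))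
    (h6 : 6 ≤ (D.legs (D.component {L, R} u)).ncard) :
    ∃ t t', t ≠ x ∧ t ≠ z ∧ D.Twin {L, R} (L, t) (R, t') ∧
      ∀ c, edge (D.kind L) c x = z ∧ edge (D.kind R) c y = w ∨
        edge (D.kind L) c x = t ∧ edge (D.kind R) c y = t' ∨
        edge (D.kind L) c z = t ∧ edge (D.kind R) c w = t' := by
  obtain ⟨t, t', htx, htz, ht⟩ := h.exists_third_twin hD hL hR hu h6
  refine ⟨t, t', htx, htz, ht, fun c => ?_⟩
  rcases h.loop_eq_or_loop_eq hD hu h6 ht c with e | e | e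
  · have e' := ((hL c x z e).resolve_left h.field_ne.symm).symm
    exact Or.inl ⟨e', h.twin_fst.edge_eq hR h.twin_snd e'⟩
  · have e' := ((hL c x t e).resolve_left htx).symm
    exact Or.inr (Or.inl ⟨e', h.twin_fst.edge_eq hR ht e'⟩)
  · have e' := ((hL c z t e).resolve_left htz).symm
    exact Or.inr (Or.inr ⟨e', h.twin_snd.edge_eq hR ht e'⟩)

theorem exists_isomorphism_or_exists_triangle (h : D.IsTwoCycle L R x y z w)
    (hD : D.IsPlanar) (hL : D.IsRegular L) (hR : D.IsRegular R) :
    (∃ ρ : Field6 → Field6, (∀ i, D.Twin {L, R} (L, i) (R, ρ i)) ∧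
      ∀ c i, ρ (edge (D.kind L) c i) = edge (D.kind R) c (ρ i)) ∨
    (∃ t t', t ≠ x ∧ t ≠ z ∧ D.Twin {L, R} (L, t) (R, t') ∧
      ∀ c, edge (D.kind L) c x = z ∧ edge (D.kind R) c y = w ∨
        edge (D.kind L) c x = t ∧ edge (D.kind R) c y = t' ∨
        edge (D.kind L) c z = t ∧ edge (D.kind R) c w = t') := by
  by_cases hbig : ∃ u ∉ ({L, R} : Set D.V), 6 ≤ (D.legs (D.component {L, R} u)).ncard
  · obtain ⟨u, hu, h6⟩ := hbig
    exact Or.inr (h.exists_triangle hD hL hR hu h6)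
  · have htwin (i : Field6) : ∃ j, D.Twin {L, R} (L, i) (R, j) := by
      obtain ⟨h', ht⟩ := (hD.exists_twin_or_six_le_ncard_legs h.connectedOn (h := (L, i))
        (Or.inl rfl)).resolve_right fun hw => hbig ⟨_, hw⟩
      obtain ⟨j, rfl⟩ := ht.exists_eq_right hL
      exact ⟨j, ht⟩
    choose ρ hρ using htwin
    exact Or.inl ⟨ρ, hρ, fun c i => ((hρ i).edge_eq hR (hρ _) rfl).symm⟩

end IsTwoCycle


/-! ### Maximal diagrams are planar -/

theorem connectedOn_univ_iff :
    D.ConnectedOn Set.univ ↔ Nonempty D.V ∧ ∀ u v : D.V, Relation.ReflTransGen D.Adj u v := by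
  constructor
  · rintro ⟨⟨u, -⟩, h⟩
    refine ⟨⟨u⟩, fun u v => ?_⟩
    have := h {v | Relation.ReflTransGen D.Adj u v} (Set.subset_univ _)
      ⟨u, Relation.ReflTransGen.refl⟩ fun k hk _ => Relation.ReflTransGen.tail hk (adj_wick k)
    exact (this ▸ Set.mem_univ v : v ∈ {v | Relation.ReflTransGen D.Adj u v})
  · rintro ⟨⟨u⟩, h⟩
    refine ⟨⟨u, trivial⟩, fun T _ ⟨t, ht⟩ hcl => Set.eq_univ_of_forall fun v => ?_⟩
    induction h t v with
    | refl => exact ht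
    | tail _ h2 ih =>
      obtain ⟨i, j, e⟩ := h2
      have := hcl (_, i) ih trivial
      rwa [e] at this

theorem connected_iff : D.Connected ↔ D.IsZeroCycle ∨ D.circles = 0 ∧ D.ConnectedOn Set.univ := by
  rw [connectedOn_univ_iff, Connected]; tauto

theorem innerLoops_univ (c : Colour) : D.innerLoops c Set.univ = Set.univ :=
  Set.eq_univ_of_forall fun _ _ _ => trivial

theorem card_loop_add_le (hD : D.ConnectedOn Set.univ) {a b : Colour} (hab : a ≠ b) :
    Nat.card (D.Loop a) + Nat.card (D.Loop b) ≤ 2 * Nat.card D.V + 2 := by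
  have := euler_bound hD hab
  rw [legs_univ, innerLoops_univ, innerLoops_univ, Set.ncard_univ, Set.ncard_univ,
    Set.ncard_univ, Set.ncard_empty] at this
  omega

theorem IsZeroCycle.fTotal (h : D.IsZeroCycle) : D.fTotal = 3 * D.numVertices + 3 := by
  have := h.1
  have hl : ∀ c, Nat.card (D.Loop c) = 0 := fun c => by
    have : IsEmpty (D.Loop c) := ⟨fun l => by
      obtain ⟨h, -⟩ := D.loop_surjective c l
      exact isEmptyElim h.1⟩
    exact Nat.card_of_isEmpty
  rw [Diagram.fTotal, numVertices, hl, hl, hl, h.2, Nat.card_of_isEmpty]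

theorem Connected.fTotal_le (h : D.Connected) : D.fTotal ≤ 3 * D.numVertices + 3 := by
  rcases connected_iff.1 h with h | ⟨h0, h⟩
  · exact h.fTotal.le
  · have h1 := card_loop_add_le h (show red ≠ green by decide)
    have h2 := card_loop_add_le h (show green ≠ blue by decide)
    have h3 := card_loop_add_le h (show red ≠ blue by decide)
    rw [Diagram.fTotal, numVertices, h0]
    omega

/-- The fields on the long loop of each colour in a necklace of prism snails. The field 6 is written
`0`, the normal form of `(6 : Fin 6)`. -/
def necklaceFields : Colour → Finset Field6
  | red => {0, 1}
  | green => {0, 1, 2, 5}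
  | blue => {0, 1, 3, 4}

/-- A ring of `n + 1` elementary prism snails, cut at the propagators of their fields 1 and 6. It
attains the bound of `Connected.fTotal_le`. -/
def necklace (n : ℕ) : Diagram where
  V := ZMod (n + 1)
  finite := inferInstance
  kind := fun _ => prism
  wick := fun h => if h.2 = 1 then (h.1 + 1, 0) else if h.2 = 0 then (h.1 - 1, 1)
    else (h.1, snailPairing prism h.2)
  wick_wick := by
    have h : ∀ i : Field6, i ≠ 1 → i ≠ 0 →
        snailPairing prism i ≠ 1 ∧ snailPairing prism i ≠ 0 := by decide
    rintro ⟨j, i⟩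
    by_cases h1 : i = 1
    · subst h1; simp
    by_cases h6 : i = 0
    · subst h6; simp
    obtain ⟨h1', h6'⟩ := h i h1 h6
    simp [h1, h6, h1', h6', snailPairing_snailPairing]
  wick_ne := by
    rintro ⟨j, i⟩ e
    by_cases h1 : i = 1
    · subst h1; simp at e
    by_cases h6 : i = 0
    · subst h6; simp at e
    simp [h1, h6, snailPairing_ne] at e
  circles := 0

theorem necklace_connected (n : ℕ) : (necklace n).Connected := by
  refine connected_iff.2 (Or.inr ⟨rfl, ⟨(0 : ZMod (n + 1)), trivial⟩, ?_⟩)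
  change ∀ T : Set (ZMod (n + 1)), _
  rintro T - ⟨(t : ZMod (n + 1)), ht⟩ hcl
  refine Set.eq_univ_of_forall fun (v : ZMod (n + 1)) => ?_
  have hstep : ∀ j : ZMod (n + 1), j ∈ T → j + 1 ∈ T := fun j hj => hcl (j, 1) hj trivial
  have : ∀ m : ℕ, t + (m : ZMod (n + 1)) ∈ T := by
    intro m
    induction m with
    | zero => rw [Nat.cast_zero, add_zero]; exact ht
    | succ m ih => rw [Nat.cast_succ, ← add_assoc]; exact hstep _ ih
  have hv := this (ZMod.val (v - t))
  rwa [ZMod.natCast_val, ZMod.cast_id, add_sub_cancel] at hv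

theorem le_card_loop_necklace (n : ℕ) (c : Colour) :
    n + 2 ≤ Nat.card ((necklace n).Loop c) := by
  let F : (necklace n).Loop c → Option (ZMod (n + 1)) :=
    Quot.lift (fun h => if h.2 ∈ necklaceFields c then none else some h.1) (by
      have hmem : ∀ c, 1 ∈ necklaceFields c ∧ 0 ∈ necklaceFields c := by decide
      have hsnail : ∀ c i, snailPairing prism i ∈ necklaceFields c ↔ i ∈ necklaceFields c := by
        decide
      have hedge : ∀ c i, edge prism c i ∈ necklaceFields c ↔ i ∈ necklaceFields c := by decide
      rintro ⟨(j : ZMod (n + 1)), i⟩ _ (rfl | rfl)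
      · simp only [necklace]
        by_cases e1 : i = 1
        · simp [e1, hmem]
        by_cases e6 : i = 0
        · simp [e6, hmem]
        simp [e1, e6, hsnail]
      · simp [necklace, hedge])
  have hF : Function.Surjective F := by
    have hproper : ∀ c, ∃ i, i ∉ necklaceFields c := by decide
    have hmem : ∀ c, 1 ∈ necklaceFields c := by decide
    rintro (_ | j)
    · exact ⟨Quot.mk _ ((0 : ZMod (n + 1)), 1), if_pos (hmem c)⟩
    · obtain ⟨i, hi⟩ := hproper c
      exact ⟨Quot.mk _ (j, i), if_neg hi⟩
  have := Nat.card_le_card_of_surjective F hF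
  rw [Finite.card_option, Nat.card_zmod] at this
  exact this

theorem exists_connected_fTotal (n : ℕ) :
    ∃ D : Diagram, D.Connected ∧ D.numVertices = n ∧ 3 * n + 3 ≤ D.fTotal := by
  cases n with
  | zero =>
    let Z : Diagram := ⟨Empty, inferInstance, fun v => v.elim, id, fun _ => rfl,
      fun h => h.1.elim, 1⟩
    have hZ : Z.IsZeroCycle := ⟨inferInstanceAs (IsEmpty Empty), rfl⟩
    have h0 : Z.numVertices = 0 := Nat.card_of_isEmpty (α := Empty)
    exact ⟨Z, Or.inl hZ, h0, by rw [hZ.fTotal, h0]⟩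
  | succ n =>
    refine ⟨necklace n, necklace_connected n, Nat.card_zmod (n + 1), ?_⟩
    have h1 := le_card_loop_necklace n red
    have h2 := le_card_loop_necklace n green
    have h3 := le_card_loop_necklace n blue
    rw [Diagram.fTotal]
    omega

theorem isMaximal_iff :
    D.IsMaximal ↔ D.Connected ∧ D.fTotal = 3 * D.numVertices + 3 := by
  constructor
  · rintro ⟨h1, h2⟩
    obtain ⟨D', c', n', f'⟩ := exists_connected_fTotal D.numVertices
    have := h2 D' c' n'
    have := h1.fTotal_le
    exact ⟨h1, by omega⟩
  · rintro ⟨h1, h2⟩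
    exact ⟨h1, fun D' c' n' => by rw [h2, ← n']; exact c'.fTotal_le⟩

theorem IsMaximal.isPlanar (h : D.IsMaximal) [hV : Nonempty D.V] :
    D.IsPlanar ∧ D.circles = 0 := by
  obtain ⟨h1, h2⟩ := isMaximal_iff.1 h
  rcases connected_iff.1 h1 with h | ⟨h0, h⟩
  · exact (not_isEmpty_of_nonempty D.V h.1).elim
  · have e1 := card_loop_add_le h (show red ≠ green by decide)
    have e2 := card_loop_add_le h (show green ≠ blue by decide)
    have e3 := card_loop_add_le h (show red ≠ blue by decide)
    rw [Diagram.fTotal, numVertices, h0] at h2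
    exact ⟨⟨h, fun c => by cases c <;> omega⟩, h0⟩

/-! ### Short cycles of planar diagrams -/

theorem IsRegular.not_oneCycle {v : D.V} (hv : D.IsRegular v) {x y : Field6} :
    D.wick (v, x) ≠ (v, y) := by
  intro e
  refine hv.false (i := x) (j := y) (fun h => D.wick_ne (v, x) (by rw [e, h])) fun c => ?_
  rw [← e, loop_wick]

theorem IsPlanar.isSnailForm (hD : D.IsPlanar) {v : D.V} {x y : Field6}
    (h : D.IsOneCycle v x y) : D.IsSnailForm v x y := by
  rcases hD.isRegular_or_isSnailVertex v with hv | ⟨s, hs, ht⟩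
  · exact absurd h hv.not_oneCycle
  · have e : s x = y := congrArg Prod.snd
      ((ht x).unique (twin_of_wick (A := {v}) (h := (v, x)) (h' := (v, y)) rfl rfl h))
    exact ⟨s, hs, e, fun i _ _ => (ht i).joined⟩

theorem not_forall_map_edge_prism_eq_edge_wheel {ρ : Field6 → Field6}
    (hρ : Function.Injective ρ) : ¬ ∀ c i, ρ (edge prism c i) = edge wheel c (ρ i) := by
  intro h
  have hwheel : ∀ i, edge wheel red (edge wheel green (edge wheel blue
      (edge wheel red (edge wheel green (edge wheel blue i))))) = i := by decide
  have hprism : edge prism red (edge prism green (edge prism blue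
      (edge prism red (edge prism green (edge prism blue 1))))) = 6 := by decide
  have h1 := hwheel (ρ 1)
  rw [← h, ← h, ← h, ← h, ← h, ← h, hprism] at h1
  exact absurd (hρ h1) (by decide)

theorem not_forall_edge_wheel_mem_triangle {y w t : Field6} (hyw : y ≠ w) :
    ¬ ∀ c, edge wheel c y = w ∨ edge wheel c y = t ∨ edge wheel c w = t := by
  revert y w t; decide

namespace IsTwoCycle

variable {L R : D.V} {x y z w : Field6} {s : Perm Field6}

theorem exists_connectedOn_of_isSnailVertex (h : D.IsTwoCycle L R x y z w)
    (hs : D.IsSnailVertex L s) : ∃ K, D.ConnectedOn K ∧ Disjoint K {L} ∧ R ∈ K ∧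
      D.legs K = {D.wick (L, x), D.wick (L, s x)} := by
  rcases (hs.2 x).2.2.2 with e | ⟨K, hK, hd, hl⟩
  · rw [h.wick_fst] at e
    exact absurd (congrArg Prod.fst e).symm h.ne
  · have hR := fst_mem_of_legs_eq hl
    rw [h.wick_fst] at hR
    exact ⟨K, hK, hd, hR, hl⟩

theorem isSnailVertex_apply (h : D.IsTwoCycle L R x y z w) (hs : D.IsSnailVertex L s) :
    s x = z := by
  obtain ⟨K, -, hd, hR, hl⟩ := h.exists_connectedOn_of_isSnailVertex hs
  have hmem : (R, w) ∈ D.legs K :=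
    ⟨hR, by rw [h.wick_snd']; exact fun hL => Set.disjoint_left.1 hd hL rfl⟩
  rw [hl, ← h.wick_snd] at hmem
  rcases hmem with e | e
  · exact absurd (congrArg Prod.snd (wick_injective e)).symm h.field_ne
  · exact (congrArg Prod.snd (wick_injective e)).symm

theorem isSnailVertex_twin (h : D.IsTwoCycle L R x y z w) (hs : D.IsSnailVertex L s)
    {i : Field6} (hix : i ≠ x) (hiz : i ≠ z) : D.Twin {L, R} (L, i) (L, s i) := by
  refine ⟨(hs.2 i).1, Or.inl rfl, Or.inl rfl, (hs.2 i).2.2.2.imp_right ?_⟩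
  rintro ⟨K', hK', hd', hl'⟩
  refine ⟨K', hK', ?_, hl'⟩
  rw [Set.disjoint_insert_right, Set.disjoint_singleton_right]
  refine ⟨Set.disjoint_singleton_right.1 hd', fun hR' => ?_⟩
  obtain ⟨K, hK, hd, hR, hl⟩ := h.exists_connectedOn_of_isSnailVertex hs
  obtain rfl := eq_of_connectedOn hK hK' hd hd'
    (wick_mem_of_legs_eq (A := {L}) (h := (L, x)) (h' := (L, s x)) rfl rfl hl)
    (wick_mem_of_legs_eq (A := {L}) (h := (L, i)) (h' := (L, s i)) rfl rfl hl') hR hR'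
  have hi : D.wick (L, i) ∈ ({D.wick (L, x), D.wick (L, s x)} : Set _) := by
    rw [← hl, hl']; exact Or.inl rfl
  rcases hi with e | e
  · exact hix (congrArg Prod.snd (wick_injective e))
  · exact hiz ((congrArg Prod.snd (wick_injective e)).trans (h.isSnailVertex_apply hs))

theorem exists_isSnailVertex (h : D.IsTwoCycle L R x y z w) (hD : D.IsPlanar)
    (hs : D.IsSnailVertex L s) : ∃ t, D.IsSnailVertex R t := by
  refine (hD.isRegular_or_isSnailVertex R).resolve_left fun hR =>
    hR.false h.field_ne' fun c => ?_
  have hloop := (hs.2 x).loop_eq c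
  rwa [h.isSnailVertex_apply hs, ← D.loop_wick c (L, x), ← D.loop_wick c (L, z), h.wick_fst,
    h.wick_snd] at hloop

theorem not_isRegular_of_prism_wheel (h : D.IsTwoCycle L R x y z w) (hD : D.IsPlanar)
    (hkL : D.kind L = prism) (hkR : D.kind R = wheel) (hL : D.IsRegular L) :
    ¬ D.IsRegular R := by
  intro hR
  rcases h.exists_isomorphism_or_exists_triangle hD hL hR with
    ⟨ρ, hρ, hedge⟩ | ⟨t, t', -, -, -, htriangle⟩
  · refine not_forall_map_edge_prism_eq_edge_wheel (ρ := ρ) (fun i j e => ?_)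
      (by rwa [hkL, hkR] at hedge)
    have hj := hρ j
    rw [← e] at hj
    exact congrArg Prod.snd ((hρ i).symm.unique hj.symm)
  · rw [hkR] at htriangle
    exact not_forall_edge_wheel_mem_triangle h.field_ne' fun c =>
      (htriangle c).imp And.right (Or.imp And.right And.right)

theorem not_isMelonForm (h : D.IsTwoCycle L R x y z w) (hs : D.IsSnailVertex L s) :
    ¬ D.IsMelonForm L R x y z w := by
  rintro ⟨ρ, -, -, hρ⟩
  obtain ⟨i, hix, hiz⟩ : ∃ i : Field6, i ≠ x ∧ i ≠ z := by
    clear * -; revert x z; decide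
  obtain ⟨S, hS, hcl⟩ := hρ i hix hiz
  have hend : ¬ ((L, s i).1 ∈ S ∨ (L, s i) = (L, i) ∨ (L, s i) = (R, ρ i)) := by
    rintro (hL | e | e)
    · exact Set.disjoint_left.1 hS hL (Or.inl rfl)
    · exact (hs.2 i).1 e.symm
    · exact h.ne (congrArg Prod.fst e)
  rcases (h.isSnailVertex_twin hs hix hiz).2.2.2 with e | ⟨K, hK, hd, hl⟩
  · exact hend (e ▸ hcl (L, i) (Or.inr (Or.inl rfl)))
  · have hin (k : D.V × Field6) (hk : k.1 ∈ K) (hkS : k.1 ∈ S ∨ k = (L, i) ∨ k = (R, ρ i)) :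
        k.1 ∈ S := by
      rcases hkS with hkS | rfl | rfl
      · exact hkS
      · exact absurd (Or.inl rfl) (Set.disjoint_left.1 hd hk)
      · exact absurd (Or.inr rfl) (Set.disjoint_left.1 hd hk)
    have hsub : K ⊆ S := fun _ => hK.induction (p := (· ∈ S)) (fst_mem_of_legs_eq hl)
      (hin _ (fst_mem_of_legs_eq hl) (hcl (L, i) (Or.inr (Or.inl rfl))))
      fun k _ hw hkS => hin _ hw (hcl k (Or.inl hkS))
    rw [Set.pair_comm] at hl
    have := hcl _ (Or.inl (hsub (fst_mem_of_legs_eq hl)))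
    rw [D.wick_wick] at this
    exact hend this

end IsTwoCycle

section MixedTwoCycle

variable {L R : D.V} {x y z w : Field6}

theorem IsMixedTwoCycle.isTwoCycle (h : D.IsMixedTwoCycle L R x y z w) :
    D.IsTwoCycle L R x y z w := by
  obtain ⟨hkL, hkR, hxz, h1, h2⟩ := h
  refine ⟨?_, hxz, h1, h2⟩
  rintro rfl
  exact absurd (hkL.symm.trans hkR) (by decide)

theorem IsPlanar.exists_isSnailVertex_of_isMixedTwoCycle (hD : D.IsPlanar)
    (h : D.IsMixedTwoCycle L R x y z w) :
    ∃ s t, D.IsSnailVertex L s ∧ D.IsSnailVertex R t := by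
  rcases hD.isRegular_or_isSnailVertex L with hL | ⟨s, hs⟩
  · obtain ⟨t, ht⟩ := (hD.isRegular_or_isSnailVertex R).resolve_left
      (h.isTwoCycle.not_isRegular_of_prism_wheel hD h.1 h.2.1 hL)
    obtain ⟨s, hs⟩ := h.isTwoCycle.symm.exists_isSnailVertex hD ht
    exact ⟨s, t, hs, ht⟩
  · obtain ⟨t, ht⟩ := h.isTwoCycle.exists_isSnailVertex hD hs
    exact ⟨s, t, hs, ht⟩

theorem IsTwoCycle.isDoubleSnail (h : D.IsTwoCycle L R x y z w) {s t : Perm Field6}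
    (hs : D.IsSnailVertex L s) (ht : D.IsSnailVertex R t) : D.IsDoubleSnail L R x y z w :=
  ⟨⟨s, hs.1, h.isSnailVertex_apply hs, fun _ hi hi' => (h.isSnailVertex_twin hs hi hi').joined⟩,
    ⟨t, ht.1, h.symm.isSnailVertex_apply ht, fun _ hi hi' =>
      Set.pair_comm L R ▸ (h.symm.isSnailVertex_twin ht hi hi').joined⟩⟩

end MixedTwoCycle

end Diagram

namespace Diagram

variable {D D' E U : Diagram}

/-! ### Loops and connectedness of modified diagrams -/

/-- A set of vertices that no propagator leaves. -/
def WickClosed (D : Diagram) (T : Set D.V) : Prop :=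
  ∀ h : D.V × Field6, h.1 ∈ T → (D.wick h).1 ∈ T

theorem WickClosed.mem_iff {T : Set D.V} (hT : D.WickClosed T) {h k : D.V × Field6}
    (hk : D.wick h = k) : k.1 ∈ T ↔ h.1 ∈ T := by
  subst hk
  exact ⟨fun hh => by simpa only [D.wick_wick] using hT _ hh, hT h⟩

theorem connectedOn_univ_iff_wickClosed : D.ConnectedOn Set.univ ↔
    Nonempty D.V ∧ ∀ T, T.Nonempty → D.WickClosed T → T = Set.univ := by
  constructor
  · rintro ⟨⟨v, -⟩, h⟩
    exact ⟨⟨v⟩, fun T hT hcl => h T (Set.subset_univ _) hT fun k hk _ => hcl k hk⟩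
  · rintro ⟨⟨v⟩, h⟩
    exact ⟨⟨v, trivial⟩, fun T _ hT hcl => h T hT fun k hk => hcl k hk trivial⟩

theorem connected_iff_of_nonempty (h : Nonempty D.V) :
    D.Connected ↔ D.circles = 0 ∧ ∀ T, T.Nonempty → D.WickClosed T → T = Set.univ := by
  rw [connected_iff, connectedOn_univ_iff_wickClosed, IsZeroCycle]
  have := not_isEmpty_of_nonempty D.V
  tauto

theorem connected_iff_of_surjective {q : D'.V → D.V} (hq : q.Surjective)
    (hc : D'.circles = D.circles) (hpre : ∀ T, D.WickClosed T → D'.WickClosed (q ⁻¹' T))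
    (hex : ∀ T', D'.WickClosed T' → ∃ T, D.WickClosed T ∧ q ⁻¹' T = T') :
    D.Connected ↔ D'.Connected := by
  rcases isEmpty_or_nonempty D'.V with hV' | hV'
  · have hV : IsEmpty D.V := ⟨fun v => hV'.elim (hq v).choose⟩
    simp only [Connected, IsZeroCycle, hc, hV, hV', true_and, not_nonempty_iff.2 hV,
      not_nonempty_iff.2 hV', false_and]
  · rw [connected_iff_of_nonempty hV', connected_iff_of_nonempty (hV'.map q), hc]
    refine and_congr_right fun _ => ⟨fun h T' hne hcl => ?_, fun h T hne hcl => ?_⟩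
    · obtain ⟨T, hT, rfl⟩ := hex T' hcl
      rw [h T (hne.elim fun v hv => ⟨q v, hv⟩) hT, Set.preimage_univ]
    · exact Set.preimage_injective.2 hq (h _ (hne.preimage hq) (hpre T hcl))

theorem loop_congr {X : Type*} {c : Colour} (F : D.V × Field6 → X)
    (hw : ∀ h, F (D.wick h) = F h) (he : ∀ h, F (D.inner c h) = F h) {h h' : D.V × Field6}
    (hh : D.loop c h = D.loop c h') : F h = F h' :=
  (mem_of_loop_eq (T := {k | F k = F h}) (fun k hk => (hw k).trans hk)
    (fun k hk => (he k).trans hk) hh rfl).symm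

theorem card_le_card_loop {X : Type*} {c : Colour} (F : D.V × Field6 → X)
    (hw : ∀ h, F (D.wick h) = F h) (he : ∀ h, F (D.inner c h) = F h)
    (hF : Function.Surjective F) : Nat.card X ≤ Nat.card (D.Loop c) := by
  refine Nat.card_le_card_of_surjective (Quot.lift F ?_ : D.Loop c → X) fun x => ?_
  · exact fun h h' hh => loop_congr F hw he (Quot.sound hh)
  · obtain ⟨h, rfl⟩ := hF x
    exact ⟨D.loop c h, rfl⟩

theorem card_loop_eq {X : Type*} [Finite X] {c : Colour} (F : D.V × Field6 → X)
    (hw : ∀ h, F (D.wick h) = F h) (he : ∀ h, F (D.inner c h) = F h)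
    (hF : Function.Surjective F) (G : X → D.Loop c) (hG : ∀ h, G (F h) = D.loop c h) :
    Nat.card (D.Loop c) = Nat.card X := by
  refine (Nat.card_le_card_of_surjective G fun l => ?_).antisymm (card_le_card_loop F hw he hF)
  obtain ⟨h, rfl⟩ := D.loop_surjective c l
  exact ⟨F h, hG h⟩

theorem card_loop_congr {c : Colour} (e : D.V × Field6 ≃ D'.V × Field6)
    (hw : ∀ h, D'.wick (e h) = e (D.wick h)) (hi : ∀ h, D'.inner c (e h) = e (D.inner c h)) :
    Nat.card (D'.Loop c) = Nat.card (D.Loop c) :=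
  (Nat.card_congr (Quot.congr e fun h h' => by
    change h' = D.wick h ∨ h' = D.inner c h ↔ e h' = D'.wick (e h) ∨ e h' = D'.inner c (e h)
    rw [hw, hi, e.apply_eq_iff_eq, e.apply_eq_iff_eq])).symm

-- A parity argument: `c`-edges and the remaining propagators pair up the half-edges with `Q`.
theorem of_cut {c : Colour} {a : D.V × Field6} (Q : D.V × Field6 → Prop)
    (hi : ∀ b, Q b → Q (D.inner c b)) (hw : ∀ b, b ≠ a → b ≠ D.wick a → Q b → Q (D.wick b))
    (ha : Q a) : Q (D.wick a) := by
  by_contra hn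
  refine not_mapsTo_sdiff_singleton_of_involution (f := D.inner c) (g := D.wick) (a := a)
    (T := {b | Q b}) ha hi (D.inner_inner c) (D.inner_ne c) D.wick_wick D.wick_ne
    fun b ⟨hb, hba⟩ => ?_
  have hb' : b ≠ D.wick a := by rintro rfl; exact hn hb
  exact ⟨hw b hba hb' hb, fun e => hb' (by rw [← e, D.wick_wick])⟩

theorem wickClosed_of_cut {T : Set D.V} (a : D.V × Field6)
    (hT : ∀ b, b ≠ a → b ≠ D.wick a → b.1 ∈ T → (D.wick b).1 ∈ T) : D.WickClosed T := by
  intro b hb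
  by_cases h1 : b = a
  · subst h1
    exact of_cut (c := red) (fun k => k.1 ∈ T) (fun _ => id) hT hb
  by_cases h2 : b = D.wick a
  · subst h2
    refine of_cut (c := red) (fun k => k.1 ∈ T) (fun _ => id) (fun k hk hk' => ?_) hb
    exact hT k (by rwa [D.wick_wick] at hk') hk
  exact hT b h1 h2 hb

theorem card_image_le_card_loop [Nonempty D.V] {X : Type*} [DecidableEq X] {c : Colour}
    (F : Field6 → X) (hw : ∀ h, F (D.wick h).2 = F h.2)
    (he : ∀ v i, F (edge (D.kind v) c i) = F i) :
    (Finset.univ.image F).card ≤ Nat.card (D.Loop c) := by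
  rw [← Nat.card_eq_finsetCard]
  refine card_le_card_loop (X := Finset.univ.image F)
    (fun h => ⟨F h.2, Finset.mem_image_of_mem F (Finset.mem_univ _)⟩)
    (fun h => Subtype.ext (hw h)) (fun h => Subtype.ext (he _ h.2)) ?_
  rintro ⟨x, hx⟩
  obtain ⟨i, -, rfl⟩ := Finset.mem_image.1 hx
  exact ⟨(Classical.arbitrary D.V, i), rfl⟩

/-! ### Replacing a propagator -/

/-- The disjoint union of two diagrams. -/
def sum (D E : Diagram) : Diagram where
  V := D.V ⊕ E.V
  finite := inferInstance
  kind := Sum.elim D.kind E.kind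
  wick h := Sum.elim (fun v => Prod.map Sum.inl id (D.wick (v, h.2)))
    (fun v => Prod.map Sum.inr id (E.wick (v, h.2))) h.1
  wick_wick := by
    rintro ⟨v | v, i⟩
    · exact congrArg (Prod.map Sum.inl id) (D.wick_wick (v, i))
    · exact congrArg (Prod.map Sum.inr id) (E.wick_wick (v, i))
  wick_ne := by
    rintro ⟨v | v, i⟩ e
    · exact D.wick_ne (v, i) (Sum.inl_injective.prodMap Function.injective_id e)
    · exact E.wick_ne (v, i) (Sum.inr_injective.prodMap Function.injective_id e)
  circles := D.circles + E.circles

/-- The half-edge of a disjoint union that comes from a half-edge of the first diagram. -/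
def inl (h : D.V × Field6) : (D.sum E).V × Field6 := (Sum.inl h.1, h.2)

/-- The half-edge of a disjoint union that comes from a half-edge of the second diagram. -/
def inr (a : E.V × Field6) : (D.sum E).V × Field6 := (Sum.inr a.1, a.2)

theorem inl_injective : Function.Injective (inl : _ → (D.sum E).V × Field6) :=
  Sum.inl_injective.prodMap Function.injective_id

theorem inr_injective : Function.Injective (inr : _ → (D.sum E).V × Field6) :=
  Sum.inr_injective.prodMap Function.injective_id

theorem inl_ne_inr {h : D.V × Field6} {a : E.V × Field6} : (inl h : (D.sum E).V × _) ≠ inr a :=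
  fun e => Sum.inl_ne_inr (congrArg Prod.fst e)

/-- The loop of a disjoint union through a half-edge of one of the two diagrams. -/
def sumLoop (c : Colour) (h : (D.sum E).V × Field6) : D.Loop c ⊕ E.Loop c :=
  Sum.map (fun v => D.loop c (v, h.2)) (fun v => E.loop c (v, h.2)) h.1

theorem sumLoop_wick (c : Colour) (h : (D.sum E).V × Field6) :
    sumLoop c ((D.sum E).wick h) = sumLoop c h := by
  obtain ⟨v | v, i⟩ := h
  · exact congrArg Sum.inl (D.loop_wick c (v, i))
  · exact congrArg Sum.inr (E.loop_wick c (v, i))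

theorem sumLoop_inner (c : Colour) (h : (D.sum E).V × Field6) :
    sumLoop c ((D.sum E).inner c h) = sumLoop c h := by
  obtain ⟨v | v, i⟩ := h
  · exact congrArg Sum.inl (D.loop_inner c (v, i))
  · exact congrArg Sum.inr (E.loop_inner c (v, i))

theorem sum_loop_inl_ne_inr (c : Colour) (h : D.V × Field6) (a : E.V × Field6) :
    (D.sum E).loop c (inl h) ≠ (D.sum E).loop c (inr a) :=
  fun e => Sum.inl_ne_inr (loop_congr (sumLoop c) (sumLoop_wick c) (sumLoop_inner c) e)

theorem card_loop_sum (D E : Diagram) (c : Colour) :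
    Nat.card ((D.sum E).Loop c) = Nat.card (D.Loop c) + Nat.card (E.Loop c) := by
  rw [← Nat.card_sum]
  refine card_loop_eq (sumLoop c) (sumLoop_wick c) (sumLoop_inner c) ?_
    (Sum.elim (Quot.map inl ?_) (Quot.map inr ?_)) ?_
  · rintro (l | l)
    · obtain ⟨k, rfl⟩ := D.loop_surjective c l
      exact ⟨inl k, rfl⟩
    · obtain ⟨k, rfl⟩ := E.loop_surjective c l
      exact ⟨inr k, rfl⟩
  · rintro h _ (rfl | rfl)
    exacts [Or.inl rfl, Or.inr rfl]
  · rintro h _ (rfl | rfl)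
    exacts [Or.inl rfl, Or.inr rfl]
  · rintro ⟨v | v, i⟩ <;> rfl

/-- `D'` is `U`, with vertices renamed by `φ`, after the propagators at `h` and `a` have exchanged
their ends: `h` gets contracted with `a`, and `U.wick h` with `U.wick a`. -/
structure IsRewiring (U D' : Diagram) (φ : U.V ≃ D'.V) (h a : U.V × Field6) : Prop where
  kind : ∀ v, D'.kind (φ v) = U.kind v
  wick_left : D'.wick (φ h.1, h.2) = (φ a.1, a.2)
  wick_right : D'.wick (φ (U.wick h).1, (U.wick h).2) = (φ (U.wick a).1, (U.wick a).2)
  wick_of_ne : ∀ k, k ≠ h → k ≠ U.wick h → k ≠ a → k ≠ U.wick a →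
    D'.wick (φ k.1, k.2) = (φ (U.wick k).1, (U.wick k).2)

namespace IsRewiring

variable {φ : U.V ≃ D'.V} {h a : U.V × Field6} (hr : IsRewiring U D' φ h a) {c : Colour}
include hr

theorem inner (c : Colour) (k : U.V × Field6) :
    D'.inner c (φ k.1, k.2) = (φ (U.inner c k).1, (U.inner c k).2) := by
  simp only [Diagram.inner, hr.kind]

theorem loop_left (c : Colour) : D'.loop c (φ a.1, a.2) = D'.loop c (φ h.1, h.2) := by
  rw [← hr.wick_left, loop_wick]

theorem symm : IsRewiring U D' φ a h where
  kind := hr.kind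
  wick_left := by rw [← hr.wick_left, D'.wick_wick]
  wick_right := by rw [← hr.wick_right, D'.wick_wick]
  wick_of_ne k h1 h2 h3 h4 := hr.wick_of_ne k h3 h4 h1 h2

theorem loop_wick_eq (hne : U.loop c h ≠ U.loop c a) :
    D'.loop c (φ (U.wick a).1, (U.wick a).2) = D'.loop c (φ a.1, a.2) := by
  refine (of_cut (D := U) (c := c) (a := a) (fun b => U.loop c b = U.loop c a ∧
    D'.loop c (φ b.1, b.2) = D'.loop c (φ a.1, a.2)) ?_ ?_ ⟨rfl, rfl⟩).2
  · exact fun b hb => ⟨(U.loop_inner c b).trans hb.1, by rw [← hr.inner, loop_inner, hb.2]⟩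
  · refine fun b h1 h2 hb => ⟨(U.loop_wick c b).trans hb.1, ?_⟩
    rw [← hr.wick_of_ne b ?_ ?_ h1 h2, loop_wick, hb.2]
    · rintro rfl
      exact hne hb.1
    · rintro rfl
      exact hne ((U.loop_wick c h).symm.trans hb.1)

theorem loop_eq_of_loop_eq (hne : U.loop c h ≠ U.loop c a) {k k' : U.V × Field6}
    (hk : U.loop c k = U.loop c k') : D'.loop c (φ k.1, k.2) = D'.loop c (φ k'.1, k'.2) := by
  have ha := hr.loop_wick_eq hne
  have hh := hr.symm.loop_wick_eq hne.symm
  refine loop_congr (fun k => D'.loop c (φ k.1, k.2)) (fun k => ?_)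
    (fun k => by rw [← hr.inner, loop_inner]) hk
  by_cases h1 : k = h
  · rwa [h1]
  by_cases h2 : k = U.wick h
  · rw [h2, U.wick_wick, hh]
  by_cases h3 : k = a
  · rwa [h3]
  by_cases h4 : k = U.wick a
  · rw [h4, U.wick_wick, ha]
  rw [← hr.wick_of_ne k h1 h2 h3 h4, loop_wick]

theorem card_loop (hne : U.loop c h ≠ U.loop c a) :
    Nat.card (D'.Loop c) + 1 = Nat.card (U.Loop c) := by
  classical
  let merge (l : U.Loop c) : {l // l ≠ U.loop c a} :=
    if hl : l = U.loop c a then ⟨U.loop c h, hne⟩ else ⟨l, hl⟩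
  have merge_eq : merge (U.loop c h) = merge (U.loop c a) := by
    simp only [merge, dif_neg hne, dif_pos]
  let F (x : D'.V × Field6) := merge (U.loop c (φ.symm x.1, x.2))
  have F_apply (k : U.V × Field6) : F (φ k.1, k.2) = merge (U.loop c k) := by
    simp only [F, φ.symm_apply_apply]
  let G : U.Loop c → D'.Loop c := Quot.lift (fun k => D'.loop c (φ k.1, k.2)) fun k k' hk =>
    hr.loop_eq_of_loop_eq hne (Quot.sound hk)
  have forall_half {Q : D'.V × Field6 → Prop} (hQ : ∀ k : U.V × Field6, Q (φ k.1, k.2)) (x) :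
      Q x := by simpa using hQ (φ.symm x.1, x.2)
  have hcard : Nat.card (D'.Loop c) = Nat.card {l // l ≠ U.loop c a} := by
    refine card_loop_eq F (forall_half fun k => ?_) (forall_half fun k => ?_) ?_ (fun l => G l)
      (forall_half fun k => ?_)
    · by_cases h1 : k = h
      · rw [h1, hr.wick_left, F_apply, F_apply, merge_eq]
      by_cases h2 : k = U.wick h
      · rw [h2, hr.wick_right, F_apply, F_apply, loop_wick, loop_wick, merge_eq]
      by_cases h3 : k = a
      · rw [h3, hr.symm.wick_left, F_apply, F_apply, merge_eq]
      by_cases h4 : k = U.wick a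
      · rw [h4, hr.symm.wick_right, F_apply, F_apply, loop_wick, loop_wick, merge_eq]
      rw [hr.wick_of_ne k h1 h2 h3 h4, F_apply, F_apply, loop_wick]
    · rw [hr.inner, F_apply, F_apply, loop_inner]
    · rintro ⟨l, hl⟩
      obtain ⟨k, rfl⟩ := U.loop_surjective c l
      exact ⟨(φ k.1, k.2), (F_apply k).trans (dif_neg hl)⟩
    · rw [F_apply]
      by_cases hk : U.loop c k = U.loop c a
      · rw [hk, ← merge_eq, hr.loop_eq_of_loop_eq hne hk, hr.loop_left]
        simp only [merge, dif_neg hne]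
        rfl
      · simp only [merge, dif_neg hk]
        rfl
  rw [hcard]
  exact Set.ncard_singleton (U.loop c a) ▸ Set.ncard_compl_add_ncard {U.loop c a}

theorem wickClosed_iff {T : Set D'.V} : D'.WickClosed T ↔
    (φ h.1 ∈ T ↔ φ a.1 ∈ T) ∧ (φ (U.wick h).1 ∈ T ↔ φ (U.wick a).1 ∈ T) ∧
      ∀ k, k ≠ h → k ≠ U.wick h → k ≠ a → k ≠ U.wick a → φ k.1 ∈ T → φ (U.wick k).1 ∈ T := by
  refine ⟨fun hT => ⟨(hT.mem_iff hr.wick_left).symm, (hT.mem_iff hr.wick_right).symm,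
    fun k h1 h2 h3 h4 => (hT.mem_iff (hr.wick_of_ne k h1 h2 h3 h4)).2⟩, ?_⟩
  rintro ⟨hl, hrt, hne⟩ ⟨v, i⟩ hv
  obtain ⟨v, rfl⟩ := φ.surjective v
  by_cases h1 : (v, i) = h
  · subst h1
    rwa [hr.wick_left, ← hl]
  by_cases h2 : (v, i) = U.wick h
  · rw [show (φ v, i) = (φ (U.wick h).1, (U.wick h).2) by rw [← h2], hr.wick_right, ← hrt, ← h2]
    exact hv
  by_cases h3 : (v, i) = a
  · subst h3
    rwa [hr.symm.wick_left, hl]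
  by_cases h4 : (v, i) = U.wick a
  · rw [show (φ v, i) = (φ (U.wick a).1, (U.wick a).2) by rw [← h4], hr.symm.wick_right, hrt, ← h4]
    exact hv
  rw [hr.wick_of_ne (v, i) h1 h2 h3 h4]
  exact hne _ h1 h2 h3 h4 hv

end IsRewiring

theorem IsRewiring.connected_iff {φ : (D.sum E).V ≃ D'.V} {h : D.V × Field6} {a : E.V × Field6}
    (hr : IsRewiring (D.sum E) D' φ (inl h) (inr a))
    (hc : D'.circles = D.circles) (hE : E.ConnectedOn Set.univ) :
    D.Connected ↔ D'.Connected := by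
  let q (v : D'.V) : D.V := Sum.elim id (fun _ => h.1) (φ.symm v)
  have hq (x : (D.sum E).V) : q (φ x) = Sum.elim id (fun _ => h.1) x :=
    congrArg _ (φ.symm_apply_apply x)
  refine connected_iff_of_surjective (q := q) (fun v => ⟨φ (Sum.inl v), hq _⟩) hc
    (fun T hT => hr.wickClosed_iff.2 ?_) fun T' hT' => ?_
  · simp only [Set.mem_preimage, hq]
    refine ⟨Iff.rfl, hT.mem_iff rfl, ?_⟩
    rintro ⟨v | v, i⟩ - - - -
    exacts [hT (v, i), id]
  obtain ⟨hl, -, hne⟩ := hr.wickClosed_iff.1 hT'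
  have hTE : E.WickClosed {v | φ (Sum.inr v) ∈ T'} := wickClosed_of_cut a fun b hb hb' =>
    hne (inr b) inl_ne_inr.symm inl_ne_inr.symm (inr_injective.ne hb) (inr_injective.ne hb')
  have hTD : D.WickClosed {v | φ (Sum.inl v) ∈ T'} := wickClosed_of_cut h fun b hb hb' =>
    hne (inl b) (inl_injective.ne hb) (inl_injective.ne hb') inl_ne_inr inl_ne_inr
  have hE' (v w : E.V) (hv : φ (Sum.inr v) ∈ T') : φ (Sum.inr w) ∈ T' :=
    Set.eq_univ_iff_forall.1 ((connectedOn_univ_iff_wickClosed.1 hE).2 _ ⟨v, hv⟩ hTE) w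
  refine ⟨_, hTD, Set.ext fun v => ?_⟩
  obtain ⟨v, rfl⟩ := φ.surjective v
  rw [Set.mem_preimage, hq]
  obtain v | v := v
  exacts [Iff.rfl, hl.trans ⟨hE' _ _, hE' _ _⟩]

/-- Closed diagrams that can be inserted into a propagator of a maximal diagram. -/
structure IsInsertable (E : Diagram) : Prop where
  conn : E.ConnectedOn Set.univ
  fTotal : E.fTotal = 3 * E.numVertices + 3
  circles : E.circles = 0

end Diagram

open Diagram

namespace ReplacesPropagator

variable {D D' E : Diagram} (h : ReplacesPropagator E D D')
include h

theorem numVertices : D'.numVertices = D.numVertices + E.numVertices := by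
  obtain ⟨φ, -⟩ := h
  rw [Diagram.numVertices, ← Nat.card_congr φ, Nat.card_sum]
  rfl

theorem isRewiring_or_iso : ∃ φ : (D.sum E).V ≃ D'.V,
    (D'.circles = D.circles ∧ ∃ (h : D.V × Field6) (a : E.V × Field6),
      IsRewiring (D.sum E) D' φ (inl h) (inr a)) ∨
    (D'.circles + 1 = D.circles ∧ (∀ v, D'.kind (φ v) = (D.sum E).kind v) ∧
      ∀ k, D'.wick (φ k.1, k.2) = (φ ((D.sum E).wick k).1, ((D.sum E).wick k).2)) := by
  obtain ⟨φ, kD, kE, ⟨hc, h, a, w1, w2, w3, w4⟩ | ⟨hc, w3, w4⟩⟩ := h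
  · refine ⟨φ, Or.inl ⟨hc, h, a, ?_, w1, w2, ?_⟩⟩
    · rintro (v | v)
      exacts [kD v, kE v]
    · rintro ⟨v | v, i⟩ h1 h2 h3 h4
      · exact w3 (v, i) (fun e => h1 (congrArg inl e)) fun e => h2 (congrArg inl e)
      · exact w4 (v, i) (fun e => h3 (congrArg inr e)) fun e => h4 (congrArg inr e)
  · refine ⟨φ, Or.inr ⟨hc, ?_, ?_⟩⟩
    · rintro (v | v)
      exacts [kD v, kE v]
    · rintro ⟨v | v, i⟩
      exacts [w3 (v, i), w4 (v, i)]

theorem fTotal (hE : E.circles = 0) : D'.fTotal + 3 = D.fTotal + E.fTotal := by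
  obtain ⟨φ, ⟨hc, h, a, hr⟩ | ⟨hc, hk, hw⟩⟩ := h.isRewiring_or_iso
  · have key (c : Colour) := (hr.card_loop (sum_loop_inl_ne_inr c h a)).trans (card_loop_sum D E c)
    have := key red
    have := key green
    have := key blue
    simp only [Diagram.fTotal]
    omega
  · have key (c : Colour) : Nat.card (D'.Loop c) = _ :=
      (card_loop_congr (φ.prodCongr (Equiv.refl _)) hw fun k =>
        congrArg (fun t => (φ k.1, edge t c k.2)) (hk k.1)).trans (card_loop_sum D E c)
    simp only [Diagram.fTotal, key]
    omega

theorem connected_iff (hE : E.ConnectedOn Set.univ) : D.Connected ↔ D'.Connected := by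
  obtain ⟨φ, ⟨hc, k, a, hr⟩ | ⟨hc, -, hw⟩⟩ := isRewiring_or_iso h
  · exact hr.connected_iff hc hE
  obtain ⟨hne, hE⟩ := connectedOn_univ_iff_wickClosed.1 hE
  rw [connected_iff_of_nonempty (hne.map fun e => φ (Sum.inr e))]
  have hD : D.Connected ↔ D'.circles = 0 ∧ IsEmpty D.V := by
    rw [Connected, IsZeroCycle]
    have := not_isEmpty_iff (α := D.V)
    constructor
    · rintro (⟨hV, _⟩ | ⟨-, _, -⟩)
      · exact ⟨by omega, hV⟩
      · omega
    · exact fun ⟨_, hV⟩ => Or.inl ⟨hV, by omega⟩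
  rw [hD]
  refine and_congr_right fun _ => ⟨fun hV T ⟨t, ht⟩ hT => ?_, fun hT => ⟨fun v => ?_⟩⟩
  · have hsurj (v) : ∃ u, φ (Sum.inr u) = v := by
      obtain ⟨u | u, rfl⟩ := φ.surjective v
      exacts [hV.elim u, ⟨u, rfl⟩]
    obtain ⟨t, rfl⟩ := hsurj t
    have := hE {u | φ (Sum.inr u) ∈ T} ⟨t, ht⟩ fun b hb =>
      (hT.mem_iff (hw (Sum.inr b.1, b.2))).2 hb
    refine Set.eq_univ_of_forall fun v => ?_
    obtain ⟨v, rfl⟩ := hsurj v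
    exact Set.eq_univ_iff_forall.1 this v
  · have hcl : D'.WickClosed (Set.range fun u => φ (Sum.inr u)) := by
      rintro ⟨_, i⟩ ⟨u, rfl⟩
      rw [hw (Sum.inr u, i)]
      exact ⟨_, rfl⟩
    obtain ⟨u, hu⟩ := Set.eq_univ_iff_forall.1 (hT _ (Set.range_nonempty _) hcl) (φ (Sum.inl v))
    exact Sum.inr_ne_inl (φ.injective hu)

theorem isMaximal_iff (hE : E.IsInsertable) : D.IsMaximal ↔ D'.IsMaximal := by
  rw [Diagram.isMaximal_iff, Diagram.isMaximal_iff, connected_iff h hE.conn]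
  have h1 := fTotal h hE.circles
  have h2 := numVertices h
  have h3 := hE.fTotal
  refine and_congr_right fun _ => ?_
  omega

end ReplacesPropagator

/-- The fields on the loop of colour `c` through the field `i` of the closed snail. -/
def snailLoop (k : Interaction) (c : Colour) (i : Field6) : Finset Field6 :=
  {i, snailPairing k i, edge k c i, snailPairing k (edge k c i)}

theorem snailLoop_snailPairing (k : Interaction) (c : Colour) (i : Field6) :
    snailLoop k c (snailPairing k i) = snailLoop k c i := by
  revert k c i
  decide +kernel

theorem snailLoop_edge (k : Interaction) (c : Colour) (i : Field6) :
    snailLoop k c (edge k c i) = snailLoop k c i := by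
  revert k c i
  decide +kernel

theorem card_image_snailLoop (k : Interaction) (c : Colour) :
    (Finset.univ.image (snailLoop k c)).card = 2 := by
  revert k c
  decide +kernel

theorem two_le_card_loop_closedSnail (k : Interaction) (c : Colour) :
    2 ≤ Nat.card ((closedSnail k).Loop c) := by
  have : Nonempty (closedSnail k).V := ⟨()⟩
  rw [← card_image_snailLoop k c]
  exact card_image_le_card_loop _ (fun h => snailLoop_snailPairing k c h.2)
    fun _ => snailLoop_edge k c

theorem isInsertable_closedSnail (k : Interaction) : (closedSnail k).IsInsertable := by
  have hc : (closedSnail k).ConnectedOn Set.univ := connectedOn_univ_iff_wickClosed.2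
    ⟨⟨()⟩, fun _ hT _ => Set.eq_univ_of_forall fun _ => hT.some_mem⟩
  refine ⟨hc, ?_, rfl⟩
  have hle := Connected.fTotal_le (Diagram.connected_iff.2 (Or.inr ⟨rfl, hc⟩))
  have hn : (closedSnail k).numVertices = 1 := Nat.card_unique (α := Unit)
  have := two_le_card_loop_closedSnail k red
  have := two_le_card_loop_closedSnail k green
  have := two_le_card_loop_closedSnail k blue
  rw [Diagram.fTotal] at *
  omega

theorem three_le_card_loop_closedMelon (k : Interaction) (c : Colour) :
    3 ≤ Nat.card ((closedMelon k).Loop c) := by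
  have : Nonempty (closedMelon k).V := ⟨true⟩
  have hcard : ∀ k c, (Finset.univ.image fun i => ({i, edge k c i} : Finset Field6)).card = 3 := by
    decide +kernel
  rw [← hcard k c]
  refine card_image_le_card_loop _ (fun _ => rfl) fun _ i => ?_
  change {edge k c i, edge k c (edge k c i)} = _
  rw [edge_edge, Finset.pair_comm]

theorem isInsertable_closedMelon (k : Interaction) : (closedMelon k).IsInsertable := by
  have hc : (closedMelon k).ConnectedOn Set.univ := connectedOn_univ_iff_wickClosed.2
    ⟨⟨true⟩, fun T ⟨t, ht⟩ hcl => Set.eq_univ_of_forall fun v => by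
      have : (!t) ∈ T := hcl (t, 0) ht
      cases t <;> cases v <;> assumption⟩
  refine ⟨hc, ?_, rfl⟩
  have hle := Connected.fTotal_le (Diagram.connected_iff.2 (Or.inr ⟨rfl, hc⟩))
  have hn : (closedMelon k).numVertices = 2 := (Nat.card_eq_fintype_card (α := Bool)).trans rfl
  have := three_le_card_loop_closedMelon k red
  have := three_le_card_loop_closedMelon k green
  have := three_le_card_loop_closedMelon k blue
  rw [Diagram.fTotal] at *
  omega

/-! ### Vertex expansion -/

/-- The fields `4, 5, 6` of a prism, which vertex expansion leaves on the right vertex. The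
field `6` is `0`. -/
def IsRight (i : Field6) : Prop := i = 4 ∨ i = 5 ∨ i = 0

instance : DecidablePred IsRight := fun i => inferInstanceAs (Decidable (i = 4 ∨ i = 5 ∨ i = 0))

theorem isRight_snailPairing (i : Field6) : IsRight (snailPairing prism i) ↔ ¬ IsRight i := by
  revert i; decide

theorem snailPairing_edge (c : Colour) (i : Field6) :
    snailPairing prism (edge prism c i) = edge prism c (snailPairing prism i) := by
  revert c i; decide

/-- The fields `1, 2, 3` that lie on the loop of colour `c` created by a vertex expansion: the ends
of the `c`-edge between two of them. -/
def IsRung (c : Colour) (i : Field6) : Prop := ¬ IsRight i ∧ ¬ IsRight (edge prism c i)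

instance (c : Colour) : DecidablePred (IsRung c) := fun _ => inferInstanceAs (Decidable (_ ∧ _))

theorem isRung_edge (c : Colour) (i : Field6) : IsRung c (edge prism c i) ↔ IsRung c i := by
  rw [IsRung, IsRung, edge_edge, and_comm]

theorem edge_eq_snailPairing_of_not_isRung {c : Colour} {i : Field6} (hi : ¬ IsRight i)
    (h : ¬ IsRung c i) : edge prism c i = snailPairing prism i := by
  revert c i
  decide

theorem eq_or_eq_edge_of_isRung {c : Colour} {i j : Field6} (hi : IsRung c i) (hj : IsRung c j) :
    j = i ∨ j = edge prism c i := by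
  revert c i j
  decide

theorem exists_isRung (c : Colour) : ∃ i, IsRung c i := by
  revert c
  decide

theorem expandLeg_of_ne {V : Type} {P v : V} (h : v ≠ P) (i : Field6) :
    expandLeg P (v, i) = (some v, i) := by
  simp only [expandLeg, h, false_and, if_false]

theorem expandLeg_right {V : Type} (P : V) {i : Field6} (h : IsRight i) :
    expandLeg P (P, i) = (some P, i) := by
  obtain ⟨h1, h2, h3⟩ : i ≠ 1 ∧ i ≠ 2 ∧ i ≠ 3 := by revert i; decide
  simp only [expandLeg, h1, h2, h3, and_false, if_false]

theorem expandLeg_left {V : Type} (P : V) {i : Field6} (h : ¬ IsRight i) :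
    expandLeg P (P, i) = (none, snailPairing prism i) := by
  have : i = 1 ∨ i = 2 ∨ i = 3 := by revert i; decide
  rcases this with rfl | rfl | rfl
  all_goals
    simp only [expandLeg]
    rfl

/-- The half-edge of the expanded diagram that comes from a half-edge of the original one. -/
noncomputable def IsExpansion.leg {V V' : Type} (P : V) (φ : Option V ≃ V')
    (h : V × Field6) : V' × Field6 :=
  (φ (expandLeg P h).1, (expandLeg P h).2)

/-- `D'` is the expansion of the prism vertex `P` of `D`, with the vertices renamed by `φ`. -/
structure IsExpansion (D D' : Diagram) (P : D.V) (φ : Option D.V ≃ D'.V) : Prop where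
  kind_vertex : D.kind P = prism
  circles : D'.circles = D.circles
  kind_none : D'.kind (φ none) = prism
  kind_some : ∀ v, D'.kind (φ (some v)) = D.kind v
  wick_rung : ∀ i, ¬ IsRight i → D'.wick (φ none, i) = (φ (some P), i)
  wick_leg : ∀ h, D'.wick (IsExpansion.leg P φ h) = IsExpansion.leg P φ (D.wick h)

theorem ExpandsVertex.exists_isExpansion {D D' : Diagram} (h : ExpandsVertex D D') :
    ∃ P φ, IsExpansion D D' P φ := by
  obtain ⟨P, φ, kP, hc, kn, ks, hr, hw⟩ := h
  exact ⟨P, φ, kP, hc, kn, ks, fun i hi => hr i (by revert i; decide), hw⟩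

namespace IsExpansion

/-- The vertex of the original diagram from which a vertex of the expanded one comes. -/
def collapse {V V' : Type} (P : V) (φ : Option V ≃ V') (v : V') : V := (φ.symm v).getD P

/-- The retraction of `leg` that sends the left end of a rung to the leg of the left vertex opposite
to it. It commutes with the edges of each colour. -/
def back {V V' : Type} (P : V) (φ : Option V ≃ V') (x : V' × Field6) : V × Field6 :=
  (collapse P φ x.1, (φ.symm x.1).elim (snailPairing prism x.2) fun _ => x.2)

/-- The half-edges on the loop of colour `c` created by the expansion. -/
def OnNewLoop {V V' : Type} (P : V) (φ : Option V ≃ V') (c : Colour)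
    (x : V' × Field6) : Prop :=
  collapse P φ x.1 = P ∧ IsRung c x.2

section

variable {V V' : Type} {P : V} {φ : Option V ≃ V'}

theorem leg_of_ne {v : V} (hv : v ≠ P) (i : Field6) : leg P φ (v, i) = (φ (some v), i) := by
  rw [leg, expandLeg_of_ne hv]

theorem leg_right {i : Field6} (hi : IsRight i) : leg P φ (P, i) = (φ (some P), i) := by
  rw [leg, expandLeg_right P hi]

theorem leg_left {i : Field6} (hi : ¬ IsRight i) :
    leg P φ (P, i) = (φ none, snailPairing prism i) := by
  rw [leg, expandLeg_left P hi]

theorem collapse_none : collapse P φ (φ none) = P := by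
  rw [collapse, φ.symm_apply_apply, Option.getD_none]

theorem collapse_some (v : V) : collapse P φ (φ (some v)) = v := by
  rw [collapse, φ.symm_apply_apply, Option.getD_some]

theorem back_none (i : Field6) : back P φ (φ none, i) = (P, snailPairing prism i) := by
  simp only [back, collapse_none, φ.symm_apply_apply, Option.elim_none]

theorem back_some (v : V) (i : Field6) : back P φ (φ (some v), i) = (v, i) := by
  simp only [back, collapse_some, φ.symm_apply_apply, Option.elim_some]

theorem back_leg (h : V × Field6) : back P φ (leg P φ h) = h := by
  obtain ⟨v, i⟩ := h
  by_cases hv : v = P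
  · subst hv
    by_cases hi : IsRight i
    · rw [leg_right hi, back_some]
    · rw [leg_left hi, back_none, snailPairing_snailPairing]
  · rw [leg_of_ne hv, back_some]

theorem not_isRung_leg (c : Colour) {h : V × Field6} (hP : h.1 = P) :
    ¬ IsRung c (leg P φ h).2 := by
  obtain ⟨v, i⟩ := h
  obtain rfl : v = P := hP
  by_cases hi : IsRight i
  · rw [leg_right hi]
    exact fun hr => hr.1 hi
  · rw [leg_left hi]
    exact fun hr => hr.1 ((isRight_snailPairing i).2 hi)

variable (P φ) in
theorem forall_halfEdge {Q : V' × Field6 → Prop} (hleg : ∀ h, Q (leg P φ h))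
    (hleft : ∀ i, ¬ IsRight i → Q (φ none, i)) (hright : ∀ i, ¬ IsRight i → Q (φ (some P), i))
    (x : V' × Field6) : Q x := by
  obtain ⟨v, i⟩ := x
  obtain ⟨_ | v, rfl⟩ := φ.surjective v
  · by_cases hi : IsRight i
    · have := hleg (P, snailPairing prism i)
      rwa [leg_left (by rwa [isRight_snailPairing, not_not]), snailPairing_snailPairing] at this
    · exact hleft i hi
  · by_cases hv : v = P
    · subst hv
      by_cases hi : IsRight i
      · exact leg_right (φ := φ) hi ▸ hleg (v, i)
      · exact hright i hi
    · exact leg_of_ne (φ := φ) hv i ▸ hleg (v, i)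

end

variable {D D' : Diagram} {P : D.V} {φ : Option D.V ≃ D'.V} (h : IsExpansion D D' P φ)
  {c : Colour}
include h

theorem wick_rung_right {i : Field6} (hi : ¬ IsRight i) :
    D'.wick (φ (some P), i) = (φ none, i) := by
  rw [← h.wick_rung i hi, D'.wick_wick]

theorem loop_rung {i : Field6} (hi : ¬ IsRight i) :
    D'.loop c (φ (some P), i) = D'.loop c (φ none, i) := by
  rw [← h.wick_rung i hi, loop_wick]

theorem loop_left_edge (i : Field6) :
    D'.loop c (φ none, edge prism c i) = D'.loop c (φ none, i) := by
  have := D'.loop_inner c (φ none, i)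
  rwa [Diagram.inner, h.kind_none] at this

theorem loop_right_edge (i : Field6) :
    D'.loop c (φ (some P), edge prism c i) = D'.loop c (φ (some P), i) := by
  have := D'.loop_inner c (φ (some P), i)
  rwa [Diagram.inner, h.kind_some, h.kind_vertex] at this

theorem kind_collapse (v : D'.V) : D.kind (collapse P φ v) = D'.kind v := by
  obtain ⟨_ | v, rfl⟩ := φ.surjective v
  · rw [collapse_none, h.kind_none, h.kind_vertex]
  · rw [collapse_some, h.kind_some]

theorem back_inner (x : D'.V × Field6) : back P φ (D'.inner c x) = D.inner c (back P φ x) := by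
  obtain ⟨v, i⟩ := x
  obtain ⟨_ | v, rfl⟩ := φ.surjective v
  · simp only [Diagram.inner, back_none, h.kind_none, h.kind_vertex, snailPairing_edge]
  · simp only [Diagram.inner, back_some, h.kind_some]

theorem onNewLoop_inner (x : D'.V × Field6) :
    OnNewLoop P φ c (D'.inner c x) ↔ OnNewLoop P φ c x := by
  refine and_congr_right fun hx => ?_
  have hk := h.kind_collapse x.1
  rw [show collapse P φ x.1 = P from hx, h.kind_vertex] at hk
  rw [Diagram.inner, ← hk, isRung_edge]

theorem loop_leg_back : ∀ x, ¬ OnNewLoop P φ c x →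
    D'.loop c (leg P φ (back P φ x)) = D'.loop c x := by
  refine forall_halfEdge P φ (fun k _ => by rw [back_leg]) (fun i hi hx => ?_) fun i hi hx => ?_
  · have he := edge_eq_snailPairing_of_not_isRung hi fun hr => hx ⟨collapse_none, hr⟩
    rw [back_none, leg_right ((isRight_snailPairing i).2 hi), ← he, h.loop_right_edge,
      h.loop_rung hi]
  · have he := edge_eq_snailPairing_of_not_isRung hi fun hr => hx ⟨collapse_some P, hr⟩
    rw [back_some, leg_left hi, ← he, h.loop_left_edge, h.loop_rung hi]

omit h in
theorem not_onNewLoop_leg (k : D.V × Field6) : ¬ OnNewLoop P φ c (leg P φ k) :=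
  fun hk => not_isRung_leg c (by rw [← hk.1]; exact congrArg Prod.fst (back_leg k).symm) hk.2

theorem loop_leg_congr {k k' : D.V × Field6} (hk : D.loop c k = D.loop c k') :
    D'.loop c (leg P φ k) = D'.loop c (leg P φ k') := by
  refine loop_congr (fun k => D'.loop c (leg P φ k)) (fun k => ?_) (fun k => ?_) hk
  · rw [← h.wick_leg, loop_wick]
  · conv_lhs => rw [← back_leg (P := P) (φ := φ) k, ← h.back_inner]
    rw [h.loop_leg_back _ (by rw [h.onNewLoop_inner]; exact not_onNewLoop_leg k), loop_inner]

theorem loop_eq_of_onNewLoop {i : Field6} (hi : IsRung c i) {x : D'.V × Field6}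
    (hx : OnNewLoop P φ c x) : D'.loop c x = D'.loop c (φ none, i) := by
  have hleft {j : Field6} (hj : IsRung c j) : D'.loop c (φ none, j) = D'.loop c (φ none, i) := by
    rcases eq_or_eq_edge_of_isRung hi hj with rfl | rfl
    exacts [rfl, h.loop_left_edge i]
  revert hx
  refine forall_halfEdge P φ (Q := fun x => OnNewLoop P φ c x → D'.loop c x = D'.loop c (φ none, i))
    (fun k hk => absurd hk (not_onNewLoop_leg k)) (fun j _ hj => hleft hj.2)
    (fun j hj hj' => (h.loop_rung hj).trans (hleft hj'.2)) x

theorem loop_back_wick : ∀ x, ¬ OnNewLoop P φ c x →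
    D.loop c (back P φ (D'.wick x)) = D.loop c (back P φ x) := by
  have key {i : Field6} (hi : ¬ IsRight i) (hr : ¬ IsRung c i) :
      D.loop c (P, snailPairing prism i) = D.loop c (P, i) := by
    have := D.loop_inner c (P, i)
    rwa [Diagram.inner, h.kind_vertex, edge_eq_snailPairing_of_not_isRung hi hr] at this
  refine forall_halfEdge P φ (fun k _ => ?_) (fun i hi hx => ?_) fun i hi hx => ?_
  · rw [h.wick_leg, back_leg, back_leg, loop_wick]
  · rw [h.wick_rung i hi, back_none, back_some, key hi fun hr => hx ⟨collapse_none, hr⟩]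
  · rw [h.wick_rung_right hi, back_none, back_some, key hi fun hr => hx ⟨collapse_some P, hr⟩]

theorem onNewLoop_wick : ∀ x, OnNewLoop P φ c (D'.wick x) ↔ OnNewLoop P φ c x := by
  refine forall_halfEdge P φ (fun k => ?_) (fun i hi => ?_) fun i hi => ?_
  · rw [h.wick_leg]
    exact iff_of_false (not_onNewLoop_leg _) (not_onNewLoop_leg _)
  · rw [h.wick_rung i hi, OnNewLoop, OnNewLoop, collapse_none, collapse_some]
  · rw [h.wick_rung_right hi, OnNewLoop, OnNewLoop, collapse_none, collapse_some]

theorem card_loop (c : Colour) : Nat.card (D'.Loop c) = Nat.card (D.Loop c) + 1 := by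
  classical
  obtain ⟨i, hi⟩ := exists_isRung c
  let F (x : D'.V × Field6) : Option (D.Loop c) :=
    if OnNewLoop P φ c x then none else some (D.loop c (back P φ x))
  let G : Option (D.Loop c) → D'.Loop c := fun o => o.elim (D'.loop c (φ none, i))
    (Quot.lift (fun k => D'.loop c (leg P φ k)) fun k k' hk => h.loop_leg_congr (Quot.sound hk))
  rw [← Finite.card_option]
  refine card_loop_eq F (fun x => ?_) (fun x => ?_) ?_ G fun x => ?_
  · by_cases hx : OnNewLoop P φ c x
    · simp only [F, h.onNewLoop_wick, if_pos hx]
    · simp only [F, h.onNewLoop_wick, if_neg hx, h.loop_back_wick x hx]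
  · simp only [F, h.onNewLoop_inner, h.back_inner, loop_inner]
  · rintro (_ | l)
    · exact ⟨(φ none, i), if_pos ⟨collapse_none, hi⟩⟩
    · obtain ⟨k, rfl⟩ := D.loop_surjective c l
      exact ⟨leg P φ k, by simp only [F, if_neg (not_onNewLoop_leg k), back_leg]⟩
  · by_cases hx : OnNewLoop P φ c x
    · simp only [F, if_pos hx]
      exact (h.loop_eq_of_onNewLoop hi hx).symm
    · simp only [F, if_neg hx]
      exact h.loop_leg_back x hx

theorem fTotal : D'.fTotal = D.fTotal + 3 := by
  simp only [Diagram.fTotal, h.card_loop, h.circles]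
  omega

theorem connected_iff : D.Connected ↔ D'.Connected := by
  have collapse_leg (k : D.V × Field6) : collapse P φ (leg P φ k).1 = k.1 :=
    congrArg Prod.fst (back_leg k)
  refine connected_iff_of_surjective (q := collapse P φ) (fun v => ⟨_, collapse_some v⟩) h.circles
    (fun T hT => ?_) fun T' hT' => ⟨{v | φ (some v) ∈ T'}, ?_⟩
  · refine forall_halfEdge P φ (fun k hk => ?_) (fun i hi hx => ?_) fun i hi hx => ?_
    · rw [Set.mem_preimage, collapse_leg] at hk
      rw [h.wick_leg, Set.mem_preimage, collapse_leg]
      exact hT k hk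
    · rw [Set.mem_preimage, collapse_none] at hx
      rwa [h.wick_rung i hi, Set.mem_preimage, collapse_some]
    · rw [Set.mem_preimage, collapse_some] at hx
      rwa [h.wick_rung_right hi, Set.mem_preimage, collapse_none]
  · have hmem (v : D'.V) : φ (some (collapse P φ v)) ∈ T' ↔ v ∈ T' := by
      obtain ⟨_ | v, rfl⟩ := φ.surjective v
      · rw [collapse_none]
        exact hT'.mem_iff (h.wick_rung 1 (by decide))
      · rw [collapse_some]
    refine ⟨fun k hk => ?_, Set.ext hmem⟩
    rw [Set.mem_ofPred_eq, ← collapse_leg k, hmem] at hk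
    have := hT' _ hk
    rwa [h.wick_leg, ← hmem, collapse_leg] at this

end IsExpansion

theorem ExpandsVertex.numVertices {D D' : Diagram} (h : ExpandsVertex D D') :
    D'.numVertices = D.numVertices + 1 := by
  obtain ⟨-, φ, -⟩ := h
  rw [Diagram.numVertices, ← Nat.card_congr φ, Finite.card_option]
  rfl

theorem ExpandsVertex.isMaximal_iff {D D' : Diagram} (h : ExpandsVertex D D') :
    D.IsMaximal ↔ D'.IsMaximal := by
  have hV := h.numVertices
  obtain ⟨P, φ, h⟩ := h.exists_isExpansion
  rw [Diagram.isMaximal_iff, Diagram.isMaximal_iff, h.connected_iff, h.fTotal, hV]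
  refine and_congr_right fun _ => ?_
  omega

/-! ### Relabelling -/

theorem edge_of_isAutomorphism {k : Interaction} {α : Perm Field6} (h : IsAutomorphism k α)
    (c : Colour) (i : Field6) : edge k c (α i) = α (edge k c i) := by
  have := congrArg (fun β : Perm Field6 => β (α i)) (h c)
  simpa using this.symm

theorem Diagram.Same.isMaximal_iff {D D' : Diagram} (h : D.Same D') :
    D.IsMaximal ↔ D'.IsMaximal := by
  obtain ⟨hc, φ, α, hk, hα, hw⟩ := h
  let f : D.V × Field6 ≃ D'.V × Field6 := Equiv.prodShear φ α
  have hw (h) : D'.wick (f h) = f (D.wick h) := hw h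
  have hi (c h) : D'.inner c (f h) = f (D.inner c h) := Prod.ext rfl <| by
    change edge (D'.kind (φ h.1)) c (α h.1 h.2) = α h.1 (edge (D.kind h.1) c h.2)
    rw [hk, edge_of_isAutomorphism (hα h.1)]
  have hf : D'.fTotal = D.fTotal := by
    simp only [Diagram.fTotal, card_loop_congr f hw (hi _), hc]
  have hn : D'.numVertices = D.numVertices := (Nat.card_congr φ).symm
  have hcon : D.Connected ↔ D'.Connected := by
    refine connected_iff_of_surjective φ.symm.surjective hc (fun T hT x hx => ?_) fun T' hT' =>
      ⟨φ ⁻¹' T', fun h hh => ?_, φ.symm_preimage_preimage T'⟩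
    · obtain ⟨h, rfl⟩ := f.surjective x
      rw [hw]
      have := hT h (by simpa [f] using hx)
      simpa [f] using this
    · have := hT' (f h) hh
      rwa [hw] at this
  rw [Diagram.isMaximal_iff, Diagram.isMaximal_iff, hcon, hn, hf]

theorem Melonic.isMaximal {D : Diagram} (h : Melonic D) : D.IsMaximal := by
  induction h with
  | zeroCycle D h => exact Diagram.isMaximal_iff.2 ⟨Or.inl h, h.fTotal⟩
  | prismMove D D' _ h ih =>
    rcases h with h | h | h
    · exact (h.isMaximal_iff (isInsertable_closedSnail _)).1 ih
    · exact (h.isMaximal_iff (isInsertable_closedMelon _)).1 ih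
    · exact h.isMaximal_iff.1 ih
  | wheelMove D D' _ h ih =>
    rcases h with h | h
    · exact (h.isMaximal_iff (isInsertable_closedSnail _)).1 ih
    · exact (h.isMaximal_iff (isInsertable_closedMelon _)).1 ih
  | same D D' _ h ih => exact h.isMaximal_iff.1 ih

/-! ### Inverse moves -/

theorem IsAutomorphism.inv {k : Interaction} {α : Perm Field6} (h : IsAutomorphism k α) :
    IsAutomorphism k α⁻¹ := fun c => by
  have := h c
  rw [Perm.one_apply] at this ⊢
  nth_rewrite 1 [← this]
  group

theorem isAutomorphism_one (k : Interaction) : IsAutomorphism k 1 := fun c => by simp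

namespace Diagram

variable {D : Diagram}

/-- The diagram with its contractions conjugated by a permutation of the half-edges. Besides
relabellings this covers, with a transposition, the cutting and crosswise regluing of two
propagators. -/
def conj (D : Diagram) (σ : Perm (D.V × Field6)) : Diagram where
  V := D.V
  finite := D.finite
  kind := D.kind
  wick h := σ (D.wick (σ.symm h))
  wick_wick h := by rw [σ.symm_apply_apply, D.wick_wick, σ.apply_symm_apply]
  wick_ne h e := D.wick_ne _ (σ.eq_symm_apply.2 e)
  circles := D.circles

/-- The diagram with the fields of each vertex renamed. -/
def relabel (D : Diagram) (α : D.V → Perm Field6) : Diagram :=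
  D.conj (Equiv.prodShear (Equiv.refl _) α)

theorem relabel_wick (α : D.V → Perm Field6) {v w : D.V} {i j : Field6}
    (h : D.wick (v, i) = (w, j)) : (D.relabel α).wick (v, α v i) = (w, α w j) := by
  let σ : Perm (D.V × Field6) := Equiv.prodShear (Equiv.refl _) α
  change σ (D.wick (σ.symm (σ (v, i)))) = σ (w, j)
  rw [σ.symm_apply_apply, h]

theorem relabel_same (α : D.V → Perm Field6) (hα : ∀ v, IsAutomorphism (D.kind v) (α v)) :
    (D.relabel α).Same D :=
  ⟨rfl, Equiv.refl _, fun v => (α v)⁻¹, fun _ => rfl, fun v => (hα v).inv,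
    fun _ => Prod.ext rfl ((α _).symm_apply_apply _).symm⟩

theorem exists_relabel_same (D : Diagram) {X : Type*} {ι : X → D.V} (hι : ι.Injective)
    {β : X → Perm Field6} (hβ : ∀ x, IsAutomorphism (D.kind (ι x)) (β x)) :
    ∃ γ : D.V → Perm Field6, (D.relabel γ).Same D ∧ ∀ x, γ (ι x) = β x := by
  refine ⟨Function.extend ι β 1, D.relabel_same _ fun v => ?_, hι.extend_apply β 1⟩
  by_cases hv : ∃ x, ι x = v
  · obtain ⟨x, rfl⟩ := hv
    rw [hι.extend_apply]
    exact hβ x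
  · rw [Function.extend_apply' _ _ _ hv]
    exact isAutomorphism_one _

theorem WickClosed.compl {T : Set D.V} (hT : D.WickClosed T) : D.WickClosed Tᶜ :=
  fun _ hh hh' => hh ((hT.mem_iff rfl).1 hh')

/-- The diagram on a set of vertices closed under the contractions, with `n` circles. -/
def restrict (D : Diagram) {X : Set D.V} (hX : D.WickClosed X) (n : ℕ) : Diagram where
  V := X
  finite := inferInstance
  kind v := D.kind v
  wick k := (⟨(D.wick (k.1, k.2)).1, hX _ k.1.2⟩, (D.wick (k.1, k.2)).2)
  wick_wick k := Prod.ext (Subtype.ext (congrArg Prod.fst (D.wick_wick (k.1, k.2))))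
    (congrArg Prod.snd (D.wick_wick (k.1, k.2)) :)
  wick_ne k e := D.wick_ne (k.1, k.2)
    (Prod.ext (congrArg (fun h => (h.1 : D.V)) e) (congrArg Prod.snd e :))
  circles := n

theorem conj_wick_apply (σ : Perm (D.V × Field6)) (k : D.V × Field6) :
    (D.conj σ).wick (σ k) = σ (D.wick k) :=
  congrArg (fun k => σ (D.wick k)) (σ.symm_apply_apply k)

section

variable [DecidableEq D.V] {p q k : D.V × Field6}

theorem conj_swap_wick (hp : k ≠ p) (hq : k ≠ q) (hwp : k ≠ D.wick p) (hwq : k ≠ D.wick q) :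
    (D.conj (swap p q)).wick k = D.wick k := by
  have := D.conj_wick_apply (swap p q) k
  rwa [swap_apply_of_ne_of_ne hp hq, swap_apply_of_ne_of_ne] at this
  · exact fun e => hwp (by rw [← e, D.wick_wick])
  · exact fun e => hwq (by rw [← e, D.wick_wick])

theorem conj_swap_wick_left (h : D.wick p ≠ q) : (D.conj (swap p q)).wick p = D.wick q := by
  have := D.conj_wick_apply (swap p q) q
  rwa [swap_apply_right, swap_apply_of_ne_of_ne _ (D.wick_ne q)] at this
  exact fun e => h (by rw [← e, D.wick_wick])

theorem conj_swap_wick_right (h : D.wick p ≠ q) : (D.conj (swap p q)).wick q = D.wick p := by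
  have := D.conj_wick_apply (swap p q) p
  rwa [swap_apply_left, swap_apply_of_ne_of_ne (D.wick_ne p) h] at this

end

theorem eq_wick_of_wick_map_eq {E : Diagram} {j : E.V × Field6 → D.V × Field6} (hj : j.Injective)
    {a b : E.V × Field6} (hw : ∀ b, b ≠ a → b ≠ E.wick a → D.wick (j b) = j (E.wick b))
    (h : D.wick (j b) = j a) : b = E.wick a := by
  by_contra hbw
  have hba : b ≠ a := fun e => D.wick_ne (j b) (h.trans (congrArg j e.symm))
  exact hbw (by rw [← hj ((hw b hba hbw).symm.trans h), E.wick_wick])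

theorem conj_swap_wick_map [DecidableEq D.V] {E : Diagram} {j : E.V × Field6 → D.V × Field6}
    (hj : j.Injective) {a : E.V × Field6} {p : D.V × Field6} (hp : D.wick p = j a)
    (hw : ∀ b, b ≠ a → b ≠ E.wick a → D.wick (j b) = j (E.wick b)) (b : E.V × Field6) :
    (D.conj (swap p (j (E.wick a)))).wick (j b) = j (E.wick b) := by
  have hq : (D.conj (swap p (j (E.wick a)))).wick (j (E.wick a)) = j a :=
    (conj_swap_wick_right fun e => E.wick_ne a (hj (hp.symm.trans e)).symm).trans hp
  by_cases h1 : b = a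
  · subst h1
    exact (congrArg _ hq.symm).trans ((D.conj _).wick_wick _)
  by_cases h2 : b = E.wick a
  · rw [h2, hq, E.wick_wick]
  rw [conj_swap_wick _ (hj.ne h2) (hp ▸ hj.ne h1), hw b h1 h2]
  · intro e
    have := hw b h1 h2
    rw [e, D.wick_wick] at this
    exact h1 (wick_injective (hj this)).symm
  · rintro rfl
    exact h2 (eq_wick_of_wick_map_eq hj hw hp)

end Diagram

theorem exists_replacesPropagator {D E : Diagram} (hD : D.circles = 0) (ι : E.V → D.V)
    (hι : Function.Injective ι) (hk : ∀ u, D.kind (ι u) = E.kind u) (a : E.V × Field6)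
    (hw : ∀ b, b ≠ a → b ≠ E.wick a → D.wick (ι b.1, b.2) = (ι (E.wick b).1, (E.wick b).2)) :
    ∃ D', ReplacesPropagator E D' D := by
  classical
  let j (b : E.V × Field6) : D.V × Field6 := (ι b.1, b.2)
  have hj : j.Injective := fun b b' e =>
    Prod.ext (hι (congrArg Prod.fst e)) (congrArg Prod.snd e :)
  let q := j (E.wick a)
  obtain ⟨p, hp⟩ : ∃ p, D.wick p = j a := ⟨_, D.wick_wick _⟩
  have hE (b) : (D.conj (swap p q)).wick (j b) = j (E.wick b) := conj_swap_wick_map hj hp hw b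
  have hX : (D.conj (swap p q)).WickClosed (Set.range ι)ᶜ := WickClosed.compl <| by
    rintro ⟨_, i⟩ ⟨u, rfl⟩
    exact ⟨_, (congrArg Prod.fst (hE (u, i))).symm⟩
  let φ : ↥(Set.range ι)ᶜ ⊕ E.V ≃ D.V := (Equiv.sumComm _ _).trans
    (((Equiv.ofInjective ι hι).sumCongr (Equiv.refl _)).trans (Equiv.Set.sumCompl (Set.range ι)))
  refine ⟨(D.conj (swap p q)).restrict hX (if p.1 ∈ Set.range ι then 1 else 0),
    φ, fun _ => rfl, hk, ?_⟩
  by_cases hpX : p.1 ∈ Set.range ι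
  · have hpq : p = q := by
      obtain ⟨b, rfl⟩ : ∃ b, j b = p := hpX.imp' (·, p.2) fun _ hu => Prod.ext hu rfl
      exact congrArg j (eq_wick_of_wick_map_eq hj hw hp)
    have hw (k : D.V × Field6) : (D.conj (swap p q)).wick k = D.wick k := by
      rw [hpq, swap_self]
      rfl
    exact Or.inr ⟨by rw [hD, restrict, if_pos hpX], fun k => (hw (k.1.1, k.2)).symm,
      fun b => (hw (j b)).symm.trans (hE b)⟩
  · have hpq : D.wick p ≠ q := fun e => E.wick_ne a (hj (hp.symm.trans e)).symm
    have hp' : (D.conj (swap p q)).wick p = D.wick q := conj_swap_wick_left hpq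
    refine Or.inl ⟨by rw [hD, restrict, if_neg hpX], (⟨p.1, hpX⟩, p.2), a, hp, ?_,
      fun k h1 h2 => ?_, hw⟩
    · change D.wick ((D.conj (swap p q)).wick p) = q
      rw [hp', D.wick_wick]
    · have hj' (b) : (k.1.1, k.2) ≠ j b := fun e => k.1.2 ⟨b.1, (congrArg Prod.fst e).symm⟩
      have hinj : Function.Injective fun k : ↥(Set.range ι)ᶜ × Field6 => (k.1.1, k.2) :=
        Subtype.val_injective.prodMap Function.injective_id
      exact (conj_swap_wick (D := D) (fun e => h1 (hinj e)) (hj' _) (hp ▸ hj' a)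
        fun e => h2 (hinj (e.trans hp'.symm))).symm

/-- Exchanges the fields `1, 2, 3` of the vertex `R` with the opposite fields `4, 5, 6` of the
vertex `L`. Conjugating by it detaches `L` from the rest of the diagram and leaves the remaining
legs of `L` and `R` on `R`, which undoes a vertex expansion. -/
def exchangeSides {V : Type} [DecidableEq V] (L R : V) (k : V × Field6) : V × Field6 :=
  if k.1 = R ∧ ¬ IsRight k.2 then (L, snailPairing prism k.2)
  else if k.1 = L ∧ IsRight k.2 then (R, snailPairing prism k.2) else k

section

variable {V : Type} [DecidableEq V] {L R : V}

theorem exchangeSides_right_of_not_isRight {i : Field6} (hi : ¬ IsRight i) :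
    exchangeSides L R (R, i) = (L, snailPairing prism i) :=
  if_pos ⟨rfl, hi⟩

theorem exchangeSides_left_of_isRight {i : Field6} (hi : IsRight i) :
    exchangeSides L R (L, i) = (R, snailPairing prism i) := by
  rw [exchangeSides, if_neg fun h => h.2 hi, if_pos ⟨rfl, hi⟩]

theorem exchangeSides_left_of_not_isRight (hLR : L ≠ R) {i : Field6} (hi : ¬ IsRight i) :
    exchangeSides L R (L, i) = (L, i) := by
  rw [exchangeSides, if_neg fun h => hLR h.1, if_neg fun h => hi h.2]

theorem exchangeSides_involutive (hLR : L ≠ R) : (exchangeSides L R).Involutive := by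
  intro k
  by_cases h : k.1 = R ∧ ¬ IsRight k.2
  · obtain ⟨rfl, hi⟩ := h
    rw [exchangeSides_right_of_not_isRight hi,
      exchangeSides_left_of_isRight ((isRight_snailPairing _).2 hi), snailPairing_snailPairing]
  by_cases h' : k.1 = L ∧ IsRight k.2
  · obtain ⟨rfl, hi⟩ := h'
    rw [exchangeSides_left_of_isRight hi, exchangeSides_right_of_not_isRight
      (by rwa [isRight_snailPairing, not_not]), snailPairing_snailPairing]
  · have : exchangeSides L R k = k := by rw [exchangeSides, if_neg h, if_neg h']
    rw [this, this]

theorem leg_optionSubtypeNe (hLR : L ≠ R) (k : {v // v ≠ L} × Field6) :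
    IsExpansion.leg ⟨R, hLR.symm⟩ (optionSubtypeNe L) k = exchangeSides L R (k.1.1, k.2) := by
  obtain ⟨⟨v, hv⟩, i⟩ := k
  have hvL : ¬ (v = L ∧ IsRight i) := fun h => hv h.1
  by_cases hvR : v = R
  · subst hvR
    by_cases hi : IsRight i
    · rw [IsExpansion.leg_right hi, exchangeSides, if_neg fun h => h.2 hi, if_neg hvL]
      rfl
    · rw [IsExpansion.leg_left hi, exchangeSides_right_of_not_isRight hi]
      rfl
  · rw [IsExpansion.leg_of_ne fun e => hvR (congrArg Subtype.val e), exchangeSides,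
      if_neg fun h => hvR h.1, if_neg hvL]
    rfl

end

theorem exists_expandsVertex {D : Diagram} {L R : D.V} (hLR : L ≠ R) (hL : D.kind L = prism)
    (hR : D.kind R = prism) (hw : ∀ i, ¬ IsRight i → D.wick (L, i) = (R, i)) :
    ∃ D', ExpandsVertex D' D := by
  classical
  let τ : Perm (D.V × Field6) := (exchangeSides_involutive hLR).toPerm
  have hwL (i : Field6) : τ (D.wick (τ (L, i))) = (L, snailPairing prism i) := by
    change exchangeSides L R (D.wick (exchangeSides L R (L, i))) = _
    by_cases hi : IsRight i
    · have hi' : ¬ IsRight (snailPairing prism i) := by rwa [isRight_snailPairing, not_not]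
      rw [exchangeSides_left_of_isRight hi, ← hw _ hi', D.wick_wick,
        exchangeSides_left_of_not_isRight hLR hi']
    · rw [exchangeSides_left_of_not_isRight hLR hi, hw i hi, exchangeSides_right_of_not_isRight hi]
  have hX : (D.conj τ).WickClosed {L}ᶜ := WickClosed.compl fun k hk =>
    (congrArg (fun v => (τ (D.wick (τ (v, k.2)))).1) hk).trans (congrArg Prod.fst (hwL k.2))
  have hleft : ∀ i : Field6, i = 1 ∨ i = 2 ∨ i = 3 → ¬ IsRight i := by decide
  refine ⟨(D.conj τ).restrict hX D.circles, ⟨R, hLR.symm⟩, optionSubtypeNe L, hR, rfl, hL,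
    fun _ => rfl, fun i hi => hw i (hleft i hi), fun k => ?_⟩
  have hleg := leg_optionSubtypeNe hLR k
  have hleg' := leg_optionSubtypeNe hLR (((D.conj τ).restrict hX D.circles).wick k)
  exact (congrArg D.wick hleg).trans ((exchangeSides_involutive hLR _).symm.trans hleg'.symm)

/-! ### Maximal diagrams are generated by the moves -/

theorem exists_ncard_fiber_lt {α β : Type*} [Finite α] [Finite β] {f : α → β} {T : Set β} {n : ℕ}
    (h : (f ⁻¹' T).ncard < n * T.ncard) : ∃ b ∈ T, (f ⁻¹' {b}).ncard < n := by
  classical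
  have : Fintype α := Fintype.ofFinite α
  have : Fintype β := Fintype.ofFinite β
  obtain ⟨b, hb, hlt⟩ := Finset.exists_card_fiber_lt_of_card_lt_mul (s := (f ⁻¹' T).toFinset)
    (t := T.toFinset) (f := f) (n := n) (by
      rwa [← Set.ncard_eq_toFinset_card', ← Set.ncard_eq_toFinset_card', mul_comm])
  rw [Set.mem_toFinset] at hb
  refine ⟨b, hb, ?_⟩
  rw [Set.ncard_eq_toFinset_card']
  refine lt_of_eq_of_lt (congrArg Finset.card (Finset.ext fun a => ?_)) hlt
  simp only [Set.mem_toFinset, Finset.mem_filter, Set.mem_preimage, Set.mem_singleton_iff]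
  exact ⟨fun e => ⟨e ▸ hb, e⟩, fun e => e.2⟩

theorem exists_isAutomorphism_of_forall_map_edge {k k' : Interaction} {ρ : Field6 → Field6}
    (hρ : ρ.Injective) (h : ∀ c i, ρ (edge k c i) = edge k' c (ρ i)) :
    k = k' ∧ ∃ σ : Perm Field6, IsAutomorphism k' σ ∧ ∀ i, σ i = ρ i := by
  let σ : Perm Field6 := .ofBijective ρ (Finite.injective_iff_bijective.1 hρ)
  have hσ (c : Colour) (i : Field6) : σ (edge k c i) = edge k' c (σ i) := h c i
  obtain rfl : k = k' := by
    rcases k <;> rcases k'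
    · rfl
    · exact absurd h (Diagram.not_forall_map_edge_prism_eq_edge_wheel hρ)
    · refine absurd (fun c i => ?_)
        (Diagram.not_forall_map_edge_prism_eq_edge_wheel σ.symm.injective)
      rw [σ.symm_apply_eq, hσ, σ.apply_symm_apply]
    · rfl
  refine ⟨rfl, σ, fun c => Equiv.ext fun i => ?_, fun _ => rfl⟩
  simpa using hσ c (σ⁻¹ i)

theorem eq_prism_of_forall_edge_mem_triangle {k : Interaction} {x z t : Field6} (hxz : x ≠ z)
    (h : ∀ c, edge k c x = z ∨ edge k c x = t ∨ edge k c z = t) : k = prism := by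
  cases k
  · rfl
  · exact absurd h (Diagram.not_forall_edge_wheel_mem_triangle hxz)

theorem exists_colour_not_opposite (k : Interaction) (i : Field6) : ∃ c, ∀ x, ∃ c',
    ¬ (edge k c' x = edge k c x ∨ edge k c' x = i ∨ edge k c' (edge k c x) = i) := by
  revert k i; decide +kernel

namespace Diagram

variable {D : Diagram}

theorem two_le_ncard_legs (hD : D.ConnectedOn Set.univ) {S : Set D.V} (hS : S.Nonempty)
    (hne : S ≠ Set.univ) : 2 ≤ (D.legs S).ncard := by
  have hpos := (Set.ncard_pos (Set.toFinite _)).2 (legs_nonempty hD hS hne)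
  obtain ⟨n, hn⟩ := even_ncard_legs S
  omega

theorem connectedOn_of_ncard_legs_le_two (hD : D.ConnectedOn Set.univ) {S : Set D.V}
    (hS : S.Nonempty) (hl : (D.legs S).ncard ≤ 2) : D.ConnectedOn S := by
  refine ⟨hS, fun T hTS ⟨t, ht⟩ hcl => ?_⟩
  by_contra hne
  obtain ⟨u, hu, huT⟩ := Set.not_subset.1 fun h => hne (hTS.antisymm h)
  have hT2 := two_le_ncard_legs hD (S := T) ⟨t, ht⟩ fun e => huT (e ▸ trivial)
  have hU2 := two_le_ncard_legs hD (S := S \ T) ⟨u, hu, huT⟩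
    fun e => (e ▸ trivial : t ∈ S \ T).2 ht
  have hdisj : Disjoint (D.legs T) (D.legs (S \ T)) :=
    Set.disjoint_left.2 fun h h1 h2 => h2.1.2 h1.1
  have hsub : D.legs T ∪ D.legs (S \ T) ⊆ D.legs S := by
    rintro h (hh | hh)
    · exact ⟨hTS hh.1, fun hw => hh.2 (hcl h hh.1 hw)⟩
    · refine ⟨hh.1.1, fun hw => hh.2 ⟨hw, fun hwT => hh.1.2 ?_⟩⟩
      have := hcl (D.wick h) hwT (by rw [D.wick_wick]; exact hh.1.1)
      rwa [D.wick_wick] at this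
  have := Set.ncard_le_ncard hsub
  rw [Set.ncard_union_eq hdisj] at this
  omega

section IsSmallest

variable {S A : Set D.V}

/-- `S` is a nonempty set of vertices with at most two legs, and has the fewest vertices among
these. A propagator correction which contains no smaller one has this property; the set of all
vertices of a connected diagram, which has no legs, may have it too. -/
structure IsSmallest (D : Diagram) (S : Set D.V) : Prop where
  nonempty : S.Nonempty
  ncard_legs_le : (D.legs S).ncard ≤ 2
  ncard_le : ∀ T : Set D.V, T.Nonempty → (D.legs T).ncard ≤ 2 → S.ncard ≤ T.ncard

theorem exists_isSmallest (D : Diagram) [Nonempty D.V] : ∃ S, D.IsSmallest S := by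
  obtain ⟨S, ⟨h1, h2⟩, h3⟩ := (measure (Set.ncard (α := D.V))).wf.has_min
    {S | S.Nonempty ∧ (D.legs S).ncard ≤ 2} ⟨Set.univ, Set.univ_nonempty, by simp [legs_univ]⟩
  exact ⟨S, h1, h2, fun T h h' => not_lt.1 (h3 T ⟨h, h'⟩)⟩

theorem ncard_legs_le_two_of_eq_pair {K : Set D.V} {k k' : D.V × Field6}
    (hl : D.legs K = {k, k'}) : (D.legs K).ncard ≤ 2 := by
  rw [hl]
  exact (Set.ncard_insert_le k {k'}).trans_eq (by rw [Set.ncard_singleton])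

theorem IsSmallest.compl_subset (hS : D.IsSmallest S) (hD : D.ConnectedOn Set.univ) (hA : A ⊆ S)
    {h h' : D.V × Field6} {K : Set D.V} (h1 : h.1 ∈ A) (h2 : h'.1 ∈ A) (hd : Disjoint K A)
    (hl : D.legs K = {D.wick h, D.wick h'}) : Sᶜ ⊆ K := by
  have hKS : ¬ K ⊆ S := fun hsub => by
    obtain rfl := Set.eq_of_subset_of_ncard_le hsub
      (hS.ncard_le K ⟨_, fst_mem_of_legs_eq hl⟩ (ncard_legs_le_two_of_eq_pair hl))
    exact Set.disjoint_left.1 hd (hA h1) h1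
  obtain ⟨u, hu, huS⟩ := Set.not_subset.1 hKS
  exact subset_of_connectedOn (connectedOn_of_ncard_legs_le_two hD ⟨u, huS⟩
    (by rw [ncard_legs_compl]; exact hS.ncard_legs_le)) huS hu
    fun k hk hw => hw (hA (wick_mem_of_legs_eq h1 h2 hl k hk))

theorem IsSmallest.legs_eq_of_twin (hS : D.IsSmallest S) (hD : D.ConnectedOn Set.univ)
    (hA : A ⊆ S) {h h' : D.V × Field6} (ht : D.Twin A h h') (hne : D.wick h ≠ h') :
    D.legs S = {h, h'} := by
  obtain ⟨-, h1, h2, hw⟩ := ht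
  obtain ⟨K, -, hd, hl⟩ := hw.resolve_left hne
  have hlegs : D.legs Kᶜ = {h, h'} := by
    rw [legs_compl, hl, Set.image_pair, D.wick_wick, D.wick_wick]
  have hKS : Kᶜ = S := Set.eq_of_subset_of_ncard_le
    (Set.compl_subset_comm.1 (hS.compl_subset hD hA h1 h2 hd hl))
    (hS.ncard_le _ ⟨h.1, fun hK => Set.disjoint_left.1 hd hK h1⟩
      (ncard_legs_le_two_of_eq_pair hlegs))
  rwa [hKS] at hlegs

theorem IsSmallest.exists_forall_wick_eq (hS : D.IsSmallest S) (hD : D.ConnectedOn Set.univ)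
    (hA : A ⊆ S) {v : D.V} {g : Field6 → D.V × Field6} (hg : ∀ i, D.Twin A (v, i) (g i)) :
    ∃ a, ∀ i, i ≠ a → (v, i) ≠ g a → D.wick (v, i) = g i := by
  by_cases hall : ∀ i, D.wick (v, i) = g i
  · exact ⟨0, fun i _ _ => hall i⟩
  · obtain ⟨a, ha⟩ := not_forall.1 hall
    refine ⟨a, fun i hia higa => by_contra fun hi => ?_⟩
    have hmem : (v, i) ∈ ({(v, a), g a} : Set _) := by
      rw [← hS.legs_eq_of_twin hD hA (hg a) ha, hS.legs_eq_of_twin hD hA (hg i) hi]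
      exact Or.inl rfl
    rcases hmem with e | e
    · exact hia (congrArg Prod.snd e)
    · exact higa e

theorem IsSmallest.ncard_innerLoops_lt (hS : D.IsSmallest S) (hD : D.IsPlanar) (c : Colour) :
    (D.loop c ⁻¹' D.innerLoops c S).ncard < 6 * (D.innerLoops c S).ncard := by
  have hsub : D.loop c ⁻¹' D.innerLoops c S ⊆ {h | h.1 ∈ S} := fun h hh => hh h rfl
  have hfields : {h : D.V × Field6 | h.1 ∈ S}.ncard = 6 * S.ncard := ncard_fields S
  rcases (D.legs S).eq_empty_or_nonempty with hl | ⟨g, hg⟩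
  · have hSu : S = Set.univ := by_contra fun hne =>
      (legs_nonempty hD.conn hS.nonempty hne).ne_empty hl
    have hle := Set.ncard_le_ncard hsub
    rw [hfields] at hle
    have hcard : (D.innerLoops c S).ncard = S.ncard + 1 := by
      rw [hSu, innerLoops_univ, Set.ncard_univ, Set.ncard_univ, hD.card_loop]
    omega
  · have hconn := connectedOn_of_ncard_legs_le_two hD.conn hS.nonempty hS.ncard_legs_le
    have hconn' := connectedOn_of_ncard_legs_le_two hD.conn (S := Sᶜ) ⟨_, hg.2⟩
      (by rw [ncard_legs_compl]; exact hS.ncard_legs_le)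
    have hcount := hD.four_mul_ncard_innerLoops_add_ncard_legs hconn hconn' c
    have h2 := hS.ncard_legs_le
    have hlt := Set.ncard_lt_ncard (Set.ssubset_iff_of_subset hsub |>.2
      ⟨g, hg.1, fun h => hg.2 (h _ (D.loop_wick c g))⟩)
    omega

end IsSmallest

theorem exists_isTwoCycle_of_ncard_loop_lt_six {c : Colour} {l : D.Loop c}
    (hreg : ∀ h, D.loop c h = l → D.IsRegular h.1) (hl : (D.loop c ⁻¹' {l}).ncard < 6) :
    ∃ L R x y, D.loop c (L, x) = l ∧ D.loop c (R, y) = l ∧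
      D.IsTwoCycle L R x y (edge (D.kind L) c x) (edge (D.kind R) c y) := by
  set T := D.loop c ⁻¹' {l}
  have hTw : ∀ h ∈ T, D.wick h ∈ T := fun h hh => (D.loop_wick c h).trans hh
  have hTe : ∀ h ∈ T, D.inner c h ∈ T := fun h hh => (D.loop_inner c h).trans hh
  obtain ⟨⟨L, x⟩, hx : (L, x) ∈ T⟩ := D.loop_surjective c l
  obtain ⟨⟨R, y⟩, hxy⟩ : ∃ k, D.wick (L, x) = k := ⟨_, rfl⟩
  have hy : (R, y) ∈ T := hxy ▸ hTw _ hx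
  have hL : D.IsRegular L := hreg _ hx
  have hLR : L ≠ R := by
    rintro rfl
    exact hL.not_oneCycle hxy
  have hne := (edge_ne (D.kind L) c x).symm
  refine ⟨L, R, x, y, hx, hy, hLR, hne, hxy, ?_⟩
  let Q : Set (D.V × Field6) :=
    {(L, x), (L, edge (D.kind L) c x), (R, y), (R, edge (D.kind R) c y)}
  have hQ : Q.ncard = 4 := by
    have hne' := (edge_ne (D.kind R) c y).symm
    simp only [Q]
    rw [Set.ncard_insert_of_notMem, Set.ncard_insert_of_notMem, Set.ncard_pair] <;>
      simp [hLR, hne, hne']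
  have hQT : Q ⊆ T := by
    rintro _ (rfl | rfl | rfl | rfl)
    exacts [hx, hTe _ hx, hy, hTe _ hy]
  have heven : Even T.ncard :=
    even_ncard_of_involution hTw (fun h _ => D.wick_wick h) fun h _ => D.wick_ne h
  have hQ_eq : Q = T := Set.eq_of_subset_of_ncard_le hQT (by
    obtain ⟨r, hr⟩ := heven
    omega)
  have hw := hTw _ (hTe _ hx)
  rw [← hQ_eq] at hw
  rcases hw with e | e | e | e
  · exact absurd e hL.not_oneCycle
  · exact absurd e hL.not_oneCycle
  · exact absurd (congrArg Prod.snd (wick_injective (e.trans hxy.symm))) hne.symm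
  · exact e

theorem IsSmallest.exists_isTwoCycle {S : Set D.V} (hS : D.IsSmallest S) (hD : D.IsPlanar)
    (hreg : ∀ v ∈ S, D.IsRegular v) (c : Colour) :
    ∃ L R x y, L ∈ S ∧ R ∈ S ∧
      D.IsTwoCycle L R x y (edge (D.kind L) c x) (edge (D.kind R) c y) := by
  obtain ⟨l, hl, hlt⟩ := exists_ncard_fiber_lt (hS.ncard_innerLoops_lt hD c)
  obtain ⟨L, R, x, y, hx, hy, h⟩ :=
    exists_isTwoCycle_of_ncard_loop_lt_six (fun h hh => hreg _ (hl h hh)) hlt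
  exact ⟨L, R, x, y, hl _ hx, hl _ hy, h⟩

/-- `D` is obtained by a move, up to renaming, from a smaller maximal diagram. -/
def IsReducible (D : Diagram) : Prop :=
  ∃ D' : Diagram, D'.IsMaximal ∧ D'.numVertices < D.numVertices ∧ (Melonic D' → Melonic D)

theorem IsReducible.of_same {D' : Diagram} (hr : D.IsReducible) (h : D.Same D') :
    D'.IsReducible := by
  obtain ⟨D'', h1, h2, h3⟩ := hr
  obtain ⟨φ, -⟩ := h.2
  refine ⟨D'', h1, ?_, fun hm => (h3 hm).same _ _ h⟩
  rwa [numVertices, numVertices, ← Nat.card_congr φ]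

theorem isReducible_of_replacesPropagator {E D' : Diagram} (hD : D.IsMaximal)
    (hE : E.IsInsertable) (h : ReplacesPropagator E D' D) (hm : Melonic D' → Melonic D) :
    D.IsReducible := by
  refine ⟨D', (h.isMaximal_iff hE).2 hD, ?_, hm⟩
  have hpos : 0 < E.numVertices := by
    obtain ⟨v, -⟩ := hE.conn.1
    have : Nonempty E.V := ⟨v⟩
    exact Nat.card_pos
  have := h.numVertices
  omega

theorem isReducible_of_closedSnail {k : Interaction} {D' : Diagram} (hD : D.IsMaximal)
    (h : ReplacesPropagator (closedSnail k) D' D) : D.IsReducible := by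
  refine isReducible_of_replacesPropagator hD (isInsertable_closedSnail k) h fun hm => ?_
  cases k
  · exact .prismMove _ _ hm (Or.inl h)
  · exact .wheelMove _ _ hm (Or.inl h)

theorem isReducible_of_closedMelon {k : Interaction} {D' : Diagram} (hD : D.IsMaximal)
    (h : ReplacesPropagator (closedMelon k) D' D) : D.IsReducible := by
  refine isReducible_of_replacesPropagator hD (isInsertable_closedMelon k) h fun hm => ?_
  cases k
  · exact .prismMove _ _ hm (Or.inr (Or.inl h))
  · exact .wheelMove _ _ hm (Or.inr h)

theorem isReducible_of_expandsVertex {D' : Diagram} (hD : D.IsMaximal)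
    (h : ExpandsVertex D' D) : D.IsReducible :=
  ⟨D', h.isMaximal_iff.2 hD, by rw [h.numVertices]; exact Nat.lt_succ_self _,
    fun hm => .prismMove _ _ hm (Or.inr (Or.inr h))⟩

theorem isReducible_of_snail (hD : D.IsMaximal) (hc : D.circles = 0) {v : D.V}
    {s : Perm Field6} (hs : IsSnailPairing (D.kind v) s) {a : Field6}
    (hw : ∀ i, i ≠ a → i ≠ s a → D.wick (v, i) = (v, s i)) : D.IsReducible := by
  obtain ⟨α, hα, rfl⟩ := hs
  obtain ⟨γ, hsame, hγ⟩ := D.exists_relabel_same (ι := fun _ : Unit => v) (fun _ _ _ => rfl)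
    (β := fun _ => α⁻¹) fun _ => hα.inv
  have hγv : γ v = α⁻¹ := hγ ()
  obtain ⟨D', h⟩ := exists_replacesPropagator (D := D.relabel γ) (E := closedSnail (D.kind v)) hc
    (fun _ => v) (fun _ _ _ => rfl) (fun _ => rfl) ((), α⁻¹ a) (by
      rintro ⟨⟨⟩, i⟩ h1 h2
      have := relabel_wick γ (hw (α i) (fun e => h1 (by rw [← e]; simp)) fun e => h2
        (Prod.ext rfl (α.injective e)))
      rw [hγv] at this
      change (D.relabel γ).wick (v, i) = (v, snailPairing (D.kind v) i)
      simpa using this)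
  exact (isReducible_of_closedSnail (hsame.isMaximal_iff.2 hD) h).of_same hsame

theorem isReducible_of_melon (hD : D.IsMaximal) (hc : D.circles = 0) {L R : D.V} (hLR : L ≠ R)
    (hk : D.kind L = D.kind R) {ρ : Perm Field6} (hρ : IsAutomorphism (D.kind R) ρ) {a : Field6}
    (hw : ∀ i, i ≠ a → D.wick (L, i) = (R, ρ i)) : D.IsReducible := by
  let ι (b : Bool) : D.V := bif b then R else L
  have hι : ι.Injective := by
    rintro (_ | _) (_ | _) e
    exacts [rfl, absurd e hLR, absurd e.symm hLR, rfl]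
  obtain ⟨γ, hsame, hγ⟩ := D.exists_relabel_same hι (β := fun b => bif b then ρ⁻¹ else 1) (by
    rintro (_ | _)
    exacts [isAutomorphism_one _, hρ.inv])
  have hγL : γ L = 1 := hγ false
  have hγR : γ R = ρ⁻¹ := hγ true
  have hw' : ∀ i, i ≠ a → (D.relabel γ).wick (L, i) = (R, i) := fun i hi => by
    have := relabel_wick γ (hw i hi)
    rw [hγR, hγL] at this
    simpa using this
  obtain ⟨D', h⟩ := exists_replacesPropagator (D := D.relabel γ) (E := closedMelon (D.kind L)) hc
    ι hι (by rintro (_ | _); exacts [rfl, hk.symm]) (false, a) (by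
      rintro ⟨_ | _, i⟩ h1 h2
      · exact hw' i fun e => h1 (by rw [e])
      · exact (congrArg (D.relabel γ).wick (hw' i fun e => h2 (by rw [e]; rfl))).symm.trans
          ((D.relabel γ).wick_wick _))
  exact (isReducible_of_closedMelon (hsame.isMaximal_iff.2 hD) h).of_same hsame

end Diagram

/-- An automorphism of the prism that moves the field `i` to the left side. -/
def moveLeft (i : Field6) : Perm Field6 := if IsRight i then snailPairing prism else 1

theorem isAutomorphism_moveLeft (i : Field6) : IsAutomorphism prism (moveLeft i) := by
  rw [moveLeft]
  split_ifs
  · decide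
  · exact isAutomorphism_one _

theorem moveLeft_triangle {x z t : Field6} (hxz : x ≠ z) (htx : t ≠ x) (htz : t ≠ z)
    (y w t' : Field6)
    (h : ∀ c, edge prism c x = z ∧ edge prism c y = w ∨
      edge prism c x = t ∧ edge prism c y = t' ∨ edge prism c z = t ∧ edge prism c w = t') :
    moveLeft x x = moveLeft y y ∧ moveLeft x z = moveLeft y w ∧ moveLeft x t = moveLeft y t' ∧
      ∀ i, ¬ IsRight i → i = moveLeft x x ∨ i = moveLeft x z ∨ i = moveLeft x t := by
  revert x z t y w t'; decide +kernel

namespace Diagram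

variable {D : Diagram}

theorem isReducible_of_triangle (hD : D.IsMaximal) {L R : D.V} (hLR : L ≠ R)
    (hL : D.kind L = prism) (hR : D.kind R = prism) {x z t y w t' : Field6} (hxz : x ≠ z)
    (htx : t ≠ x) (htz : t ≠ z)
    (h : ∀ c, edge prism c x = z ∧ edge prism c y = w ∨
      edge prism c x = t ∧ edge prism c y = t' ∨ edge prism c z = t ∧ edge prism c w = t')
    (hxy : D.wick (L, x) = (R, y)) (hzw : D.wick (L, z) = (R, w))
    (htt : D.wick (L, t) = (R, t')) : D.IsReducible := by
  obtain ⟨ex, ez, et, hleft⟩ := moveLeft_triangle hxz htx htz y w t' h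
  have hι : Function.Injective fun b : Bool => bif b then R else L := by
    rintro (_ | _) (_ | _) e
    exacts [rfl, absurd e hLR, absurd e.symm hLR, rfl]
  obtain ⟨γ, hsame, hγ⟩ := D.exists_relabel_same hι
    (β := fun b => bif b then moveLeft y else moveLeft x) (by
      rintro (_ | _)
      · exact hL ▸ isAutomorphism_moveLeft x
      · exact hR ▸ isAutomorphism_moveLeft y)
  have hγL : γ L = moveLeft x := hγ false
  have hγR : γ R = moveLeft y := hγ true
  have hrung {p q : Field6} (hpq : D.wick (L, p) = (R, q)) (e : moveLeft x p = moveLeft y q) :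
      (D.relabel γ).wick (L, moveLeft x p) = (R, moveLeft x p) := by
    have := relabel_wick γ hpq
    rwa [hγR, hγL, ← e] at this
  obtain ⟨D', hD'⟩ := exists_expandsVertex (D := D.relabel γ) hLR hL hR fun i hi => by
    rcases hleft i hi with rfl | rfl | rfl
    exacts [hrung hxy ex, hrung hzw ez, hrung htt et]
  exact (isReducible_of_expandsVertex (hsame.isMaximal_iff.2 hD) hD').of_same hsame

theorem exists_colour_not_opposite_leg (S : Set D.V) :
    ∃ c, (D.legs S).Nonempty → ∃ g ∈ D.legs S, ∀ x, ∃ c',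
      ¬ (edge (D.kind g.1) c' x = edge (D.kind g.1) c x ∨ edge (D.kind g.1) c' x = g.2 ∨
        edge (D.kind g.1) c' (edge (D.kind g.1) c x) = g.2) := by
  rcases (D.legs S).eq_empty_or_nonempty with hl | ⟨g, hg⟩
  · exact ⟨red, fun h => absurd hl h.ne_empty⟩
  · obtain ⟨c, hc⟩ := exists_colour_not_opposite (D.kind g.1) g.2
    exact ⟨c, fun _ => ⟨g, hg, hc⟩⟩

theorem IsSmallest.isReducible_of_isomorphism {S : Set D.V} (hS : D.IsSmallest S)
    (hD : D.IsMaximal) (hconn : D.ConnectedOn Set.univ) (hc : D.circles = 0) {L R : D.V}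
    (hLR : L ≠ R) (hA : {L, R} ⊆ S) {ρ : Field6 → Field6}
    (hρ : ∀ i, D.Twin {L, R} (L, i) (R, ρ i))
    (he : ∀ c i, ρ (edge (D.kind L) c i) = edge (D.kind R) c (ρ i)) : D.IsReducible := by
  have hinj : ρ.Injective := fun i j e => by
    have htwin := (hρ j).symm
    rw [← e] at htwin
    exact congrArg Prod.snd ((hρ i).symm.unique htwin)
  obtain ⟨hk, σ, hσ, e⟩ := exists_isAutomorphism_of_forall_map_edge hinj he
  obtain ⟨a, ha⟩ := hS.exists_forall_wick_eq hconn hA hρ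
  exact isReducible_of_melon hD hc hLR hk hσ fun i hi =>
    (ha i hi fun e => hLR (congrArg Prod.fst e)).trans (by rw [e])

theorem IsMaximal.isReducible (h : D.IsMaximal) [Nonempty D.V] : D.IsReducible := by
  obtain ⟨hD, hc⟩ := h.isPlanar
  obtain ⟨S, hS⟩ := D.exists_isSmallest
  by_cases hsnail : ∃ v ∈ S, ∃ s, D.IsSnailVertex v s
  · obtain ⟨v, hv, s, hs, ht⟩ := hsnail
    obtain ⟨a, ha⟩ := hS.exists_forall_wick_eq hD.conn (Set.singleton_subset_iff.2 hv) ht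
    exact isReducible_of_snail h hc hs fun i hia his =>
      ha i hia fun e => his (congrArg Prod.snd e)
  have hreg : ∀ v ∈ S, D.IsRegular v := fun v hv =>
    (hD.isRegular_or_isSnailVertex v).resolve_right fun hs => hsnail ⟨v, hv, hs⟩
  obtain ⟨c, hopp⟩ := exists_colour_not_opposite_leg S
  obtain ⟨L, R, x, y, hL, hR, hLR⟩ := hS.exists_isTwoCycle hD hreg c
  have hA : {L, R} ⊆ S := Set.pair_subset hL hR
  rcases hLR.exists_isomorphism_or_exists_triangle hD (hreg L hL) (hreg R hR) with
    ⟨ρ, hρ, he⟩ | ⟨t, t', htx, htz, ht, he⟩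
  · exact hS.isReducible_of_isomorphism h hD.conn hc hLR.ne hA hρ he
  · have hLt (c') := (he c').imp And.left (Or.imp And.left And.left)
    have hRt (c') := (he c').imp And.right (Or.imp And.right And.right)
    have hkL := eq_prism_of_forall_edge_mem_triangle hLR.field_ne hLt
    have hkR := eq_prism_of_forall_edge_mem_triangle hLR.field_ne' hRt
    -- Otherwise the third side is the pair of legs of `S`, which `c` was chosen to exclude.
    have htt : D.wick (L, t) = (R, t') := by
      by_contra hne
      have hlegs := hS.legs_eq_of_twin hD.conn hA ht hne
      obtain ⟨g, hg, hg'⟩ := hopp (hlegs ▸ Set.insert_nonempty _ _)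
      rcases hlegs ▸ hg with rfl | rfl
      · exact (hg' x).elim fun c' hc' => hc' (hLt c')
      · exact (hg' y).elim fun c' hc' => hc' (hRt c')
    refine isReducible_of_triangle h hLR.ne hkL hkR hLR.field_ne htx htz (fun c' => ?_)
      hLR.wick_fst hLR.wick_snd htt
    simpa only [hkL, hkR] using he c'

end Diagram

theorem melonic_of_isMaximal {D : Diagram} (h : D.IsMaximal) : Melonic D := by
  induction hn : D.numVertices using Nat.strong_induction_on generalizing D with
  | _ n ih =>
    by_cases hV : Nonempty D.V
    · obtain ⟨D', h1, h2, h3⟩ := h.isReducible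
      exact h3 (ih _ (hn ▸ h2) h1 rfl)
    · exact .zeroCycle D (h.1.resolve_right fun h => hV h.1)

/-! ### The forms of mixed 2-cycles -/

theorem IsColourSymmetry.edge_apply {k : Interaction} {π : Perm Colour} {α : Perm Field6}
    (h : IsColourSymmetry k π α) (c : Colour) (i : Field6) :
    edge k (π c) (α i) = α (edge k c i) := by
  rw [← h c]; simp

theorem IsColourSymmetry.mul {k : Interaction} {π π' : Perm Colour} {α α' : Perm Field6}
    (h : IsColourSymmetry k π α) (h' : IsColourSymmetry k π' α') :
    IsColourSymmetry k (π * π') (α * α') := fun c => by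
  rw [Perm.mul_apply, ← h, ← h']
  group

theorem EquivalentMixed.trans {x y z w x' y' z' w' x'' y'' z'' w'' : Field6}
    (h : EquivalentMixed x y z w x' y' z' w') (h' : EquivalentMixed x' y' z' w' x'' y'' z'' w'') :
    EquivalentMixed x y z w x'' y'' z'' w'' := by
  obtain ⟨π, α, β, h1, h2, rfl, rfl, rfl, rfl⟩ := h
  obtain ⟨π', α', β', h1', h2', rfl, rfl, rfl, rfl⟩ := h'
  exact ⟨π' * π, α' * α, β' * β, h1'.mul h1, h2'.mul h2, rfl, rfl, rfl, rfl⟩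

/-- The form of a mixed 2-cycle read off from the adjacency of its fields in the two interaction
graphs, which makes it visibly invariant under equivalence. -/
def mixedForm (x y z w : Field6) : MixedForm :=
  if ∀ c, edge prism c x ≠ z then .form2
  else if ∃ a b, edge prism a (edge prism b x) = z then .form1
  else if ∀ c, edge wheel c y ≠ w then .form4
  else if ∃ c, edge prism c x = z ∧ edge wheel c y = w then .form5
  else .form3

theorem EquivalentMixed.mixedForm_eq {x y z w x' y' z' w' : Field6}
    (h : EquivalentMixed x y z w x' y' z' w') : mixedForm x y z w = mixedForm x' y' z' w' := by
  obtain ⟨π, α, β, h1, h2, rfl, rfl, rfl, rfl⟩ := h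
  have e1 : (∀ c, edge prism c (α x) ≠ α z) ↔ ∀ c, edge prism c x ≠ z := by
    refine (π.forall_congr_right (q := fun c => edge prism c (α x) ≠ α z)).symm.trans ?_
    simp only [h1.edge_apply, ne_eq, EmbeddingLike.apply_eq_iff_eq]
  have e2 : (∃ a b, edge prism a (edge prism b (α x)) = α z) ↔
      ∃ a b, edge prism a (edge prism b x) = z := by
    refine (π.exists_congr_right
      (q := fun a => ∃ b, edge prism a (edge prism b (α x)) = α z)).symm.trans
      (exists_congr fun a => ?_)
    refine (π.exists_congr_right
      (q := fun b => edge prism (π a) (edge prism b (α x)) = α z)).symm.trans ?_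
    simp only [h1.edge_apply, EmbeddingLike.apply_eq_iff_eq]
  have e3 : (∀ c, edge wheel c (β y) ≠ β w) ↔ ∀ c, edge wheel c y ≠ w := by
    refine (π.forall_congr_right (q := fun c => edge wheel c (β y) ≠ β w)).symm.trans ?_
    simp only [h2.edge_apply, ne_eq, EmbeddingLike.apply_eq_iff_eq]
  have e4 : (∃ c, edge prism c (α x) = α z ∧ edge wheel c (β y) = β w) ↔
      ∃ c, edge prism c x = z ∧ edge wheel c y = w := by
    refine (π.exists_congr_right
      (q := fun c => edge prism c (α x) = α z ∧ edge wheel c (β y) = β w)).symm.trans ?_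
    simp only [h1.edge_apply, h2.edge_apply, EmbeddingLike.apply_eq_iff_eq]
  rw [mixedForm, mixedForm]
  simp only [e1, e2, e3, e4]

theorem HasForm.mixedForm_eq {x y z w : Field6} {n : MixedForm} (h : HasForm x y z w n) :
    mixedForm x y z w = n := by
  have e1 : ¬ ∀ c, edge prism c 1 ≠ 6 := by decide
  have e2 : ¬ ∃ a b, edge prism a (edge prism b 1) = 6 := by decide
  cases n with
  | form1 =>
    obtain ⟨W, h⟩ := h
    rw [h.mixedForm_eq, mixedForm, if_neg (by decide), if_pos (by decide)]
  | form2 =>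
    obtain ⟨W, h⟩ := h
    rw [h.mixedForm_eq, mixedForm, if_pos (by decide)]
  | form3 =>
    rw [EquivalentMixed.mixedForm_eq h, mixedForm, if_neg e1, if_neg e2, if_neg (by decide),
      if_neg (by decide)]
  | form4 =>
    rw [EquivalentMixed.mixedForm_eq h, mixedForm, if_neg e1, if_neg e2, if_pos (by decide)]
  | form5 =>
    rw [EquivalentMixed.mixedForm_eq h, mixedForm, if_neg e1, if_neg e2, if_neg (by decide),
      if_pos (by decide)]

theorem exists_isColourSymmetry_prism {x z : Field6} (h : x ≠ z) :
    ∃ π α, IsColourSymmetry prism π α ∧ α x = 1 ∧ (α z = 2 ∨ α z = 4 ∨ α z = 6) := by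
  let symmetries : List (Perm Colour × Perm Field6) := do
    let f ← [(1, 1), (swap green blue, swap 2 3 * swap 4 5)]
    let g ← [(1, 1), (swap red green, swap 1 3 * swap 4 6), (swap red blue, swap 1 2 * swap 5 6)]
    let h ← [(1, 1), (1, snailPairing prism)]
    return f * g * h
  obtain ⟨p, -, hp⟩ : ∃ p ∈ symmetries,
      IsColourSymmetry prism p.1 p.2 ∧ p.2 x = 1 ∧ (p.2 z = 2 ∨ p.2 z = 4 ∨ p.2 z = 6) := by
    revert x z; decide +kernel
  exact ⟨p.1, p.2, hp⟩

theorem exists_isAutomorphism_wheel (y : Field6) : ∃ β, IsAutomorphism wheel β ∧ β y = 1 := by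
  obtain ⟨β, -, hβ⟩ : ∃ β ∈ [1, wheelRotation, wheelRotation⁻¹, snailPairing wheel,
      wheelRotation * snailPairing wheel, wheelRotation⁻¹ * snailPairing wheel],
      IsAutomorphism wheel β ∧ β y = 1 := by
    revert y; decide +kernel
  exact ⟨β, hβ⟩

theorem exists_isColourSymmetry_wheel (π : Perm Colour) :
    ∃ β, IsColourSymmetry wheel π β ∧ β 1 = 1 := by
  let σ : Perm Field6 := swap 2 4 * swap 3 5
  let τ : Perm Field6 := swap 2 6 * swap 3 5
  obtain ⟨β, -, hβ⟩ : ∃ β ∈ [1, σ, τ, σ * τ, τ * σ, σ * τ * σ],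
      IsColourSymmetry wheel π β ∧ β 1 = 1 := by
    revert π; decide +kernel
  exact ⟨β, hβ⟩

theorem exists_isColourSymmetry_of_ne_one {v : Field6} (hv : v ≠ 1) :
    ∃ π α β, IsColourSymmetry prism π α ∧ IsColourSymmetry wheel π β ∧ α 1 = 1 ∧ β 1 = 1 ∧
      α 6 = 6 ∧ (β v = 2 ∨ β v = 3 ∨ β v = 6) := by
  obtain ⟨π, -, α, -, β, -, h⟩ : ∃ π ∈ [1, swap green blue], ∃ α ∈ [1, swap 2 3 * swap 4 5],
      ∃ β ∈ [1, swap 2 4 * swap 3 5], IsColourSymmetry prism π α ∧ IsColourSymmetry wheel π β ∧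
        α 1 = 1 ∧ β 1 = 1 ∧ α 6 = 6 ∧ (β v = 2 ∨ β v = 3 ∨ β v = 6) := by
    revert v; decide +kernel
  exact ⟨π, α, β, h⟩

theorem exists_hasForm {x y z w : Field6} (hxz : x ≠ z) (hyw : y ≠ w) : ∃ n, HasForm x y z w n := by
  obtain ⟨π, α, hα, hx, hz⟩ := exists_isColourSymmetry_prism hxz
  obtain ⟨β, hβ, hy⟩ := exists_isAutomorphism_wheel y
  obtain ⟨γ, hγ, h1⟩ := exists_isColourSymmetry_wheel π
  have he : EquivalentMixed x y z w 1 1 (α z) ((γ * β) w) :=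
    ⟨π, α, γ * β, hα, by simpa using hγ.mul hβ, hx, by rw [Perm.mul_apply, hy, h1], rfl, rfl⟩
  have hw : (γ * β) w ≠ 1 := by
    rw [← h1, ← hy, Perm.mul_apply, Ne, γ.injective.eq_iff, β.injective.eq_iff]
    exact hyw.symm
  rcases hz with hz | hz | hz <;> rw [hz] at he
  · exact ⟨.form1, _, he⟩
  · exact ⟨.form2, _, he⟩
  · obtain ⟨π', α', β', h1, h2, h3, h4, h5, h | h | h⟩ := exists_isColourSymmetry_of_ne_one hw
    · exact ⟨.form3, he.trans ⟨π', α', β', h1, h2, h3, h4, h5, h⟩⟩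
    · exact ⟨.form4, he.trans ⟨π', α', β', h1, h2, h3, h4, h5, h⟩⟩
    · exact ⟨.form5, he.trans ⟨π', α', β', h1, h2, h3, h4, h5, h⟩⟩

theorem existsUnique_hasForm {x y z w : Field6} (hxz : x ≠ z) (hyw : y ≠ w) :
    ∃! n, HasForm x y z w n := by
  obtain ⟨n, hn⟩ := exists_hasForm hxz hyw
  exact ⟨n, hn, fun m hm => hm.mixedForm_eq.symm.trans hn.mixedForm_eq⟩

theorem IsSnailPairing.exists_edge {k : Interaction} {s : Perm Field6} (h : IsSnailPairing k s)
    (i : Field6) : ∃ c, edge k c i = s i := by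
  obtain ⟨α, hα, rfl⟩ := h
  obtain ⟨i, rfl⟩ := α.surjective i
  obtain ⟨c, hc⟩ : ∃ c, edge k c i = snailPairing k i := by
    clear hα; revert k i; decide
  exact ⟨c, by rw [edge_of_isAutomorphism hα, hc]; simp⟩

theorem IsSnailPairing.edge_edge_ne {s : Perm Field6} (h : IsSnailPairing prism s)
    (i : Field6) (a b : Colour) : edge prism a (edge prism b i) ≠ s i := by
  obtain ⟨α, hα, rfl⟩ := h
  obtain ⟨i, rfl⟩ := α.surjective i
  rw [edge_of_isAutomorphism hα, edge_of_isAutomorphism hα]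
  have : edge prism a (edge prism b i) ≠ snailPairing prism i := by revert i a b; decide
  simpa using this

theorem IsSnailPairing.ne {k : Interaction} {s : Perm Field6} (h : IsSnailPairing k s)
    (i : Field6) : s i ≠ i := by
  obtain ⟨c, hc⟩ := h.exists_edge i
  rw [← hc]
  exact edge_ne k c i

theorem mixedForm_three_or_five_iff {x y z w : Field6} :
    mixedForm x y z w = .form3 ∨ mixedForm x y z w = .form5 ↔
      (∃ c, edge prism c x = z) ∧ (¬ ∃ a b, edge prism a (edge prism b x) = z) ∧
        ∃ c, edge wheel c y = w := by
  rw [mixedForm]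
  split_ifs with hx hxx hy hxy <;> simp_all

theorem exists_isSnailPairing_prism_iff {x z : Field6} :
    (∃ s, IsSnailPairing prism s ∧ s x = z) ↔
      (∃ c, edge prism c x = z) ∧ ¬ ∃ a b, edge prism a (edge prism b x) = z := by
  constructor
  · rintro ⟨s, hs, rfl⟩
    exact ⟨hs.exists_edge x, fun ⟨a, b, e⟩ => hs.edge_edge_ne x a b e⟩
  · intro h
    refine ⟨snailPairing prism, ⟨1, isAutomorphism_one _, by simp⟩, ?_⟩
    revert x z; decide

theorem exists_isSnailPairing_wheel_iff {y w : Field6} :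
    (∃ t, IsSnailPairing wheel t ∧ t y = w) ↔ ∃ c, edge wheel c y = w := by
  constructor
  · rintro ⟨t, ht, rfl⟩
    exact ht.exists_edge y
  · rintro ⟨c, rfl⟩
    obtain ⟨α, -, h1, h2⟩ : ∃ α ∈ [1, wheelRotation, wheelRotation⁻¹], IsAutomorphism wheel α ∧
        (α * snailPairing wheel * α⁻¹) y = edge wheel c y := by
      revert y c; decide +kernel
    exact ⟨_, ⟨α, h1, rfl⟩, h2⟩

theorem hasForm_three_or_five_iff {x y z w : Field6} :
    HasForm x y z w .form3 ∨ HasForm x y z w .form5 ↔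
      (∃ s, IsSnailPairing prism s ∧ s x = z) ∧ ∃ t, IsSnailPairing wheel t ∧ t y = w := by
  have hform : (∃ s, IsSnailPairing prism s ∧ s x = z) ∧ (∃ t, IsSnailPairing wheel t ∧ t y = w) ↔
      mixedForm x y z w = .form3 ∨ mixedForm x y z w = .form5 := by
    rw [exists_isSnailPairing_prism_iff, exists_isSnailPairing_wheel_iff,
      mixedForm_three_or_five_iff, and_assoc]
  refine ⟨fun h => hform.2 (h.imp HasForm.mixedForm_eq HasForm.mixedForm_eq), fun h => ?_⟩
  obtain ⟨⟨s, hs, rfl⟩, t, ht, rfl⟩ := h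
  obtain ⟨n, hn⟩ := exists_hasForm (hs.ne x).symm (ht.ne y).symm
  refine (hform.1 ⟨⟨s, hs, rfl⟩, t, ht, rfl⟩).imp (fun h => ?_) fun h => ?_ <;>
    exact (hn.mixedForm_eq.symm.trans h) ▸ hn

/-! ### Maximal diagrams with mixed 2-cycles -/

/-- One end of the cut propagator of each of the two snails in `doubleSnail`: the prism is the
vertex `false` and the wheel the vertex `true`. -/
def doubleSnailLeg (p q : Field6) (b : Bool) : Field6 := bif b then q else p

/-- The interactions of the two vertices of `doubleSnail`. -/
def doubleSnailKind (b : Bool) : Interaction := bif b then wheel else prism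

/-- The contractions of `doubleSnail`. -/
def doubleSnailWick (p q : Field6) (h : Bool × Field6) : Bool × Field6 :=
  if h.2 = doubleSnailLeg p q h.1 then (!h.1, doubleSnailLeg p q !h.1)
  else if h.2 = snailPairing (doubleSnailKind h.1) (doubleSnailLeg p q h.1) then
    (!h.1, snailPairing (doubleSnailKind !h.1) (doubleSnailLeg p q !h.1))
  else (h.1, snailPairing (doubleSnailKind h.1) h.2)

/-- The closed prism snail with the propagator at its field `p` replaced by the wheel snail cut at
its field `q`. -/
def doubleSnail (p q : Field6) : Diagram where
  V := Bool
  finite := inferInstance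
  kind := doubleSnailKind
  wick := doubleSnailWick p q
  wick_wick := by revert p q; decide +kernel
  wick_ne := by revert p q; decide +kernel
  circles := 0

theorem isMaximal_closedSnail (k : Interaction) : (closedSnail k).IsMaximal :=
  have h := isInsertable_closedSnail k
  isMaximal_iff.2 ⟨connected_iff.2 (Or.inr ⟨h.circles, h.conn⟩), h.fTotal⟩

theorem replacesPropagator_doubleSnail (p q : Field6) :
    ReplacesPropagator (closedSnail wheel) (closedSnail prism) (doubleSnail p q) := by
  refine ⟨Equiv.boolEquivPUnitSumPUnit.symm, fun _ => rfl, fun _ => rfl,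
    Or.inl ⟨rfl, ((), p), ((), q), ?_, ?_, ?_, ?_⟩⟩
  · exact if_pos rfl
  · exact (if_neg (snailPairing_ne _ _)).trans (if_pos rfl)
  · rintro ⟨⟨⟩, i⟩ h1 h2
    exact (if_neg fun e => h1 (Prod.ext rfl e)).trans (if_neg fun e => h2 (Prod.ext rfl e))
  · rintro ⟨⟨⟩, i⟩ h1 h2
    exact (if_neg fun e => h1 (Prod.ext rfl e)).trans (if_neg fun e => h2 (Prod.ext rfl e))

theorem isMaximal_doubleSnail (p q : Field6) : (doubleSnail p q).IsMaximal :=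
  ((replacesPropagator_doubleSnail p q).isMaximal_iff (isInsertable_closedSnail wheel)).1
    (isMaximal_closedSnail prism)

theorem exists_isMixedTwoCycle {x y : Field6} {s t : Perm Field6} (hs : IsSnailPairing prism s)
    (ht : IsSnailPairing wheel t) : ∃ (D : Diagram) (L R : D.V), D.IsMaximal ∧
      D.IsMixedTwoCycle L R x y (s x) (t y) := by
  have hne := hs.ne x
  obtain ⟨α, hα, rfl⟩ := hs
  obtain ⟨β, hβ, rfl⟩ := ht
  obtain ⟨x, rfl⟩ := α.surjective x
  obtain ⟨y, rfl⟩ := β.surjective y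
  let γ (b : (doubleSnail x y).V) : Perm Field6 := bif b then β else α
  have h1 : (doubleSnail x y).wick (false, x) = (true, y) := if_pos rfl
  have h2 : (doubleSnail x y).wick (false, snailPairing prism x) = (true, snailPairing wheel y) :=
    (if_neg (snailPairing_ne _ _)).trans (if_pos rfl)
  refine ⟨(doubleSnail x y).relabel γ, false, true,
    (Same.isMaximal_iff (relabel_same γ ?_)).2 (isMaximal_doubleSnail x y), rfl, rfl, hne.symm,
    relabel_wick γ h1, ?_⟩
  · rintro (_ | _)
    · exact hα
    · exact hβ
  · have := relabel_wick γ h2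
    rwa [show (α * snailPairing prism * α⁻¹) (α x) = α (snailPairing prism x) by simp,
      show (β * snailPairing wheel * β⁻¹) (β y) = β (snailPairing wheel y) by simp]

end PrismWheel

theorem mainTheorem8 :
    -- every mixed 2-cycle falls under exactly one of the five forms
    (∀ x y z w : PrismWheel.Field6, x ≠ z → y ≠ w → ∃! n, PrismWheel.HasForm x y z w n) ∧
    -- the allowed 1-cycles are those of the two separate theories: they are snails
    (∀ D : PrismWheel.Diagram, D.IsMaximal → ∀ (v : D.V) (x y : PrismWheel.Field6),
      D.IsOneCycle v x y → D.IsSnailForm v x y) ∧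
    -- a mixed 2-cycle of a maximal diagram is of the third or fifth form, is a double snail, and
    -- yields no elementary melon
    (∀ D : PrismWheel.Diagram, D.IsMaximal → ∀ (L R : D.V) (x y z w : PrismWheel.Field6),
      D.IsMixedTwoCycle L R x y z w →
        (PrismWheel.HasForm x y z w .form3 ∨ PrismWheel.HasForm x y z w .form5) ∧
        D.IsDoubleSnail L R x y z w ∧ ¬ D.IsMelonForm L R x y z w) ∧
    -- the third and fifth forms occur in maximal diagrams
    (∀ x y z w : PrismWheel.Field6,
      (PrismWheel.HasForm x y z w .form3 ∨ PrismWheel.HasForm x y z w .form5) →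
        ∃ (D : PrismWheel.Diagram) (L R : D.V), D.IsMaximal ∧ D.IsMixedTwoCycle L R x y z w) ∧
    -- the maximal diagrams are exactly those generated by the moves of the separate theories
    (∀ D : PrismWheel.Diagram, D.IsMaximal ↔ PrismWheel.Melonic D) := by
  refine ⟨fun x y z w => PrismWheel.existsUnique_hasForm, ?_, ?_, ?_, ?_⟩
  · intro D hD v x y h
    have : Nonempty D.V := ⟨v⟩
    exact hD.isPlanar.1.isSnailForm h
  · intro D hD L R x y z w h
    have : Nonempty D.V := ⟨L⟩
    obtain ⟨s, t, hs, ht⟩ := hD.isPlanar.1.exists_isSnailVertex_of_isMixedTwoCycle h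
    exact ⟨PrismWheel.hasForm_three_or_five_iff.2
        ⟨⟨s, h.1 ▸ hs.1, h.isTwoCycle.isSnailVertex_apply hs⟩,
          t, h.2.1 ▸ ht.1, h.isTwoCycle.symm.isSnailVertex_apply ht⟩,
      h.isTwoCycle.isDoubleSnail hs ht, h.isTwoCycle.not_isMelonForm hs⟩
  · intro x y z w h
    obtain ⟨⟨s, hs, rfl⟩, t, ht, rfl⟩ := PrismWheel.hasForm_three_or_five_iff.1 h
    exact PrismWheel.exists_isMixedTwoCycle hs ht
  · exact fun D => ⟨PrismWheel.melonic_of_isMaximal, fun h => h.isMaximal⟩
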